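/- Let $\mathbb{G}$ be a finite quantum group, i.e. $\mathscr{A}=\mathrm{C}(\mathbb{G})$ is a finite-dimensional $\mathrm{C}^*$-algebra with the structure of a Hopf $*$-algebra with coproduct $\Delta$, counit $\epsilon$, antipode $S$. Let $h$ be its Haar state and $\eta$ its Haar element (the element with $\epsilon(\eta)=1$ and $a\eta=\epsilon(a)\eta$ for all $a$). Equip $\mathscr{A}$ with the convolution product $a\star b=(h\otimes\mathrm{id})\bigl(((S\otimes\mathrm{id})\Delta(b))(a\otimes 1)\bigr)$ and the convolution adjoint $a^\bullet=S(a^*)$. The dual quantum group $\hat{\mathbb{G}}$ is given by $\mathrm{C}(\hat{\mathbb{G}})=\mathscr{A}^*$ with product $\omega_1\omega_2=(\omega_1\otimes\omega_2)\circ\Delta$, unit $\epsilon$, involution $\omega^*(a)=\overline{\omega(S(a)^*)}$, coproduct $\hat\Delta(\omega)(a\otimes b)=\omega(ab)$, counit $\omega\mapsto\omega(1)$ and antipode $\hat S(\omega)=\omega\circ S$; the Fourier transform is $\mathscr{F}\colon\mathscr{A}\to\mathscr{A}^*$, $\mathscr{F}(a)=h(\,\cdot\,a)$, and $\hat{\mathscr{F}}$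 denotes the Fourier transform of $\hat{\mathbb{G}}$, where $\mathscr{A}^{**}$ is identified with $\mathscr{A}$. For a unital $\mathrm{C}^*$-algebra $\mathsf{B}$, a linear map $\alpha\colon\mathrm{C}(\mathbb{G})\to\mathrm{C}(\mathbb{G})\otimes\mathsf{B}$ represents a quantum family of automorphisms of $\mathbb{G}$ if it is a unital $*$-homomorphism, $\alpha(\mathrm{C}(\mathbb{G}))(1\otimes\mathsf{B})$ spans $\mathrm{C}(\mathbb{G})\otimes\mathsf{B}$, $\alpha$ is multiplicative for $\star$ (with $\star$ on the first leg and the product of $\mathsf{B}$ on the second leg of the target), $(\bullet\otimes *)\circ\alpha=\alpha\circ\bullet$, and $\alpha(\eta)=\eta\otimes 1$. The quantum automorphism group $\mathrm{qAut}(\mathbb{G})$ is a compact quantum group (in the sense of Woronowicz, with spatial tensor products) together with an action $\alpha_u\colon\mathrm{C}(\mathbb{G})\to\mathrm{C}(\mathbb{G})\otimes\mathrm{C}(\mathrm{qAut}(\mathbb{G}))$ which represents a quantum family of automorphisms and is universal: every quantum family of automorphisms $\gamma\colon\mathrm{C}(\mathbb{G})\to\mathrm{C}(\mathbb{G})\otimes\mathsf{C}$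 is of the form $\gamma=(\mathrm{id}\otimes\Lambda)\circ\alpha_u$ for a unique unital $*$-homomorphism $\Lambda\colon\mathrm{C}(\mathrm{qAut}(\mathbb{G}))\to\mathsf{C}$. For linear $\alpha\colon\mathrm{C}(\mathbb{G})\to\mathrm{C}(\mathbb{G})\otimes\mathsf{B}$ put $$\hat\alpha=\tfrac{1}{h(\eta)}(\mathscr{F}\otimes\mathrm{id}_{\mathsf{B}})\circ\alpha\circ\hat{\mathscr{F}}\circ\hat S\colon\ \mathrm{C}(\hat{\mathbb{G}})\to\mathrm{C}(\hat{\mathbb{G}})\otimes\mathsf{B}.$$ Proposition. The quantum automorphism groups $\mathrm{qAut}(\mathbb{G})$ and $\mathrm{qAut}(\hat{\mathbb{G}})$ exist and are canonically isomorphic as compact quantum groups: if $\alpha_u$ and $\beta_u$ denote their universal actions on $\mathbb{G}$ and $\hat{\mathbb{G}}$, there is exactly one unital $*$-homomorphism $\Phi\colon\mathrm{C}(\mathrm{qAut}(\mathbb{G}))\to\mathrm{C}(\mathrm{qAut}(\hat{\mathbb{G}}))$ with $\beta_u=(\mathrm{id}\otimes\Phi)\circ\widehat{\alpha_u}$, and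 this $\Phi$ is a $*$-isomorphism satisfying $\Delta_{\mathrm{qAut}(\hat{\mathbb{G}})}\circ\Phi=(\Phi\otimes\Phi)\circ\Delta_{\mathrm{qAut}(\mathbb{G})}$. -/

import Mathlib

open scoped TensorProduct InnerProductSpace

universe u v

noncomputable section

namespace QuantumAut

/-! ### Completion of a `*`-algebra with respect to a C*-seminorm -/

/-- A C*-seminorm on a unital complex `*`-algebra. -/
structure CStarSeminorm (R : Type u) [Ring R] [StarRing R] [Algebra ℂ R] where
  toFun : R → ℝ
  add_le : ∀ x y, toFun (x + y) ≤ toFun x + toFun y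
  smul_eq : ∀ (c : ℂ) x, toFun (c • x) = ‖c‖ * toFun x
  mul_le : ∀ x y, toFun (x * y) ≤ toFun x * toFun y
  star_mul_self : ∀ x, toFun (star x * x) = toFun x * toFun x

namespace CStarSeminorm

section basic

variable {R : Type u} [Ring R] [StarRing R] [Algebra ℂ R] (p : CStarSeminorm R)

theorem toFun_zero : p.toFun 0 = 0 := by
  simpa using p.smul_eq 0 0

theorem toFun_neg (x : R) : p.toFun (-x) = p.toFun x := by
  simpa using p.smul_eq (-1) x

theorem nonneg (x : R) : 0 ≤ p.toFun x := by
  have h := p.add_le x (-x)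
  rw [add_neg_cancel, p.toFun_zero, p.toFun_neg] at h
  linarith

theorem le_star (x : R) : p.toFun x ≤ p.toFun (star x) := by
  have h := p.mul_le (star x) x
  rw [p.star_mul_self] at h
  rcases (p.nonneg x).eq_or_lt with h0 | h0
  · rw [← h0]; exact p.nonneg _
  · exact le_of_mul_le_mul_right h h0

theorem toFun_star (x : R) : p.toFun (star x) = p.toFun x :=
  le_antisymm (by simpa using p.le_star (star x)) (p.le_star x)

/-- A C*-seminorm is in particular a ring seminorm. -/
def ringSeminorm : RingSeminorm R where
  toFun := p.toFun
  map_zero' := p.toFun_zero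
  add_le' := p.add_le
  neg' := p.toFun_neg
  mul_le' := p.mul_le

/-- The algebra `R`, regarded as a seminormed ring by means of `p`. -/
def Carrier (_p : CStarSeminorm R) : Type u := R

instance : SeminormedRing p.Carrier := p.ringSeminorm.toSeminormedRing

instance : StarRing p.Carrier := inferInstanceAs (StarRing R)

instance : NormedAlgebra ℂ p.Carrier where
  __ := (inferInstanceAs (Algebra ℂ R) : Algebra ℂ p.Carrier)
  norm_smul_le c x := (p.smul_eq c x).le

instance : NormedStarGroup p.Carrier where
  norm_star_le x := (p.toFun_star x).le

/-- The Hausdorff completion of `R` with respect to `p`. -/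
def Completion : Type u := UniformSpace.Completion p.Carrier

instance : NormedRing p.Completion :=
  inferInstanceAs (NormedRing (UniformSpace.Completion p.Carrier))

instance : CompleteSpace p.Completion :=
  inferInstanceAs (CompleteSpace (UniformSpace.Completion p.Carrier))

instance : NormedAlgebra ℂ p.Completion where
  __ := (inferInstanceAs (Algebra ℂ (UniformSpace.Completion p.Carrier)) : Algebra ℂ p.Completion)
  norm_smul_le c x :=
    norm_smul_le (α := ℂ) (β := UniformSpace.Completion p.Carrier) c x

/-- The canonical map from `R` to its completion. -/
def toCompl (x : R) : p.Completion := ((show p.Carrier from x : p.Carrier) : UniformSpace.Completion p.Carrier)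

theorem norm_toCompl (x : R) : ‖p.toCompl x‖ = p.toFun x :=
  UniformSpace.Completion.norm_coe (show p.Carrier from x)

theorem toCompl_add (x y : R) : p.toCompl (x + y) = p.toCompl x + p.toCompl y :=
  UniformSpace.Completion.coe_add (show p.Carrier from x) (show p.Carrier from y)

theorem toCompl_mul (x y : R) : p.toCompl (x * y) = p.toCompl x * p.toCompl y :=
  UniformSpace.Completion.coe_mul (show p.Carrier from x) (show p.Carrier from y)

theorem toCompl_smul (c : ℂ) (x : R) : p.toCompl (c • x) = c • p.toCompl x :=
  UniformSpace.Completion.coe_smul c (show p.Carrier from x)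

theorem toCompl_algebraMap (c : ℂ) : p.toCompl (algebraMap ℂ R c) = algebraMap ℂ p.Completion c :=
  rfl

theorem denseRange_toCompl : DenseRange p.toCompl :=
  UniformSpace.Completion.denseRange_coe (α := p.Carrier)

theorem continuous_star_carrier : UniformContinuous (star : p.Carrier → p.Carrier) :=
  star_isometry.uniformContinuous

instance : Star p.Completion where
  star := UniformSpace.Completion.map (star : p.Carrier → p.Carrier)

theorem continuous_star_completion : Continuous (star : p.Completion → p.Completion) :=
  UniformSpace.Completion.continuous_map

theorem toCompl_star (x : R) : p.toCompl (star x) = star (p.toCompl x) :=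
  (UniformSpace.Completion.map_coe p.continuous_star_carrier (show p.Carrier from x)).symm

theorem induction_on {q : p.Completion → Prop} (x : p.Completion)
    (hc : IsClosed {x | q x}) (h : ∀ r, q (p.toCompl r)) : q x :=
  UniformSpace.Completion.induction_on (α := p.Carrier) x hc h

theorem induction_on_pair {q : p.Completion → p.Completion → Prop} (x y : p.Completion)
    (hc : IsClosed {z : p.Completion × p.Completion | q z.1 z.2})
    (h : ∀ r s, q (p.toCompl r) (p.toCompl s)) : q x y :=
  UniformSpace.Completion.induction_on₂ (α := p.Carrier) (β := p.Carrier) x y hc h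

instance : ContinuousStar p.Completion where
  continuous_star := p.continuous_star_completion

instance : StarRing p.Completion where
  star_involutive x := by
    refine p.induction_on (q := fun x => star (star x) = x) x
      (isClosed_eq (by fun_prop) (by fun_prop)) fun r => ?_
    rw [← p.toCompl_star, ← p.toCompl_star, star_star]
  star_mul x y := by
    refine p.induction_on_pair (q := fun x y => star (x * y) = star y * star x) x y
      (isClosed_eq (by fun_prop) (by fun_prop)) fun r s => ?_
    simp only [← p.toCompl_star, ← p.toCompl_mul, star_mul]
  star_add x y := by
    refine p.induction_on_pair (q := fun x y => star (x + y) = star x + star y) x y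
      (isClosed_eq (by fun_prop) (by fun_prop)) fun r s => ?_
    simp only [← p.toCompl_star, ← p.toCompl_add, star_add]

variable {p} in
/-- A `*`-homomorphism into a C*-algebra, as a map on the carrier of `p`. -/
def liftCarrier {T : Type v} [CStarAlgebra T] (f : R →⋆ₐ[ℂ] T) : p.Carrier →+* T :=
  (f : R →+* T)

theorem continuous_liftCarrier {T : Type v} [CStarAlgebra T] (f : R →⋆ₐ[ℂ] T)
    (hf : ∀ x, ‖f x‖ ≤ p.toFun x) : Continuous (liftCarrier (p := p) f) :=
  AddMonoidHomClass.continuous_of_bound _ 1 fun x => by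
    rw [one_mul]
    exact hf x

end basic

section star

variable {R : Type u} [Ring R] [StarRing R] [Algebra ℂ R] [StarModule ℂ R] (p : CStarSeminorm R)

instance : CStarAlgebra p.Completion where
  norm_mul_self_le x := by
    refine p.induction_on (q := fun x => ‖x‖ * ‖x‖ ≤ ‖star x * x‖) x
      (isClosed_le (by fun_prop) (by fun_prop)) fun r => ?_
    rw [← p.toCompl_star, ← p.toCompl_mul, p.norm_toCompl, p.norm_toCompl, p.star_mul_self]
  star_smul c x := by
    have h1 : Continuous fun x : p.Completion => star (c • x) :=
      continuous_star.comp (continuous_const_smul c)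
    have h2 : Continuous fun x : p.Completion => star c • star x :=
      (continuous_const_smul (star c)).comp continuous_star
    refine p.induction_on (q := fun x => star (c • x) = star c • star x) x
      (isClosed_eq h1 h2) fun r => ?_
    rw [← p.toCompl_smul, ← p.toCompl_star, ← p.toCompl_star, ← p.toCompl_smul, star_smul]

/-- The canonical unital `*`-homomorphism from `R` to its completion. -/
def ι : R →⋆ₐ[ℂ] p.Completion where
  toFun := p.toCompl
  map_one' := rfl
  map_mul' := p.toCompl_mul
  map_zero' := rfl
  map_add' := p.toCompl_add
  commutes' := p.toCompl_algebraMap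
  map_star' := p.toCompl_star

variable {p} in
/-- A `*`-homomorphism into a C*-algebra that is contractive for `p` extends to the completion. -/
def lift {T : Type v} [CStarAlgebra T] (f : R →⋆ₐ[ℂ] T) (hf : ∀ x, ‖f x‖ ≤ p.toFun x) :
    p.Completion →⋆ₐ[ℂ] T :=
  let G : p.Completion →+* T :=
    UniformSpace.Completion.extensionHom (liftCarrier (p := p) f) (p.continuous_liftCarrier f hf)
  have hGc : Continuous G := UniformSpace.Completion.continuous_extension
  have hG : ∀ x : R, G (p.toCompl x) = f x := fun x =>
    UniformSpace.Completion.extensionHom_coe (liftCarrier (p := p) f)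
      (p.continuous_liftCarrier f hf) (show p.Carrier from x)
  { G with
    commutes' := fun c => (hG _).trans (AlgHomClass.commutes f c)
    map_star' := fun x => by
      refine p.induction_on (q := fun x => G (star x) = star (G x)) x
        (isClosed_eq (by fun_prop) (by fun_prop)) fun r => ?_
      rw [← p.toCompl_star, hG, hG, map_star] }

variable {p} in
theorem lift_ι {T : Type v} [CStarAlgebra T] (f : R →⋆ₐ[ℂ] T) (hf : ∀ x, ‖f x‖ ≤ p.toFun x)
    (x : R) : lift f hf (p.ι x) = f x :=
  UniformSpace.Completion.extensionHom_coe (liftCarrier (p := p) f)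
    (p.continuous_liftCarrier f hf) (show p.Carrier from x)

end star

end CStarSeminorm

/-! ### The spatial tensor product of unital C*-algebras -/

/-- A representation of a unital C*-algebra on a complex Hilbert space. -/
structure HilbertRep (B : Type u) [CStarAlgebra B] where
  space : Type u
  [normed : NormedAddCommGroup space]
  [inner : InnerProductSpace ℂ space]
  [complete : CompleteSpace space]
  hom : B →⋆ₐ[ℂ] (space →L[ℂ] space)

attribute [instance] HilbertRep.normed HilbertRep.inner HilbertRep.complete

section spatial

variable {B C : Type u} [CStarAlgebra B] [CStarAlgebra C]

/-- The tensor product `π ⊗ ρ` of two representations, acting by bounded operators on the (not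
completed) tensor product of the two Hilbert spaces: `(π ⊗ ρ)(b ⊗ c) = π(b) ⊗ ρ(c)`. -/
def tensorRep (π : HilbertRep B) (ρ : HilbertRep C) :
    B ⊗[ℂ] C →ₐ[ℂ] (π.space ⊗[ℂ] ρ.space →L[ℂ] π.space ⊗[ℂ] ρ.space) :=
  Algebra.TensorProduct.algHomOfLinearMapTensorProduct
    (TensorProduct.lift
      (LinearMap.mk₂ ℂ (fun b c => TensorProduct.mapL (π.hom b) (ρ.hom c))
        (fun b b' c => by rw [map_add, TensorProduct.mapL_add_left])
        (fun r b c => by rw [map_smul, TensorProduct.mapL_smul_left])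
        (fun b c c' => by rw [map_add, TensorProduct.mapL_add_right])
        (fun r b c => by rw [map_smul, TensorProduct.mapL_smul_right])))
    (fun b b' c c' => by
      simp only [TensorProduct.lift.tmul, LinearMap.mk₂_apply, map_mul, TensorProduct.mapL_mul])
    (by
      simp only [TensorProduct.lift.tmul, LinearMap.mk₂_apply, map_one]
      exact TensorProduct.mapL_id_id)

theorem tensorRep_tmul (π : HilbertRep B) (ρ : HilbertRep C) (b : B) (c : C) :
    tensorRep π ρ (b ⊗ₜ c) = TensorProduct.mapL (π.hom b) (ρ.hom c) :=
  rfl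

theorem inner_tensorRep (π : HilbertRep B) (ρ : HilbertRep C) (x : B ⊗[ℂ] C)
    (ξ ζ : π.space ⊗[ℂ] ρ.space) :
    ⟪tensorRep π ρ x ξ, ζ⟫_ℂ = ⟪ξ, tensorRep π ρ (star x) ζ⟫_ℂ := by
  induction x with
  | zero => simp
  | add x y hx hy => simp [inner_add_left, inner_add_right, hx, hy]
  | tmul b c =>
    induction ξ with
    | zero => simp
    | add ξ ξ' h h' => simp only [map_add, inner_add_left, h, h']
    | tmul ξ₁ ξ₂ =>
      induction ζ with
      | zero => simp
      | add ζ ζ' h h' => simp only [map_add, inner_add_right, h, h']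
      | tmul ζ₁ ζ₂ =>
        simp only [TensorProduct.star_tmul, tensorRep_tmul, TensorProduct.mapL_tmul,
          TensorProduct.inner_tmul, map_star, ContinuousLinearMap.star_eq_adjoint,
          ContinuousLinearMap.adjoint_inner_right]

theorem norm_tensorRep_add_le (π : HilbertRep B) (ρ : HilbertRep C) (x y : B ⊗[ℂ] C) :
    ‖tensorRep π ρ (x + y)‖ ≤ ‖tensorRep π ρ x‖ + ‖tensorRep π ρ y‖ := by
  rw [map_add]
  exact ContinuousLinearMap.opNorm_add_le _ _

theorem norm_tensorRep_smul (π : HilbertRep B) (ρ : HilbertRep C) (c : ℂ) (x : B ⊗[ℂ] C) :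
    ‖tensorRep π ρ (c • x)‖ = ‖c‖ * ‖tensorRep π ρ x‖ := by
  have h : ∀ (d : ℂ) (y : B ⊗[ℂ] C), ‖tensorRep π ρ (d • y)‖ ≤ ‖d‖ * ‖tensorRep π ρ y‖ := by
    intro d y
    rw [map_smul]
    exact ContinuousLinearMap.opNorm_smul_le _ _
  refine le_antisymm (h c x) ?_
  rcases eq_or_ne c 0 with rfl | hc
  · rw [norm_zero, zero_mul]
    exact ContinuousLinearMap.opNorm_nonneg _
  · have h1 := h c⁻¹ (c • x)
    rw [inv_smul_smul₀ hc, norm_inv] at h1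
    rwa [← le_inv_mul_iff₀ (norm_pos_iff.mpr hc)]

theorem norm_tensorRep_mul_le (π : HilbertRep B) (ρ : HilbertRep C) (x y : B ⊗[ℂ] C) :
    ‖tensorRep π ρ (x * y)‖ ≤ ‖tensorRep π ρ x‖ * ‖tensorRep π ρ y‖ := by
  rw [map_mul]
  exact ContinuousLinearMap.opNorm_comp_le _ _

theorem norm_tensorRep_nonneg (π : HilbertRep B) (ρ : HilbertRep C) (x : B ⊗[ℂ] C) :
    0 ≤ ‖tensorRep π ρ x‖ :=
  ContinuousLinearMap.opNorm_nonneg _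

theorem norm_tensorRep_star_mul_self (π : HilbertRep B) (ρ : HilbertRep C) (x : B ⊗[ℂ] C) :
    ‖tensorRep π ρ x‖ ≤ √‖tensorRep π ρ (star x * x)‖ := by
  refine ContinuousLinearMap.opNorm_le_bound _ (Real.sqrt_nonneg _) fun ξ => ?_
  refine le_of_sq_le_sq ?_ (by positivity)
  rw [mul_pow, Real.sq_sqrt (norm_tensorRep_nonneg _ _ _), ← inner_self_eq_norm_sq (𝕜 := ℂ),
    inner_tensorRep]
  have h1 : tensorRep π ρ (star x) (tensorRep π ρ x ξ) = tensorRep π ρ (star x * x) ξ := by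
    rw [map_mul]
    rfl
  rw [h1]
  calc RCLike.re ⟪ξ, tensorRep π ρ (star x * x) ξ⟫_ℂ
      ≤ ‖ξ‖ * ‖tensorRep π ρ (star x * x) ξ‖ :=
        re_inner_le_norm (𝕜 := ℂ) ξ (tensorRep π ρ (star x * x) ξ)
    _ ≤ ‖ξ‖ * (‖tensorRep π ρ (star x * x)‖ * ‖ξ‖) := by
        gcongr
        exact ContinuousLinearMap.le_opNorm _ _
    _ = ‖tensorRep π ρ (star x * x)‖ * ‖ξ‖ ^ 2 := by ring

theorem norm_tensorRep_tmul_le (π : HilbertRep B) (ρ : HilbertRep C) (b : B) (c : C) :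
    ‖tensorRep π ρ (b ⊗ₜ c)‖ ≤ ‖b‖ * ‖c‖ :=
  (TensorProduct.norm_mapL_le _ _).trans
    (mul_le_mul (NonUnitalStarAlgHom.norm_apply_le π.hom b)
      (NonUnitalStarAlgHom.norm_apply_le ρ.hom c) (norm_nonneg _) (norm_nonneg _))

/-- `sup ‖(π ⊗ ρ)(x)‖` over all representations `π` of `B` and `ρ` of `C`. -/
def spatialNorm (x : B ⊗[ℂ] C) : ℝ :=
  ⨆ p : HilbertRep B × HilbertRep C, ‖tensorRep p.1 p.2 x‖

theorem bddAbove_tensorRep (x : B ⊗[ℂ] C) :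
    BddAbove (Set.range fun p : HilbertRep B × HilbertRep C => ‖tensorRep p.1 p.2 x‖) := by
  suffices h : ∃ M : ℝ, ∀ (π : HilbertRep B) (ρ : HilbertRep C), ‖tensorRep π ρ x‖ ≤ M by
    obtain ⟨M, hM⟩ := h
    exact ⟨M, by rintro _ ⟨p, rfl⟩; exact hM p.1 p.2⟩
  induction x with
  | zero =>
    refine ⟨‖(0 : B)‖ * ‖(0 : C)‖, fun π ρ => ?_⟩
    rw [← TensorProduct.zero_tmul B (0 : C)]
    exact norm_tensorRep_tmul_le π ρ 0 0
  | add x y hx hy =>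
    obtain ⟨M, hM⟩ := hx
    obtain ⟨N, hN⟩ := hy
    exact ⟨M + N, fun π ρ =>
      (norm_tensorRep_add_le π ρ x y).trans (add_le_add (hM π ρ) (hN π ρ))⟩
  | tmul b c => exact ⟨‖b‖ * ‖c‖, fun π ρ => norm_tensorRep_tmul_le π ρ b c⟩

theorem norm_tensorRep_le (π : HilbertRep B) (ρ : HilbertRep C) (x : B ⊗[ℂ] C) :
    ‖tensorRep π ρ x‖ ≤ spatialNorm x :=
  le_ciSup (bddAbove_tensorRep x) (π, ρ)

/-- The trivial representation on the zero space. -/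
instance : Inhabited (HilbertRep B) where
  default :=
    { space := PUnit
      hom :=
        { toFun := fun _ => 0
          map_one' := Subsingleton.elim _ _
          map_mul' := fun _ _ => Subsingleton.elim _ _
          map_zero' := rfl
          map_add' := fun _ _ => Subsingleton.elim _ _
          commutes' := fun _ => Subsingleton.elim _ _
          map_star' := fun _ => Subsingleton.elim _ _ } }

theorem spatialNorm_le {x : B ⊗[ℂ] C} {M : ℝ}
    (h : ∀ (π : HilbertRep B) (ρ : HilbertRep C), ‖tensorRep π ρ x‖ ≤ M) : spatialNorm x ≤ M :=
  ciSup_le fun p => h p.1 p.2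

theorem spatialNorm_nonneg (x : B ⊗[ℂ] C) : 0 ≤ spatialNorm x :=
  (norm_tensorRep_nonneg default default x).trans (norm_tensorRep_le default default x)

theorem spatialNorm_mul_le (x y : B ⊗[ℂ] C) :
    spatialNorm (x * y) ≤ spatialNorm x * spatialNorm y :=
  spatialNorm_le fun π ρ => (norm_tensorRep_mul_le π ρ x y).trans
    (mul_le_mul (norm_tensorRep_le π ρ x) (norm_tensorRep_le π ρ y)
      (norm_tensorRep_nonneg π ρ y) (spatialNorm_nonneg x))

theorem spatialNorm_mul_self_le (x : B ⊗[ℂ] C) :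
    spatialNorm x * spatialNorm x ≤ spatialNorm (star x * x) := by
  have h : spatialNorm x ≤ √(spatialNorm (star x * x)) :=
    spatialNorm_le fun π ρ => (norm_tensorRep_star_mul_self π ρ x).trans
      (Real.sqrt_le_sqrt (norm_tensorRep_le π ρ _))
  calc spatialNorm x * spatialNorm x
      ≤ √(spatialNorm (star x * x)) * √(spatialNorm (star x * x)) :=
        mul_le_mul h h (spatialNorm_nonneg x) (Real.sqrt_nonneg _)
    _ = spatialNorm (star x * x) := Real.mul_self_sqrt (spatialNorm_nonneg _)

theorem spatialNorm_le_star (x : B ⊗[ℂ] C) : spatialNorm x ≤ spatialNorm (star x) := by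
  have h := (spatialNorm_mul_self_le x).trans (spatialNorm_mul_le (star x) x)
  rcases (spatialNorm_nonneg x).eq_or_lt with h0 | h0
  · rw [← h0]; exact spatialNorm_nonneg _
  · exact le_of_mul_le_mul_right h h0

variable (B C) in
/-- The spatial (minimal) C*-norm on the algebraic tensor product. -/
def spatialSeminorm : CStarSeminorm (B ⊗[ℂ] C) where
  toFun := spatialNorm
  add_le x y := spatialNorm_le fun π ρ => (norm_tensorRep_add_le π ρ x y).trans
    (add_le_add (norm_tensorRep_le π ρ x) (norm_tensorRep_le π ρ y))
  smul_eq c x := by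
    unfold spatialNorm
    rw [Real.mul_iSup_of_nonneg (norm_nonneg c)]
    exact congrArg iSup (funext fun p => norm_tensorRep_smul p.1 p.2 c x)
  mul_le := spatialNorm_mul_le
  star_mul_self x := by
    refine le_antisymm ((spatialNorm_mul_le _ _).trans ?_) (spatialNorm_mul_self_le x)
    refine mul_le_mul_of_nonneg_right ?_ (spatialNorm_nonneg x)
    simpa using spatialNorm_le_star (star x)

end spatial

/-- The spatial tensor product `B ⊗ C` of unital C*-algebras: the completion of the algebraic
tensor product in the spatial norm. -/
def SpatialTensor (B C : Type u) [CStarAlgebra B] [CStarAlgebra C] : Type u :=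
  (spatialSeminorm B C).Completion

namespace SpatialTensor

instance (B C : Type u) [CStarAlgebra B] [CStarAlgebra C] : CStarAlgebra (SpatialTensor B C) :=
  inferInstanceAs (CStarAlgebra (spatialSeminorm B C).Completion)

/-- The canonical map from the algebraic to the spatial tensor product. -/
def ofAlg (B C : Type u) [CStarAlgebra B] [CStarAlgebra C] :
    B ⊗[ℂ] C →⋆ₐ[ℂ] SpatialTensor B C :=
  (spatialSeminorm B C).ι

/-- The elementary tensor `b ⊗ c` in the spatial tensor product. -/
def tmul {B C : Type u} [CStarAlgebra B] [CStarAlgebra C] (b : B) (c : C) : SpatialTensor B C :=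
  ofAlg B C (b ⊗ₜ c)

variable {B C B₁ C₁ : Type u} [CStarAlgebra B] [CStarAlgebra C] [CStarAlgebra B₁] [CStarAlgebra C₁]

/-- The algebraic tensor product of two unital `*`-homomorphisms. -/
def mapAlg (f : B →⋆ₐ[ℂ] B₁) (g : C →⋆ₐ[ℂ] C₁) : B ⊗[ℂ] C →⋆ₐ[ℂ] B₁ ⊗[ℂ] C₁ where
  __ := Algebra.TensorProduct.map (f : B →ₐ[ℂ] B₁) (g : C →ₐ[ℂ] C₁)
  map_star' x := by
    change Algebra.TensorProduct.map (f : B →ₐ[ℂ] B₁) (g : C →ₐ[ℂ] C₁) (star x) =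
      star (Algebra.TensorProduct.map (f : B →ₐ[ℂ] B₁) (g : C →ₐ[ℂ] C₁) x)
    induction x with
    | zero => simp
    | add x y hx hy => simp [hx, hy]
    | tmul b c => simp [map_star]

/-- The pull-back of a representation along a unital `*`-homomorphism. -/
def _root_.QuantumAut.HilbertRep.comap (f : B →⋆ₐ[ℂ] B₁) (π : HilbertRep B₁) : HilbertRep B where
  space := π.space
  hom := π.hom.comp f

theorem spatialNorm_mapAlg_le (f : B →⋆ₐ[ℂ] B₁) (g : C →⋆ₐ[ℂ] C₁) (x : B ⊗[ℂ] C) :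
    spatialNorm (mapAlg f g x) ≤ spatialNorm x := by
  refine spatialNorm_le fun π ρ => ?_
  refine le_trans (le_of_eq ?_) (norm_tensorRep_le (π.comap f) (ρ.comap g) x)
  have h : tensorRep π ρ (mapAlg f g x) = tensorRep (π.comap f) (ρ.comap g) x := by
    induction x with
    | zero =>
      exact (map_zero (tensorRep π ρ)).trans (map_zero (tensorRep (π.comap f) (ρ.comap g))).symm
    | add x y hx hy =>
      rw [map_add, map_add, hx, hy]
      exact (map_add (tensorRep (π.comap f) (ρ.comap g)) x y).symm
    | tmul b c => rfl
  exact congrArg norm h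

/-- The tensor product `f ⊗ g : B ⊗ C → B₁ ⊗ C₁` of two unital `*`-homomorphisms. -/
def map (f : B →⋆ₐ[ℂ] B₁) (g : C →⋆ₐ[ℂ] C₁) : SpatialTensor B C →⋆ₐ[ℂ] SpatialTensor B₁ C₁ :=
  CStarSeminorm.lift ((ofAlg B₁ C₁).comp (mapAlg f g)) fun x =>
    ((spatialSeminorm B₁ C₁).norm_toCompl _).le.trans (spatialNorm_mapAlg_le f g x)

theorem map_tmul (f : B →⋆ₐ[ℂ] B₁) (g : C →⋆ₐ[ℂ] C₁) (b : B) (c : C) :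
    map f g (tmul b c) = tmul (f b) (g c) :=
  CStarSeminorm.lift_ι _ _ _

/-- `x ∈ (B ⊗ C) ⊗ D` and `y ∈ B ⊗ (C ⊗ D)` are identified by the associativity isomorphism of the
spatial tensor product. That isomorphism is isometric and extends the algebraic one, so that its
graph is the closure of the graph of the algebraic associativity isomorphism
`(b ⊗ c) ⊗ d ↦ b ⊗ (c ⊗ d)`. -/
def AssocRel {D : Type u} [CStarAlgebra D] (x : SpatialTensor (SpatialTensor B C) D)
    (y : SpatialTensor B (SpatialTensor C D)) : Prop :=
  (x, y) ∈ closure (Set.range fun t : (B ⊗[ℂ] C) ⊗[ℂ] D =>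
    (ofAlg (SpatialTensor B C) D
        (TensorProduct.map (ofAlg B C : B ⊗[ℂ] C →ₗ[ℂ] SpatialTensor B C) LinearMap.id t),
      ofAlg B (SpatialTensor C D)
        (TensorProduct.map LinearMap.id (ofAlg C D : C ⊗[ℂ] D →ₗ[ℂ] SpatialTensor C D)
          (TensorProduct.assoc ℂ B C D t))))

end SpatialTensor

/-! ### Finite quantum groups and their duals -/

open Coalgebra HopfAlgebra

/-- A finite-dimensional complex Hopf `*`-algebra: a finite-dimensional Hopf algebra with an
antilinear antimultiplicative involution such that the coproduct is a `*`-homomorphism. -/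
class FiniteHopfStar (A : Type v) [Ring A] [StarRing A] [HopfAlgebra ℂ A] : Prop
    extends StarModule ℂ A, Module.Finite ℂ A where
  comul_star : ∀ a : A, comul (R := ℂ) (star a) = star (comul (R := ℂ) a)

/-- A finite quantum group `𝔾`, given by its algebra of functions `A = C(𝔾)`: a finite-dimensional
C*-algebra that is a Hopf `*`-algebra. (A norm on a finite-dimensional space is complete, and
the C*-norm of a `*`-algebra is unique, so that it need not be part of the data.) -/
class FiniteQuantumGroup (A : Type v) [Ring A] [StarRing A] [HopfAlgebra ℂ A] : Prop
    extends FiniteHopfStar A where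
  exists_cstar_norm : ∃ N : AlgebraNorm ℂ A, ∀ a : A, N (star a * a) = N a * N a

section hopfstar

variable {A : Type v} [Ring A] [StarRing A] [HopfAlgebra ℂ A] [FiniteHopfStar A]

/-- Adjoints of a Sweedler representation of `a` represent `star a`. -/
def starRepr {ι : Type*} {a : A} (r : Coalgebra.Repr ℂ a ι) : Coalgebra.Repr ℂ (star a) ι where
  index := r.index
  left i := star (r.left i)
  right i := star (r.right i)
  eq := by
    rw [FiniteHopfStar.comul_star, ← r.eq, star_sum]
    rfl

theorem counit_star (a : A) : counit (R := ℂ) (star a) = star (counit (R := ℂ) a) := by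
  let r := ℛ ℂ a
  have h1 : ∑ i ∈ r.index, star (counit (R := ℂ) (star (r.left i))) • r.right i = a := by
    have h := congrArg star (Coalgebra.sum_counit_smul (starRepr r))
    simpa [starRepr, star_sum, star_smul] using h
  have h2 : ∑ i ∈ r.index, counit (R := ℂ) (r.right i) • r.left i = a := by
    have h := congrArg (TensorProduct.rid ℂ A) (Coalgebra.sum_tmul_counit_eq r)
    rw [map_sum, TensorProduct.rid_tmul, one_smul] at h
    exact h
  have h3 := congrArg (counit (R := ℂ)) h1
  have h4 := congrArg (fun x => star (counit (R := ℂ) (star x))) h2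
  simp only [map_sum, map_smul, star_sum, star_smul, smul_eq_mul, star_mul', star_star] at h3 h4
  have h5 : counit (R := ℂ) a = star (counit (R := ℂ) (star a)) := by
    rw [← h3, ← h4]
    exact Finset.sum_congr rfl fun i _ => mul_comm _ _
  rw [h5, star_star]

/-- The map `a ↦ S(a*)*`, which is inverse to the antipode. -/
def antipodeInv : A →ₗ[ℂ] A where
  toFun a := star (antipode ℂ (star a))
  map_add' x y := by simp
  map_smul' c x := by simp [star_smul]

theorem antipodeInv_mul (a b : A) :
    antipodeInv (a * b) = antipodeInv b * antipodeInv a := by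
  simp [antipodeInv, antipode_mul_antidistrib]

theorem sum_mul_antipodeInv {ι : Type*} {a : A} (r : Coalgebra.Repr ℂ a ι) :
    ∑ i ∈ r.index, r.right i * antipodeInv (r.left i) = algebraMap ℂ A (counit a) := by
  have h := congrArg star (sum_antipode_mul_eq_algebraMap_counit (starRepr r))
  rw [counit_star, algebraMap_star_comm, star_star] at h
  rw [← h]
  simp [starRepr, star_sum, antipodeInv]

theorem antipodeInv_antipode (a : A) : antipodeInv (antipode ℂ a) = a := by
  let F : A →ₗ[ℂ] Aᵐᵒᵖ :=
    (MulOpposite.opLinearEquiv ℂ).toLinearMap ∘ₗ antipodeInv ∘ₗ antipode ℂ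
  let G : A →ₗ[ℂ] Aᵐᵒᵖ := (MulOpposite.opLinearEquiv ℂ).toLinearMap ∘ₗ antipodeInv
  let I : A →ₗ[ℂ] Aᵐᵒᵖ := (MulOpposite.opLinearEquiv ℂ).toLinearMap
  have hFG : WithConv.toConv F * WithConv.toConv G = 1 := by
    apply WithConv.ext
    refine LinearMap.ext fun a => ?_
    have h := congrArg antipodeInv (sum_antipode_mul_eq_algebraMap_counit (ℛ ℂ a))
    rw [map_sum] at h
    simp only [antipodeInv_mul] at h
    rw [(ℛ ℂ a).convMul_apply]
    refine MulOpposite.unop_injective ?_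
    refine (map_sum (MulOpposite.opLinearEquiv ℂ (M := A)).symm _ _).trans ?_
    refine h.trans ?_
    simp [antipodeInv, Algebra.algebraMap_eq_smul_one]
  have hGI : WithConv.toConv G * WithConv.toConv I = 1 := by
    apply WithConv.ext
    refine LinearMap.ext fun a => ?_
    rw [(ℛ ℂ a).convMul_apply]
    refine MulOpposite.unop_injective ?_
    refine (map_sum (MulOpposite.opLinearEquiv ℂ (M := A)).symm _ _).trans ?_
    exact sum_mul_antipodeInv (ℛ ℂ a)
  have h : WithConv.toConv F = WithConv.toConv I := left_inv_eq_right_inv hFG hGI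
  have h2 : F = I := WithConv.toConv_injective h
  exact MulOpposite.op_injective (LinearMap.congr_fun h2 a)

theorem antipode_star_antipode_star (a : A) :
    antipode ℂ (star (antipode ℂ a)) = star a := by
  rw [← star_star (antipode ℂ (star (antipode ℂ a)))]
  exact congrArg star (antipodeInv_antipode a)

end hopfstar

/-- The algebra `Â = C(𝔾̂)` of the dual quantum group: the linear functionals on `A`, with the
convolution product `ω₁ω₂ = (ω₁ ⊗ ω₂) ∘ Δ` and unit `ε`. -/
def QDual (A : Type v) [Ring A] [HopfAlgebra ℂ A] : Type v := WithConv (A →ₗ[ℂ] ℂ)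

namespace QDual

section dual

variable {A : Type v} [Ring A] [HopfAlgebra ℂ A]

instance : Ring (QDual A) := inferInstanceAs (Ring (WithConv (A →ₗ[ℂ] ℂ)))

instance : Algebra ℂ (QDual A) := inferInstanceAs (Algebra ℂ (WithConv (A →ₗ[ℂ] ℂ)))

/-- An element of the dual, as a linear functional. -/
def toDual : QDual A ≃ₗ[ℂ] Module.Dual ℂ A where
  toFun ω := WithConv.ofConv ω
  invFun f := WithConv.toConv f
  map_add' _ _ := rfl
  map_smul' _ _ := rfl
  left_inv _ := rfl
  right_inv _ := rfl

theorem ext {ω θ : QDual A} (h : ∀ a, toDual ω a = toDual θ a) : ω = θ :=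
  toDual.injective (LinearMap.ext h)

theorem one_apply (a : A) : toDual (1 : QDual A) a = counit (R := ℂ) a := rfl

theorem mul_apply {ι : Type*} (ω θ : QDual A) {a : A} (r : Coalgebra.Repr ℂ a ι) :
    toDual (ω * θ) a = ∑ i ∈ r.index, toDual ω (r.left i) * toDual θ (r.right i) :=
  r.convMul_apply _ _

theorem algebraMap_apply (c : ℂ) (a : A) :
    toDual (algebraMap ℂ (QDual A) c) a = c * counit (R := ℂ) a := rfl

variable [Module.Finite ℂ A]

instance : Module.Finite ℂ (QDual A) := Module.Finite.equiv toDual.symm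

/-- The identification of `Â ⊗ Â` with `(A ⊗ A)*`. -/
def pair : QDual A ⊗[ℂ] QDual A ≃ₗ[ℂ] Module.Dual ℂ (A ⊗[ℂ] A) :=
  (TensorProduct.congr toDual toDual).trans (TensorProduct.dualDistribEquiv ℂ A A)

theorem pair_tmul (ω θ : QDual A) (a b : A) :
    pair (ω ⊗ₜ θ) (a ⊗ₜ b) = toDual ω a * toDual θ b := by
  simp [pair, TensorProduct.dualDistribEquiv]

theorem pair_ext {s t : QDual A ⊗[ℂ] QDual A}
    (h : ∀ a b, pair s (a ⊗ₜ b) = pair t (a ⊗ₜ b)) : s = t :=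
  pair.injective (TensorProduct.ext' h)

/-- The coproduct of the dual, `Δ̂(ω)(a ⊗ b) = ω(ab)`, and its counit, `ε̂(ω) = ω(1)`. -/
instance : CoalgebraStruct ℂ (QDual A) where
  comul := pair.symm.toLinearMap ∘ₗ (LinearMap.mul' ℂ A).dualMap ∘ₗ toDual.toLinearMap
  counit := LinearMap.applyₗ (1 : A) ∘ₗ toDual.toLinearMap

theorem pair_comul (ω : QDual A) (a b : A) :
    pair (comul (R := ℂ) ω) (a ⊗ₜ b) = toDual ω (a * b) := by
  change pair (pair.symm ((LinearMap.mul' ℂ A).dualMap (toDual ω))) (a ⊗ₜ b) = _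
  rw [LinearEquiv.apply_symm_apply]
  simp

theorem counit_apply (ω : QDual A) : counit (R := ℂ) ω = toDual ω 1 := rfl

/-- The identification of `Â ⊗ (Â ⊗ Â)` with `(A ⊗ (A ⊗ A))*`. -/
def pairThree : QDual A ⊗[ℂ] (QDual A ⊗[ℂ] QDual A) ≃ₗ[ℂ] Module.Dual ℂ (A ⊗[ℂ] (A ⊗[ℂ] A)) :=
  (TensorProduct.congr toDual pair).trans (TensorProduct.dualDistribEquiv ℂ A (A ⊗[ℂ] A))

theorem pairThree_tmul (ω : QDual A) (t : QDual A ⊗[ℂ] QDual A) (a : A) (x : A ⊗[ℂ] A) :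
    pairThree (ω ⊗ₜ t) (a ⊗ₜ x) = toDual ω a * pair t x := by
  simp [pairThree, TensorProduct.dualDistribEquiv]

theorem pairThree_ext {s t : QDual A ⊗[ℂ] (QDual A ⊗[ℂ] QDual A)}
    (h : ∀ a b c, pairThree s (a ⊗ₜ (b ⊗ₜ c)) = pairThree t (a ⊗ₜ (b ⊗ₜ c))) : s = t :=
  pairThree.injective (TensorProduct.ext_threefold' h)

theorem pairThree_assoc (s : QDual A ⊗[ℂ] QDual A) (θ : QDual A) (a b c : A) :
    pairThree (TensorProduct.assoc ℂ _ _ _ (s ⊗ₜ θ)) (a ⊗ₜ (b ⊗ₜ c)) =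
      pair s (a ⊗ₜ b) * toDual θ c := by
  induction s with
  | zero => simp
  | add s t hs ht => simp only [TensorProduct.add_tmul, map_add, LinearMap.add_apply, hs, ht, add_mul]
  | tmul ω₁ ω₂ => rw [TensorProduct.assoc_tmul, pairThree_tmul, pair_tmul, pair_tmul, mul_assoc]

theorem pairThree_rTensor (t : QDual A ⊗[ℂ] QDual A) (a b c : A) :
    pairThree (TensorProduct.assoc ℂ _ _ _ (LinearMap.rTensor _ (comul (R := ℂ)) t))
      (a ⊗ₜ (b ⊗ₜ c)) = pair t ((a * b) ⊗ₜ c) := by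
  induction t with
  | zero => simp
  | add s t hs ht => simp only [map_add, LinearMap.add_apply, hs, ht]
  | tmul ω θ => rw [LinearMap.rTensor_tmul, pairThree_assoc, pair_comul, pair_tmul]

theorem pairThree_lTensor (t : QDual A ⊗[ℂ] QDual A) (a b c : A) :
    pairThree (LinearMap.lTensor _ (comul (R := ℂ)) t) (a ⊗ₜ (b ⊗ₜ c)) =
      pair t (a ⊗ₜ (b * c)) := by
  induction t with
  | zero => simp
  | add s t hs ht => simp only [map_add, LinearMap.add_apply, hs, ht]
  | tmul ω θ => rw [LinearMap.lTensor_tmul, pairThree_tmul, pair_comul, pair_tmul]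

theorem rTensor_counit (t : QDual A ⊗[ℂ] QDual A) (b : A) :
    toDual (TensorProduct.lid ℂ _ (LinearMap.rTensor _ (counit (R := ℂ)) t)) b =
      pair t (1 ⊗ₜ b) := by
  induction t with
  | zero => simp
  | add s t hs ht => simp only [map_add, LinearMap.add_apply, hs, ht]
  | tmul ω θ => simp [pair_tmul, counit_apply]

theorem lTensor_counit (t : QDual A ⊗[ℂ] QDual A) (a : A) :
    toDual (TensorProduct.rid ℂ _ (LinearMap.lTensor _ (counit (R := ℂ)) t)) a =
      pair t (a ⊗ₜ 1) := by
  induction t with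
  | zero => simp
  | add s t hs ht => simp only [map_add, LinearMap.add_apply, hs, ht]
  | tmul ω θ => simp [pair_tmul, counit_apply, mul_comm]

instance : Coalgebra ℂ (QDual A) where
  coassoc := by
    refine LinearMap.ext fun ω => pairThree_ext fun a b c => ?_
    change pairThree (TensorProduct.assoc ℂ _ _ _ (LinearMap.rTensor _ (comul (R := ℂ))
      (comul (R := ℂ) ω))) _ = pairThree (LinearMap.lTensor _ (comul (R := ℂ))
      (comul (R := ℂ) ω)) _
    rw [pairThree_rTensor, pairThree_lTensor, pair_comul, pair_comul, mul_assoc]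
  rTensor_counit_comp_comul := by
    refine LinearMap.ext fun ω => (TensorProduct.lid ℂ _).injective (ext fun b => ?_)
    change toDual (TensorProduct.lid ℂ _ (LinearMap.rTensor _ (counit (R := ℂ))
      (comul (R := ℂ) ω))) b = _
    rw [rTensor_counit, pair_comul, one_mul]
    simp
  lTensor_counit_comp_comul := by
    refine LinearMap.ext fun ω => (TensorProduct.rid ℂ _).injective (ext fun b => ?_)
    change toDual (TensorProduct.rid ℂ _ (LinearMap.lTensor _ (counit (R := ℂ))
      (comul (R := ℂ) ω))) b = _
    rw [lTensor_counit, pair_comul, mul_one]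
    simp

theorem pair_mul {ι κ : Type*} (s t : QDual A ⊗[ℂ] QDual A) {a b : A}
    (r : Coalgebra.Repr ℂ a ι) (q : Coalgebra.Repr ℂ b κ) :
    pair (s * t) (a ⊗ₜ b) = ∑ i ∈ r.index, ∑ j ∈ q.index,
      pair s (r.left i ⊗ₜ q.left j) * pair t (r.right i ⊗ₜ q.right j) := by
  induction s with
  | zero => simp
  | add s s' hs hs' =>
    simp only [add_mul, map_add, LinearMap.add_apply, hs, hs', Finset.sum_add_distrib]
  | tmul ω₁ ω₂ =>
    induction t with
    | zero => simp
    | add t t' ht ht' =>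
      simp only [mul_add, map_add, LinearMap.add_apply, ht, ht', Finset.sum_add_distrib]
    | tmul θ₁ θ₂ =>
      rw [Algebra.TensorProduct.tmul_mul_tmul, pair_tmul, mul_apply _ _ r, mul_apply _ _ q,
        Finset.sum_mul_sum]
      refine Finset.sum_congr rfl fun i _ => Finset.sum_congr rfl fun j _ => ?_
      rw [pair_tmul, pair_tmul]
      ring

instance : Bialgebra ℂ (QDual A) :=
  Bialgebra.mk' ℂ (QDual A)
    (by
      rw [counit_apply, one_apply]
      exact Bialgebra.counit_one)
    (fun {ω θ} => by
      have h : toDual (ω * θ) 1 = LinearMap.mul' ℂ ℂ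
          (TensorProduct.map (toDual ω) (toDual θ) (comul (R := ℂ) (1 : A))) := rfl
      rw [counit_apply, h, Bialgebra.comul_one, Algebra.TensorProduct.one_def,
        TensorProduct.map_tmul, LinearMap.mul'_apply]
      rfl)
    (by
      refine pair_ext fun a b => ?_
      rw [pair_comul, Algebra.TensorProduct.one_def, pair_tmul, one_apply, one_apply, one_apply,
        Bialgebra.counit_mul])
    (fun {ω θ} => by
      refine pair_ext fun a b => ?_
      rw [pair_comul, mul_apply ω θ ((ℛ ℂ a).mul (ℛ ℂ b)), pair_mul _ _ (ℛ ℂ a) (ℛ ℂ b)]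
      simp only [pair_comul]
      exact Finset.sum_product _ _ _)

/-- The antipode of the dual, `Ŝ(ω) = ω ∘ S`. -/
instance : HopfAlgebraStruct ℂ (QDual A) where
  antipode := toDual.symm.toLinearMap ∘ₗ (antipode ℂ (A := A)).dualMap ∘ₗ toDual.toLinearMap

theorem antipode_apply (ω : QDual A) (a : A) :
    toDual (antipode ℂ ω) a = toDual ω (antipode ℂ a) := rfl

theorem mul_antipode_rTensor (t : QDual A ⊗[ℂ] QDual A) {ι : Type*} {a : A}
    (r : Coalgebra.Repr ℂ a ι) :
    toDual (LinearMap.mul' ℂ _ (LinearMap.rTensor _ (antipode ℂ) t)) a =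
      pair t (∑ i ∈ r.index, antipode ℂ (r.left i) ⊗ₜ r.right i) := by
  induction t with
  | zero => simp
  | add s t hs ht => simp only [map_add, LinearMap.add_apply, hs, ht]
  | tmul ω θ =>
    rw [LinearMap.rTensor_tmul, LinearMap.mul'_apply, mul_apply _ _ r, map_sum]
    simp only [pair_tmul, antipode_apply]

theorem mul_antipode_lTensor (t : QDual A ⊗[ℂ] QDual A) {ι : Type*} {a : A}
    (r : Coalgebra.Repr ℂ a ι) :
    toDual (LinearMap.mul' ℂ _ (LinearMap.lTensor _ (antipode ℂ) t)) a =
      pair t (∑ i ∈ r.index, r.left i ⊗ₜ antipode ℂ (r.right i)) := by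
  induction t with
  | zero => simp
  | add s t hs ht => simp only [map_add, LinearMap.add_apply, hs, ht]
  | tmul ω θ =>
    rw [LinearMap.lTensor_tmul, LinearMap.mul'_apply, mul_apply _ _ r, map_sum]
    simp only [pair_tmul, antipode_apply]

instance : HopfAlgebra ℂ (QDual A) where
  mul_antipode_rTensor_comul := by
    refine LinearMap.ext fun ω => ext fun a => ?_
    change toDual (LinearMap.mul' ℂ _ (LinearMap.rTensor _ (antipode ℂ) (comul (R := ℂ) ω))) a =
      toDual (algebraMap ℂ (QDual A) (counit (R := ℂ) ω)) a
    rw [mul_antipode_rTensor _ (ℛ ℂ a), map_sum]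
    simp only [pair_comul]
    rw [← map_sum, sum_antipode_mul_eq_smul, map_smul, algebraMap_apply, counit_apply,
      smul_eq_mul, mul_comm]
  mul_antipode_lTensor_comul := by
    refine LinearMap.ext fun ω => ext fun a => ?_
    change toDual (LinearMap.mul' ℂ _ (LinearMap.lTensor _ (antipode ℂ) (comul (R := ℂ) ω))) a =
      toDual (algebraMap ℂ (QDual A) (counit (R := ℂ) ω)) a
    rw [mul_antipode_lTensor _ (ℛ ℂ a), map_sum]
    simp only [pair_comul]
    rw [← map_sum, sum_mul_antipode_eq_smul, map_smul, algebraMap_apply, counit_apply,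
      smul_eq_mul, mul_comm]

end dual

section star

variable {A : Type v} [Ring A] [StarRing A] [HopfAlgebra ℂ A] [FiniteHopfStar A]

/-- The linear functional `a ↦ conj (ω (a*))`. -/
def conjFun (ω : QDual A) : QDual A :=
  toDual.symm
    { toFun := fun a => star (toDual ω (star a))
      map_add' := fun x y => by simp
      map_smul' := fun c x => by simp [star_smul] }

theorem conjFun_apply (ω : QDual A) (a : A) : toDual (conjFun ω) a = star (toDual ω (star a)) :=
  rfl

theorem conjFun_mul (ω θ : QDual A) : conjFun (ω * θ) = conjFun ω * conjFun θ := by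
  refine ext fun a => ?_
  rw [conjFun_apply, mul_apply _ _ (starRepr (ℛ ℂ a)), mul_apply _ _ (ℛ ℂ a), star_sum]
  refine Finset.sum_congr rfl fun i _ => ?_
  rw [star_mul']
  rfl

/-- The involution of the dual, `ω*(a) = conj (ω (S(a)*))`. -/
instance : Star (QDual A) where
  star ω := toDual.symm
    { toFun := fun a => star (toDual ω (star (antipode ℂ a)))
      map_add' := fun x y => by simp
      map_smul' := fun c x => by simp [star_smul] }

theorem star_apply (ω : QDual A) (a : A) :
    toDual (star ω) a = star (toDual ω (star (antipode ℂ a))) := rfl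

theorem star_eq (ω : QDual A) : star ω = antipode ℂ (conjFun ω) := rfl

instance : StarRing (QDual A) where
  star_involutive ω := ext fun a => by
    rw [star_apply, star_apply, star_star, antipode_star_antipode_star, star_star]
  star_mul ω θ := by
    rw [star_eq, star_eq, star_eq, conjFun_mul, antipode_mul_antidistrib]
  star_add ω θ := ext fun a => by
    simp [star_apply]

instance : StarModule ℂ (QDual A) where
  star_smul c ω := ext fun a => by
    simp [star_apply]

theorem pair_star (t : QDual A ⊗[ℂ] QDual A) (a b : A) :
    pair (star t) (a ⊗ₜ b) = star (pair t (star (antipode ℂ a) ⊗ₜ star (antipode ℂ b))) := by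
  induction t with
  | zero => simp
  | add s t hs ht => simp only [star_add, map_add, LinearMap.add_apply, hs, ht]
  | tmul ω θ => rw [TensorProduct.star_tmul, pair_tmul, pair_tmul, star_apply, star_apply, star_mul']

instance : FiniteHopfStar (QDual A) where
  comul_star ω := pair_ext fun a b => by
    rw [pair_star, pair_comul, pair_comul, star_apply, antipode_mul_antidistrib, star_mul]

end star

end QDual

/-! ### The Haar state, the Haar element, convolution and the Fourier transform -/

section haar

open scoped ComplexOrder

/-- `h` is a Haar state: a state with `(h ⊗ id)Δ(a) = h(a)1 = (id ⊗ h)Δ(a)`. -/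
structure IsHaarState {A : Type v} [Ring A] [StarRing A] [HopfAlgebra ℂ A] (h : A →ₗ[ℂ] ℂ) :
    Prop where
  map_one : h 1 = 1
  nonneg : ∀ a, 0 ≤ h (star a * a)
  left_invariant : ∀ a, TensorProduct.lid ℂ A (LinearMap.rTensor A h (comul a)) = h a • (1 : A)
  right_invariant : ∀ a, TensorProduct.rid ℂ A (LinearMap.lTensor A h (comul a)) = h a • (1 : A)

variable (A : Type v) [Ring A] [StarRing A] [HopfAlgebra ℂ A]

/-- The Haar state `h` of a finite quantum group (it exists and is unique). -/
def haar : A →ₗ[ℂ] ℂ := Classical.epsilon IsHaarState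

end haar

/-- The Haar element `η`: the unique element with `ε(η) = 1` and `aη = ε(a)η` for all `a`. -/
def haarElement (A : Type v) [Ring A] [HopfAlgebra ℂ A] : A :=
  Classical.epsilon fun η : A => counit (R := ℂ) η = 1 ∧ ∀ a : A, a * η = counit (R := ℂ) a • η

section fourier

variable {A : Type v} [Ring A] [StarRing A] [HopfAlgebra ℂ A]

/-- The convolution product `a ⋆ b = (h ⊗ id)(((S ⊗ id)Δ(b))(a ⊗ 1))`. -/
def convProd : A →ₗ[ℂ] A →ₗ[ℂ] A :=
  LinearMap.mk₂ ℂ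
    (fun a b => TensorProduct.lid ℂ A (LinearMap.rTensor A (haar A)
      (LinearMap.rTensor A (antipode ℂ) (comul (R := ℂ) b) * (a ⊗ₜ[ℂ] (1 : A)))))
    (fun a a' b => by simp only [TensorProduct.add_tmul, mul_add, map_add])
    (fun c a b => by simp only [← TensorProduct.smul_tmul', mul_smul_comm, map_smul])
    (fun a b b' => by simp only [map_add, add_mul])
    (fun c a b => by simp only [map_smul, smul_mul_assoc])

variable (A) in
/-- The Fourier transform `ℱ : A → Â`, `ℱ(a) = h(· a)`. -/
def fourier : A →ₗ[ℂ] QDual A :=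
  QDual.toDual.symm.toLinearMap ∘ₗ (LinearMap.mul ℂ A).flip.compr₂ (haar A)

theorem fourier_apply (a c : A) : QDual.toDual (fourier A a) c = haar A (c * a) := rfl

variable [FiniteHopfStar A]

variable (A) in
/-- The canonical identification of `A` with its bidual, `a ↦ (ω ↦ ω(a))`. -/
def bidual : A ≃ₗ[ℂ] QDual (QDual A) :=
  ((Module.evalEquiv ℂ A).trans (LinearEquiv.dualMap (QDual.toDual (A := A)))).trans
    QDual.toDual.symm

theorem bidual_apply (a : A) (ω : QDual A) :
    QDual.toDual (bidual A a) ω = QDual.toDual ω a := rfl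

variable {B : Type u} [CStarAlgebra B]

/-- The transported map `α̂ = h(η)⁻¹ (ℱ ⊗ id) ∘ α ∘ ℱ̂ ∘ Ŝ : Â → Â ⊗ B`, where `ℱ̂` is the Fourier
transform of the dual, with values in the bidual, which is identified with `A`. -/
def hat (α : A →ₗ[ℂ] A ⊗[ℂ] B) : QDual A →ₗ[ℂ] QDual A ⊗[ℂ] B :=
  (haar A (haarElement A))⁻¹ •
    (LinearMap.rTensor B (fourier A) ∘ₗ α ∘ₗ (bidual A).symm.toLinearMap ∘ₗ
      fourier (QDual A) ∘ₗ antipode ℂ)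

end fourier

/-! ### Quantum families of automorphisms -/

section families

variable {A : Type v} [Ring A] [StarRing A] [HopfAlgebra ℂ A] [StarModule ℂ A]
variable {B : Type u} [CStarAlgebra B]

/-- `α` represents a quantum family of maps: it is a unital `*`-homomorphism. -/
structure IsQuantumFamily (α : A →ₗ[ℂ] A ⊗[ℂ] B) : Prop where
  map_one : α 1 = 1
  map_mul : ∀ a b, α (a * b) = α a * α b
  map_star : ∀ a, α (star a) = star (α a)

/-- `α` represents a quantum family of invertible maps: in addition, the Podleś condition holds,
that is, `α(A)(1 ⊗ B)` spans `A ⊗ B`. -/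
structure IsInvertibleFamily (α : A →ₗ[ℂ] A ⊗[ℂ] B) : Prop extends IsQuantumFamily α where
  podles : Submodule.span ℂ {x : A ⊗[ℂ] B | ∃ (a : A) (b : B), x = α a * ((1 : A) ⊗ₜ[ℂ] b)} = ⊤

/-- `α` represents a quantum family of automorphisms: in addition, it preserves the convolution
product (where `A ⊗ B` carries the convolution product of `A` and the product of `B`), the
convolution adjoint `a ↦ S(a*)`, and the Haar element. -/
structure IsAutFamily (α : A →ₗ[ℂ] A ⊗[ℂ] B) : Prop extends IsInvertibleFamily α where
  map_convProd : ∀ a b : A,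
    α (convProd a b) = TensorProduct.map₂ convProd (LinearMap.mul ℂ B) (α a) (α b)
  map_convAdjoint : ∀ a : A,
    α (antipode ℂ (star a)) = LinearMap.rTensor B (antipode ℂ) (star (α a))
  map_haarElement : α (haarElement A) = haarElement A ⊗ₜ[ℂ] (1 : B)

/-- The map `id ⊗ Λ : A ⊗ B → A ⊗ C` given by a unital `*`-homomorphism `Λ : B → C`. -/
abbrev idTensor (A : Type v) [Ring A] [HopfAlgebra ℂ A] {B C : Type u} [CStarAlgebra B]
    [CStarAlgebra C] (Λ : B →⋆ₐ[ℂ] C) : A ⊗[ℂ] B →ₗ[ℂ] A ⊗[ℂ] C :=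
  LinearMap.lTensor A (Λ : B →ₗ[ℂ] C)

end families

/-! ### Compact quantum groups and the quantum automorphism group -/

/-- A compact quantum group `ℍ` in the sense of Woronowicz: a unital C*-algebra `C(ℍ)` with a
coassociative unital `*`-homomorphism `Δ : C(ℍ) → C(ℍ) ⊗ C(ℍ)` into the spatial tensor product such
that `Δ(C(ℍ))(1 ⊗ C(ℍ))` and `(C(ℍ) ⊗ 1)Δ(C(ℍ))` span dense subspaces. -/
structure CompactQuantumGroup where
  carrier : Type u
  [cstar : CStarAlgebra carrier]
  comul : carrier →⋆ₐ[ℂ] SpatialTensor carrier carrier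
  coassoc : ∀ a, SpatialTensor.AssocRel
    (SpatialTensor.map comul (StarAlgHom.id ℂ carrier) (comul a))
    (SpatialTensor.map (StarAlgHom.id ℂ carrier) comul (comul a))
  dense_right : Dense (Submodule.span ℂ
    {x | ∃ a b : carrier, x = comul a * SpatialTensor.tmul 1 b} : Set (SpatialTensor carrier carrier))
  dense_left : Dense (Submodule.span ℂ
    {x | ∃ a b : carrier, x = SpatialTensor.tmul a 1 * comul b} : Set (SpatialTensor carrier carrier))

attribute [instance] CompactQuantumGroup.cstar

/-- A `*`-isomorphism of the algebras of functions that intertwines the coproducts, that is, an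
isomorphism of compact quantum groups. -/
def IsCQGIso (H K : CompactQuantumGroup.{u}) (Φ : H.carrier ≃⋆ₐ[ℂ] K.carrier) : Prop :=
  ∀ x, K.comul (Φ x) = SpatialTensor.map (Φ : H.carrier →⋆ₐ[ℂ] K.carrier)
    (Φ : H.carrier →⋆ₐ[ℂ] K.carrier) (H.comul x)

section qaut

variable (A : Type v) [Ring A] [StarRing A] [HopfAlgebra ℂ A] [StarModule ℂ A]

variable {A} in
/-- The action equation `(id ⊗ Δ) ∘ α = (α ⊗ id) ∘ α`, in `A ⊗ (C(ℍ) ⊗ C(ℍ))`. -/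
def ActionEquation (H : CompactQuantumGroup.{u}) (α : A →ₗ[ℂ] A ⊗[ℂ] H.carrier) : Prop :=
  ∀ a, idTensor A H.comul (α a) =
    LinearMap.lTensor A
      (SpatialTensor.ofAlg H.carrier H.carrier :
        H.carrier ⊗[ℂ] H.carrier →ₗ[ℂ] SpatialTensor H.carrier H.carrier)
      (TensorProduct.assoc ℂ A H.carrier H.carrier (LinearMap.rTensor H.carrier α (α a)))

variable {A} in
/-- `(B, α)` is a final object of the category of quantum families of automorphisms: `α` is a
quantum family of automorphisms, and each quantum family of automorphisms `γ : A → A ⊗ C` is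
`(id ⊗ Λ) ∘ α` for exactly one unital `*`-homomorphism `Λ : B → C`. -/
structure IsFinalAutFamily {B : Type u} [CStarAlgebra B] (α : A →ₗ[ℂ] A ⊗[ℂ] B) : Prop where
  isAutFamily : IsAutFamily α
  existsUnique : ∀ (C : Type u) [CStarAlgebra C] (γ : A →ₗ[ℂ] A ⊗[ℂ] C), IsAutFamily γ →
    ∃! Λ : B →⋆ₐ[ℂ] C, ∀ a, γ a = idTensor A Λ (α a)

/-- The compact quantum group `H`, acting by `α`, is the quantum automorphism group `qAut(𝔾)` of the
finite quantum group `𝔾` with `C(𝔾) = A`: the pair `(C(H), α)` is a final object of the category of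
quantum families of automorphisms of `𝔾`, and `α` is an action of `H`. -/
structure IsQAut (H : CompactQuantumGroup.{u}) (α : A →ₗ[ℂ] A ⊗[ℂ] H.carrier) : Prop where
  isFinal : IsFinalAutFamily α
  action : ActionEquation H α

end qaut

end QuantumAut

end

/-!
The Haar state of a finite quantum group is the normalized trace of the regular representation. This
trace is positive and faithful because `A` is a C*-algebra (`regTrace_star_mul_self`), and it is an
idempotent for the convolution of functionals because the bijective map `x ⊗ y ↦ Δ(x)(1 ⊗ y)`
intertwines left multiplication by `a ⊗ 1` with left multiplication by `Δ(a)` (`regTrace_comul`).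
A faithful idempotent state is invariant (`isHaarState_of_idempotent`). As the Haar state is a
trace, strong invariance (`strong_invariance`) yields `S² = id` (`antipode_antipode_eq`).

With these facts the Fourier transform `ℱ` exchanges the structures of `A` and of its dual: it
turns `⋆` into the product, `a ↦ S(a*)` into the involution, the Haar element into a multiple of the
unit, and the unit into the Haar element. It turns the product of `A` into a multiple of the
convolution product of the dual, with the order reversed (`convProd_fourier`). The reversal is
harmless: a family of automorphisms commutes with the antipode, which reverses products, so that it
is also multiplicative for the opposite product of `A` (`map_flip_of_map_antipode`). By Fourier
inversion `α̂` is the conjugate `(ℱ ⊗ id) ∘ α ∘ ℱ⁻¹` (`hat_fourier`), whence `α ↦ α̂` is a bijection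
between the families of automorphisms of `A` and those of its dual
(`isPreFamily_iff_of_fourier`), and it preserves finality and the action equation (`IsQAut.hat`).

For existence, fix a basis of `A` that is orthonormal for the Haar state. A family `α` is determined
by its coefficient matrix, and since `1 ⋆ a = h(a)1` the Haar state is preserved; together with
the Podleś condition this makes the coefficient matrix unitary (`IsPreFamily.unitary`). Its entries
are therefore uniformly bounded, and the free `*`-algebra on the matrix entries has a largest
C*-seminorm compatible with all families. Its separated completion carries the final family
(`isFinalAutFamily_univ`). Finality, applied to `(α ⊗ id) ∘ α`, provides the coproduct, and
unitarity of the coefficient matrix provides the density conditions (`exists_isQAut`).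

Finally, `(H, α̂)` and `(K, β)` are both final for the dual, hence isomorphic in a unique way, and
the isomorphism respects the coproducts because these are determined by finality as well
(`IsQAut.isCQGIso`).
-/

noncomputable section

namespace QuantumAut

open Coalgebra HopfAlgebra

section haarState

open scoped ComplexOrder

/-! ### The trace of the regular representation -/

section regularTrace

/-- The trace of left multiplication by `x` on the algebra `A`, as a function of `x`. -/
def regTrace (A : Type v) [Ring A] [Algebra ℂ A] : A →ₗ[ℂ] ℂ :=
  LinearMap.trace ℂ A ∘ₗ (Algebra.lmul ℂ A).toLinearMap

theorem regTrace_apply {A : Type v} [Ring A] [Algebra ℂ A] (x : A) :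
    regTrace A x = LinearMap.trace ℂ A (Algebra.lmul ℂ A x) := rfl

variable {A : Type v} [Ring A] [Algebra ℂ A]

theorem regTrace_mul_comm (a b : A) : regTrace A (a * b) = regTrace A (b * a) := by
  rw [regTrace_apply, regTrace_apply, map_mul (Algebra.lmul ℂ A), map_mul (Algebra.lmul ℂ A),
    LinearMap.trace_mul_comm]

/-- An element of a finite-dimensional algebra is invertible as soon as left multiplication by it
is, so the regular representation preserves spectra. -/
theorem spectrum_leftMulMatrix {ι : Type*} [Fintype ι] [DecidableEq ι] (b : Module.Basis ι ℂ A)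
    (x : A) : spectrum ℂ (Algebra.leftMulMatrix b x) = spectrum ℂ x := by
  refine subset_antisymm (AlgHom.spectrum_apply_subset (Algebra.leftMulMatrix b) x) ?_
  intro z hz hu
  refine hz ?_
  change IsUnit (algebraMap ℂ A z - x)
  have h1 : IsUnit (Algebra.leftMulMatrix b (algebraMap ℂ A z - x)) := by
    rw [map_sub, AlgHom.commutes]
    exact hu
  set y := algebraMap ℂ A z - x
  have h2 : IsUnit (LinearMap.mulLeft ℂ y) := by
    have h3 : LinearMap.toMatrixAlgEquiv b (LinearMap.mulLeft ℂ y) = Algebra.leftMulMatrix b y :=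
      rfl
    rw [← h3] at h1
    simpa using h1
  rw [Module.End.isUnit_iff] at h2
  obtain ⟨w, hw⟩ := h2.2 1
  have hw : y * w = 1 := hw
  have hw' : w * y = 1 := h2.1 (by simp [← mul_assoc, hw])
  exact ⟨⟨y, w, hw, hw'⟩, rfl⟩

variable [Module.Finite ℂ A]

/-- The regular trace is the sum of the spectrum, with multiplicities. -/
theorem regTrace_eq_sum_spectrum (x : A) :
    ∃ s : Multiset ℂ, regTrace A x = s.sum ∧ ∀ z, z ∈ s ↔ z ∈ spectrum ℂ x := by
  let b := Module.finBasis ℂ A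
  refine ⟨(Algebra.leftMulMatrix b x).charpoly.roots, ?_, fun z => ?_⟩
  · rw [← Matrix.trace_eq_sum_roots_charpoly, regTrace_apply, LinearMap.trace_eq_matrix_trace ℂ b]
    rfl
  · rw [← spectrum_leftMulMatrix b, Matrix.mem_spectrum_iff_isRoot_charpoly,
      Polynomial.mem_roots (Matrix.charpoly_monic _).ne_zero]

variable [StarRing A] [StarModule ℂ A]

/-- In a finite-dimensional C*-algebra the regular trace is positive and faithful: the trace of
`a*a` is the sum of the spectrum of the positive element `a*a`, with multiplicities. -/
theorem regTrace_star_mul_self (N : AlgebraNorm ℂ A) (hN : ∀ a : A, N (star a * a) = N a * N a)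
    (a : A) : 0 ≤ regTrace A (star a * a) ∧
      (regTrace A (star a * a) = 0 → a = 0) := by
  let N' : RingNorm A :=
    { toFun := N
      map_zero' := map_zero N
      add_le' := map_add_le_add N
      neg' := map_neg_eq_map N
      mul_le' := map_mul_le_mul N
      eq_zero_of_map_eq_zero' := fun x => eq_zero_of_map_eq_zero N }
  let : NormedRing A := N'.toNormedRing
  let : NormedAlgebra ℂ A :=
    { ‹Algebra ℂ A› with norm_smul_le := fun c x => (map_smul_eq_mul N c x).le }
  have : CompleteSpace A := FiniteDimensional.complete ℂ A
  let : CStarAlgebra A :=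
    { norm_mul_self_le := fun x => (hN x).ge }
  obtain ⟨s, hs, hmem⟩ := regTrace_eq_sum_spectrum (star a * a)
  have hpos : ∀ z ∈ s, 0 ≤ z := by
    intro z hz
    have hz' := (hmem z).1 hz
    have hsa : IsSelfAdjoint (star a * a) := IsSelfAdjoint.star_mul_self a
    have hre := hsa.mem_spectrum_eq_re hz'
    rw [hre] at hz' ⊢
    have h3 : z.re ∈ spectrum ℝ (star a * a) := spectrum.of_algebraMap_mem ℂ hz'
    exact_mod_cast spectrum_star_mul_self_nonneg _ h3
  refine ⟨hs ▸ Multiset.sum_nonneg hpos, fun h0 => ?_⟩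
  rw [hs] at h0
  have hz : ∀ z ∈ s, z = 0 := fun z hz =>
    le_antisymm ((Multiset.single_le_sum hpos z hz).trans h0.le) (hpos z hz)
  -- A self-adjoint element of spectral radius zero vanishes.
  have hsa : IsSelfAdjoint (star a * a) := IsSelfAdjoint.star_mul_self a
  have hr := hsa.spectralRadius_eq_nnnorm
  have hr0 : spectralRadius ℂ (star a * a) = 0 := by
    unfold spectralRadius
    simp only [ENNReal.iSup_eq_zero]
    intro z hz'
    simp [hz z ((hmem z).2 hz')]
  rw [hr0] at hr
  have h4 : star a * a = 0 := by
    have : ‖star a * a‖₊ = 0 := by exact_mod_cast hr.symm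
    simpa using this
  exact CStarRing.star_mul_self_eq_zero_iff a |>.1 h4

end regularTrace

/-! ### The Galois map, and the trace as an idempotent functional -/

section galois

variable {A : Type v} [Ring A] [HopfAlgebra ℂ A]

/-- The map `x ⊗ y ↦ x₁ ⊗ f(x₂)y`. -/
def galois (f : A →ₗ[ℂ] A) : A ⊗[ℂ] A →ₗ[ℂ] A ⊗[ℂ] A :=
  LinearMap.lTensor A (LinearMap.mul' ℂ A ∘ₗ LinearMap.rTensor A f) ∘ₗ
    (TensorProduct.assoc ℂ A A A).toLinearMap ∘ₗ LinearMap.rTensor A (comul (R := ℂ))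

theorem galois_tmul (f : A →ₗ[ℂ] A) (x y : A) :
    galois f (x ⊗ₜ y) = LinearMap.lTensor A ((LinearMap.mulRight ℂ y) ∘ₗ f) (comul (R := ℂ) x) := by
  change LinearMap.lTensor A (LinearMap.mul' ℂ A ∘ₗ LinearMap.rTensor A f)
    (TensorProduct.assoc ℂ A A A (comul (R := ℂ) x ⊗ₜ y)) = _
  induction comul (R := ℂ) x with
  | zero => simp
  | add s t hs ht => simp only [TensorProduct.add_tmul, map_add, hs, ht]
  | tmul a b => simp

/-- `f ↦ galois f` is multiplicative for the convolution product; this is coassociativity. -/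
theorem galois_comp (f g : A →ₗ[ℂ] A) (t : A ⊗[ℂ] A) :
    galois f (galois g t) =
      galois (WithConv.ofConv (WithConv.toConv f * WithConv.toConv g)) t := by
  induction t with
  | zero => simp
  | add s t hs ht => simp only [map_add, hs, ht]
  | tmul x y =>
    let L : A ⊗[ℂ] (A ⊗[ℂ] A) →ₗ[ℂ] A ⊗[ℂ] A := LinearMap.lTensor A
      (LinearMap.mulRight ℂ y ∘ₗ LinearMap.mul' ℂ A ∘ₗ TensorProduct.map f g)
    have h1 : ∀ s : A ⊗[ℂ] A, galois f (LinearMap.lTensor A ((LinearMap.mulRight ℂ y) ∘ₗ g) s) =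
        L (TensorProduct.assoc ℂ A A A (LinearMap.rTensor A (comul (R := ℂ)) s)) := by
      intro s
      induction s with
      | zero => simp
      | add s t hs ht => simp only [map_add, hs, ht]
      | tmul a b =>
        rw [LinearMap.lTensor_tmul, galois_tmul, LinearMap.rTensor_tmul]
        induction comul (R := ℂ) a with
        | zero => simp
        | add s t hs ht => simp only [TensorProduct.add_tmul, map_add, hs, ht]
        | tmul a b => simp [L, mul_assoc]
    have h2 : ∀ s : A ⊗[ℂ] A, LinearMap.lTensor A ((LinearMap.mulRight ℂ y) ∘ₗ
        (WithConv.ofConv (WithConv.toConv f * WithConv.toConv g))) s =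
        L (LinearMap.lTensor A (comul (R := ℂ)) s) := by
      intro s
      induction s with
      | zero => simp
      | add s t hs ht => simp only [map_add, hs, ht]
      | tmul a b => rfl
    rw [galois_tmul, h1, coassoc_apply, galois_tmul, h2]

theorem galois_one (t : A ⊗[ℂ] A) :
    galois (WithConv.ofConv (1 : WithConv (A →ₗ[ℂ] A))) t = t := by
  induction t with
  | zero => simp
  | add s t hs ht => simp only [map_add, hs, ht]
  | tmul x y =>
    rw [galois_tmul, ← (ℛ ℂ x).eq, map_sum]
    have h := congrArg (LinearMap.lTensor A (LinearMap.toSpanSingleton ℂ A y))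
      (sum_tmul_counit_eq (ℛ ℂ x))
    rw [map_sum] at h
    simp only [LinearMap.lTensor_tmul, LinearMap.toSpanSingleton_apply, one_smul] at h
    rw [← h]
    refine Finset.sum_congr rfl fun i _ => ?_
    simp [LinearMap.convOne_def, Algebra.algebraMap_eq_smul_one]

/-- The Galois map `x ⊗ y ↦ Δ(x)(1 ⊗ y)` is bijective, with inverse `x ⊗ y ↦ x₁ ⊗ S(x₂)y`. -/
def galoisEquiv : A ⊗[ℂ] A ≃ₗ[ℂ] A ⊗[ℂ] A :=
  LinearEquiv.ofLinearMap (galois LinearMap.id) (galois (antipode ℂ))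
    (LinearMap.ext fun t => by
      rw [LinearMap.comp_apply, galois_comp, LinearMap.id_mul_antipode, galois_one]; rfl)
    (LinearMap.ext fun t => by
      rw [LinearMap.comp_apply, galois_comp, LinearMap.antipode_mul_id, galois_one]; rfl)

theorem galoisEquiv_tmul (x y : A) :
    galoisEquiv (x ⊗ₜ y) = comul (R := ℂ) x * (1 ⊗ₜ[ℂ] y) := by
  change galois LinearMap.id _ = _
  rw [galois_tmul]
  induction comul (R := ℂ) x with
  | zero => simp
  | add s t hs ht => simp only [add_mul, map_add, hs, ht]
  | tmul a b => simp

/-- The Galois map intertwines left multiplication by `a ⊗ 1` with left multiplication by `Δ(a)`,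
so that both have the same trace. -/
theorem regTrace_comul (a : A) :
    regTrace (A ⊗[ℂ] A) (comul (R := ℂ) a) = regTrace (A ⊗[ℂ] A) (a ⊗ₜ[ℂ] (1 : A)) := by
  rw [regTrace_apply, regTrace_apply,
    ← LinearMap.trace_conj' (Algebra.lmul ℂ (A ⊗[ℂ] A) (a ⊗ₜ[ℂ] (1 : A))) galoisEquiv]
  congr 1
  refine LinearMap.ext fun t => ?_
  obtain ⟨t, rfl⟩ := galoisEquiv.surjective t
  rw [LinearEquiv.conj_apply_apply, LinearEquiv.symm_apply_apply]
  induction t with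
  | zero => simp
  | add s t hs ht => simp only [map_add, hs, ht]
  | tmul x y =>
    simp [galoisEquiv_tmul, mul_assoc]

variable [Module.Finite ℂ A]

theorem regTrace_tensor (t : A ⊗[ℂ] A) :
    regTrace (A ⊗[ℂ] A) t = TensorProduct.lid ℂ ℂ
      (TensorProduct.map (regTrace A) (regTrace A) t) := by
  induction t with
  | zero => simp
  | add s t hs ht => simp only [map_add, hs, ht]
  | tmul x y =>
    simp only [TensorProduct.map_tmul, regTrace_apply, TensorProduct.lid_tmul, smul_eq_mul]
    rw [← LinearMap.trace_tensorProduct']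
    congr 1
    ext a b
    simp

end galois

/-! ### Faithful positive functionals -/

section faithful

variable {A : Type v} [Ring A] [StarRing A] [Algebra ℂ A] [StarModule ℂ A]

/-- A positive functional is hermitian, by polarization of `h((a + c1)*(a + c1)) ∈ ℝ` for
`c = 1` and `c = i`. -/
theorem map_star_of_nonneg {h : A →ₗ[ℂ] ℂ} (hpos : ∀ a, 0 ≤ h (star a * a)) (a : A) :
    h (star a) = star (h a) := by
  have key : ∀ c : ℂ, (c * h (star a) + star c * h a).im = 0 := by
    intro c
    have h1 := (Complex.nonneg_iff.1 (hpos (a + c • 1))).2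
    have h2 := (Complex.nonneg_iff.1 (hpos a)).2
    have h3 := (Complex.nonneg_iff.1 (hpos (c • 1))).2
    have h4 : star (a + c • 1) * (a + c • 1) =
        star a * a + star (c • (1 : A)) * (c • 1) + (c • star a + star c • a) := by
      simp only [star_add, star_smul, star_one, add_mul, mul_add, smul_mul_assoc, mul_smul_comm,
        one_mul, mul_one, smul_add]
      abel
    rw [h4, map_add, map_add, Complex.add_im, Complex.add_im, ← h2, ← h3] at h1
    simpa using h1.symm
  have k1 := key 1
  have k2 := key Complex.I
  simp at k1 k2
  apply Complex.ext
  · simp; linarith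
  · simp; linarith

theorem exists_sum_basis_tmul {A : Type*} [Ring A] [Algebra ℂ A] {B : Type*} [AddCommGroup B]
    [Module ℂ B] {ι : Type*} [Fintype ι]
    (e : Module.Basis ι ℂ A) (t : A ⊗[ℂ] B) : ∃ c : ι → B, t = ∑ i, e i ⊗ₜ c i := by
  classical
  refine ⟨fun i => TensorProduct.equivFinsuppOfBasisLeft e t i, ?_⟩
  conv_lhs => rw [← (TensorProduct.equivFinsuppOfBasisLeft e).symm_apply_apply t]
  rw [TensorProduct.equivFinsuppOfBasisLeft_symm_apply, Finsupp.sum_fintype _ _ (by simp)]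

theorem lid_map_star_mul {h : A →ₗ[ℂ] ℂ} {ι : Type*} [Fintype ι] [DecidableEq ι]
    {e : Module.Basis ι ℂ A} (he : ∀ i j, h (star (e i) * e j) = if i = j then 1 else 0)
    {B : Type*} [Ring B] [StarRing B] [Algebra ℂ B] [StarModule ℂ B] (c d : ι → B) :
    TensorProduct.lid ℂ B (LinearMap.rTensor B h
      (star (∑ i, e i ⊗ₜ[ℂ] c i) * ∑ i, e i ⊗ₜ[ℂ] d i)) = ∑ i, star (c i) * d i := by
  simp [star_sum, Finset.sum_mul_sum, he]

variable [Module.Finite ℂ A]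

/-- A basis of `A` that is orthonormal for the inner product `h(a*b)`. -/
theorem exists_orthonormal_basis {h : A →ₗ[ℂ] ℂ} (hpos : ∀ a, 0 ≤ h (star a * a))
    (hf : ∀ a, h (star a * a) = 0 → a = 0) :
    ∃ e : Module.Basis (Fin (Module.finrank ℂ A)) ℂ A,
      ∀ i j, h (star (e i) * e j) = if i = j then 1 else 0 := by
  let core : InnerProductSpace.Core ℂ A :=
    { inner := fun a b => h (star a * b)
      conj_inner_symm := fun a b => by
        change star (h (star b * a)) = _
        rw [← map_star_of_nonneg hpos, star_mul, star_star]
      re_inner_nonneg := fun a => (Complex.nonneg_iff.1 (hpos a)).1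
      add_left := fun a b c => by simp [add_mul]
      smul_left := fun a b c => by simp
      definite := fun a => hf a }
  let : NormedAddCommGroup A := core.toNormedAddCommGroup
  let : InnerProductSpace ℂ A := InnerProductSpace.ofCore core.toCore
  refine ⟨(stdOrthonormalBasis ℂ A).toBasis, fun i j => ?_⟩
  have := orthonormal_iff_ite.1 (stdOrthonormalBasis ℂ A).orthonormal i j
  rw [OrthonormalBasis.coe_toBasis]
  exact this

/-- The tensor square of a faithful positive functional is faithful. -/
theorem eq_zero_of_tensor_faithful {h : A →ₗ[ℂ] ℂ} (hpos : ∀ a, 0 ≤ h (star a * a))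
    (hf : ∀ a, h (star a * a) = 0 → a = 0) (X : A ⊗[ℂ] A)
    (hX : h (TensorProduct.lid ℂ A (LinearMap.rTensor A h (star X * X))) = 0) : X = 0 := by
  obtain ⟨e, he⟩ := exists_orthonormal_basis hpos hf
  obtain ⟨c, rfl⟩ := exists_sum_basis_tmul e X
  rw [lid_map_star_mul he, map_sum] at hX
  have h0 : ∀ i, c i = 0 := fun i =>
    hf _ ((Finset.sum_eq_zero_iff_of_nonneg fun j _ => hpos (c j)).1 hX i (Finset.mem_univ i))
  simp [h0]

end faithful

/-! ### The Haar state -/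

section haar

variable {A : Type v} [Ring A] [StarRing A] [HopfAlgebra ℂ A]

theorem IsHaarState.sum_left {h : A →ₗ[ℂ] ℂ} (hh : IsHaarState h) {a : A} {ι : Type*}
    (r : Coalgebra.Repr ℂ a ι) : ∑ i ∈ r.index, h (r.left i) • r.right i = h a • 1 := by
  rw [← hh.left_invariant, ← r.eq]
  simp

theorem IsHaarState.sum_right {h : A →ₗ[ℂ] ℂ} (hh : IsHaarState h) {a : A} {ι : Type*}
    (r : Coalgebra.Repr ℂ a ι) : ∑ i ∈ r.index, h (r.right i) • r.left i = h a • 1 := by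
  rw [← hh.right_invariant, ← r.eq]
  simp

theorem IsHaarState.unique {h k : A →ₗ[ℂ] ℂ} (hh : IsHaarState h) (hk : IsHaarState k) :
    h = k := by
  refine LinearMap.ext fun a => ?_
  have h1 := congrArg k (hh.sum_left (ℛ ℂ a))
  have h2 := congrArg h (hk.sum_right (ℛ ℂ a))
  simp only [map_sum, map_smul, smul_eq_mul, hh.map_one, hk.map_one, mul_one] at h1 h2
  rw [← h1, ← h2]
  exact Finset.sum_congr rfl fun i _ => mul_comm _ _

theorem IsHaarState.haar_eq {h : A →ₗ[ℂ] ℂ} (hh : IsHaarState h) : haar A = h :=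
  (Classical.epsilon_spec (⟨h, hh⟩ : ∃ h, IsHaarState h) : IsHaarState (haar A)).unique hh

variable [FiniteHopfStar A]

theorem lid_rTensor_star {h : A →ₗ[ℂ] ℂ} (hpos : ∀ a, 0 ≤ h (star a * a)) (s : A ⊗[ℂ] A) :
    TensorProduct.lid ℂ A (LinearMap.rTensor A h (star s)) =
      star (TensorProduct.lid ℂ A (LinearMap.rTensor A h s)) := by
  induction s with
  | zero => simp
  | add s t hs ht => simp only [star_add, map_add, hs, ht]
  | tmul a b => simp [map_star_of_nonneg hpos]

/-- If `h` is a faithful state with `(h ⊗ h)δ = h` and `(h ⊗ id)δ(b) = b`, then `δ(b) = 1 ⊗ b`,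
because `X = δ(b) - 1 ⊗ b` satisfies `(h ⊗ h)(X*X) = 0`. -/
theorem eq_one_tmul_of_idempotent {h : A →ₗ[ℂ] ℂ} (hpos : ∀ a, 0 ≤ h (star a * a))
    (hf : ∀ a, h (star a * a) = 0 → a = 0) (h1 : h 1 = 1) (δ : A →ₗ[ℂ] A ⊗[ℂ] A)
    (hmul : ∀ a b, δ (a * b) = δ a * δ b) (hstar : ∀ a, δ (star a) = star (δ a))
    (hid : ∀ a, h (TensorProduct.lid ℂ A (LinearMap.rTensor A h (δ a))) = h a) {b : A}
    (hb : TensorProduct.lid ℂ A (LinearMap.rTensor A h (δ b)) = b) : δ b = 1 ⊗ₜ b := by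
  have hr : ∀ (s : A ⊗[ℂ] A) (c : A), TensorProduct.lid ℂ A (LinearMap.rTensor A h
      (s * 1 ⊗ₜ[ℂ] c)) = TensorProduct.lid ℂ A (LinearMap.rTensor A h s) * c := by
    intro s c
    induction s with
    | zero => simp
    | add s t hs ht => simp only [add_mul, map_add, hs, ht]
    | tmul x y => simp
  have hl : ∀ (s : A ⊗[ℂ] A) (c : A), TensorProduct.lid ℂ A (LinearMap.rTensor A h
      (1 ⊗ₜ[ℂ] c * s)) = c * TensorProduct.lid ℂ A (LinearMap.rTensor A h s) := by
    intro s c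
    induction s with
    | zero => simp
    | add s t hs ht => simp only [mul_add, map_add, hs, ht]
    | tmul x y => simp
  refine sub_eq_zero.1 (eq_zero_of_tensor_faithful hpos hf _ ?_)
  have hX : star (δ b - 1 ⊗ₜ b) * (δ b - 1 ⊗ₜ b) =
      δ (star b * b) - δ (star b) * 1 ⊗ₜ b - 1 ⊗ₜ star b * δ b + 1 ⊗ₜ[ℂ] (star b * b) := by
    rw [star_sub, TensorProduct.star_tmul, star_one, hmul, hstar, sub_mul, mul_sub, mul_sub,
      Algebra.TensorProduct.tmul_mul_tmul, one_mul]
    abel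
  rw [hX]
  simp only [map_add, map_sub]
  rw [hid, hr, hl, hstar, lid_rTensor_star hpos, hb]
  simp [h1]

/-- A faithful state that is idempotent for the convolution of functionals is a Haar state. -/
theorem isHaarState_of_idempotent {h : A →ₗ[ℂ] ℂ} (hpos : ∀ a, 0 ≤ h (star a * a))
    (hf : ∀ a, h (star a * a) = 0 → a = 0) (h1 : h 1 = 1)
    (hid : ∀ a, h (TensorProduct.lid ℂ A (LinearMap.rTensor A h (comul a))) = h a) :
    IsHaarState h := by
  have hflip : ∀ s : A ⊗[ℂ] A, TensorProduct.lid ℂ A (LinearMap.rTensor A h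
      (TensorProduct.comm ℂ A A s)) = TensorProduct.rid ℂ A (LinearMap.lTensor A h s) := by
    intro s
    induction s with
    | zero => simp
    | add s t hs ht => simp only [map_add, hs, ht]
    | tmul x y => simp
  have hsym : ∀ s : A ⊗[ℂ] A, h (TensorProduct.rid ℂ A (LinearMap.lTensor A h s)) =
      h (TensorProduct.lid ℂ A (LinearMap.rTensor A h s)) := by
    intro s
    induction s with
    | zero => simp
    | add s t hs ht => simp only [map_add, hs, ht]
    | tmul x y => simp [mul_comm]
  refine ⟨h1, hpos, fun a => ?_, fun a => ?_⟩
  -- The element `b = (h ⊗ id)Δ(a)` satisfies `(h ⊗ id)Δ(b) = b`, hence `Δ(b) = 1 ⊗ b`, and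
  -- applying the counit shows that `b` is a scalar.
  · set b := TensorProduct.lid ℂ A (LinearMap.rTensor A h (comul a)) with hb
    let M : A ⊗[ℂ] (A ⊗[ℂ] A) →ₗ[ℂ] A := (TensorProduct.lid ℂ A).toLinearMap ∘ₗ
      TensorProduct.map h ((TensorProduct.lid ℂ A).toLinearMap ∘ₗ LinearMap.rTensor A h)
    have hfix : TensorProduct.lid ℂ A (LinearMap.rTensor A h (comul b)) = b := by
      have e1 : ∀ s : A ⊗[ℂ] A, TensorProduct.lid ℂ A (LinearMap.rTensor A h (comul (R := ℂ)
          (TensorProduct.lid ℂ A (LinearMap.rTensor A h s)))) =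
          M (LinearMap.lTensor A (comul (R := ℂ)) s) := by
        intro s
        induction s with
        | zero => simp
        | add s t hs ht => simp only [map_add, hs, ht]
        | tmul x y => simp [M]
      have e2 : ∀ s : A ⊗[ℂ] A, M (TensorProduct.assoc ℂ A A A
          (LinearMap.rTensor A (comul (R := ℂ)) s)) =
          TensorProduct.lid ℂ A (LinearMap.rTensor A h s) := by
        intro s
        induction s with
        | zero => simp
        | add s t hs ht => simp only [map_add, hs, ht]
        | tmul x y =>
          rw [LinearMap.rTensor_tmul, LinearMap.rTensor_tmul, TensorProduct.lid_tmul, ← hid x]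
          induction comul (R := ℂ) x with
          | zero => simp
          | add s t hs ht => simp only [TensorProduct.add_tmul, add_smul, map_add, hs, ht]
          | tmul p q => simp [M, smul_smul, mul_comm]
      rw [hb, e1, ← coassoc_apply, e2]
    have hone := eq_one_tmul_of_idempotent hpos hf h1 (comul (R := ℂ)) Bialgebra.comul_mul
      FiniteHopfStar.comul_star hid hfix
    have hsc : b = counit (R := ℂ) b • 1 := by
      have := congrArg (TensorProduct.rid ℂ A) (lTensor_counit_comul (R := ℂ) b)
      rw [hone] at this
      simpa using this.symm
    rw [hsc, ← hid a, ← hb]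
    conv_rhs => rw [hsc]
    simp [h1]
  -- The same argument for the opposite coproduct.
  · set b := TensorProduct.rid ℂ A (LinearMap.lTensor A h (comul a)) with hb
    let M : A ⊗[ℂ] (A ⊗[ℂ] A) →ₗ[ℂ] A := (TensorProduct.rid ℂ A).toLinearMap ∘ₗ
      LinearMap.lTensor A (h ∘ₗ (TensorProduct.lid ℂ A).toLinearMap ∘ₗ LinearMap.rTensor A h)
    have hfix : TensorProduct.rid ℂ A (LinearMap.lTensor A h (comul b)) = b := by
      have e1 : ∀ s : A ⊗[ℂ] A, TensorProduct.rid ℂ A (LinearMap.lTensor A h (comul (R := ℂ)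
          (TensorProduct.rid ℂ A (LinearMap.lTensor A h s)))) =
          M (TensorProduct.assoc ℂ A A A (LinearMap.rTensor A (comul (R := ℂ)) s)) := by
        intro s
        induction s with
        | zero => simp
        | add s t hs ht => simp only [map_add, hs, ht]
        | tmul x y =>
          rw [LinearMap.rTensor_tmul, LinearMap.lTensor_tmul, TensorProduct.rid_tmul, map_smul]
          induction comul (R := ℂ) x with
          | zero => simp
          | add s t hs ht => simp only [TensorProduct.add_tmul, smul_add, map_add, hs, ht]
          | tmul p q => simp [M, smul_smul, mul_comm]
      have e2 : ∀ s : A ⊗[ℂ] A, M (LinearMap.lTensor A (comul (R := ℂ)) s) =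
          TensorProduct.rid ℂ A (LinearMap.lTensor A h s) := by
        intro s
        induction s with
        | zero => simp
        | add s t hs ht => simp only [map_add, hs, ht]
        | tmul x y => simp [M, hid]
      rw [hb, e1, coassoc_apply, e2]
    have hone := eq_one_tmul_of_idempotent hpos hf h1
      ((TensorProduct.comm ℂ A A).toLinearMap ∘ₗ comul (R := ℂ))
      (fun a b => by
        have := map_mul (Algebra.TensorProduct.comm ℂ A A) (comul (R := ℂ) a) (comul (R := ℂ) b)
        rw [LinearMap.comp_apply, Bialgebra.comul_mul]
        exact this)
      (fun a => by
        rw [LinearMap.comp_apply, LinearMap.comp_apply, FiniteHopfStar.comul_star]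
        induction comul (R := ℂ) a with
        | zero => simp
        | add s t hs ht => simp only [star_add, map_add, hs, ht]
        | tmul x y => simp)
      (fun a => by
        rw [LinearMap.comp_apply, LinearEquiv.coe_coe, hflip, hsym, hid])
      (b := b) (by
        rw [LinearMap.comp_apply, LinearEquiv.coe_coe, hflip, hfix])
    have hone' : comul (R := ℂ) b = b ⊗ₜ 1 := (TensorProduct.comm ℂ A A).injective hone
    have hsc : b = counit (R := ℂ) b • 1 := by
      have := congrArg (TensorProduct.lid ℂ A) (rTensor_counit_comul (R := ℂ) b)
      rw [hone'] at this
      simpa using this.symm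
    have hh : h b = h a := by rw [hb, hsym, hid]
    rw [hsc, ← hh]
    conv_rhs => rw [hsc]
    simp [h1]

end haar

section haarExists

variable (A : Type v) [Ring A] [StarRing A] [HopfAlgebra ℂ A] [FiniteQuantumGroup A]

/-- The normalized regular trace is a faithful tracial Haar state. -/
theorem exists_haarState : ∃ h : A →ₗ[ℂ] ℂ, IsHaarState h ∧
    (∀ a, h (star a * a) = 0 → a = 0) ∧ ∀ a b, h (a * b) = h (b * a) := by
  obtain ⟨N, hN⟩ := FiniteQuantumGroup.exists_cstar_norm (A := A)
  have hpos := fun a => (regTrace_star_mul_self N hN a).1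
  have hf := fun a => (regTrace_star_mul_self N hN a).2
  have h10 : (1 : A) ≠ 0 := fun h => by
    have := congrArg (counit (R := ℂ)) h
    simp at this
  have ht0 : regTrace A 1 ≠ 0 := fun h => h10 (hf 1 (by simpa using h))
  have htpos : 0 < regTrace A 1 := lt_of_le_of_ne (by simpa using hpos 1) ht0.symm
  have hinv : 0 ≤ (regTrace A 1)⁻¹ := (inv_pos.2 htpos).le
  refine ⟨(regTrace A 1)⁻¹ • regTrace A, isHaarState_of_idempotent ?_ ?_ ?_ ?_, ?_, ?_⟩
  · exact fun a => mul_nonneg hinv (hpos a)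
  · intro a ha
    exact hf a (by simpa [ht0] using ha)
  · simp [ht0]
  -- With `τ` the regular trace, `(τ ⊗ τ)Δ(a) = (τ ⊗ τ)(a ⊗ 1) = τ(1)τ(a)`.
  · intro a
    have h1 := regTrace_comul a
    rw [regTrace_tensor, regTrace_tensor] at h1
    have h2 : ∀ s : A ⊗[ℂ] A, (regTrace A) (TensorProduct.lid ℂ A (LinearMap.rTensor A (regTrace A)
        s)) = TensorProduct.lid ℂ ℂ (TensorProduct.map (regTrace A) (regTrace A) s) := by
      intro s
      induction s with
      | zero => simp
      | add s t hs ht => simp only [map_add, hs, ht]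
      | tmul x y => simp
    rw [LinearMap.rTensor_smul, LinearMap.smul_apply, LinearMap.smul_apply, LinearMap.smul_apply,
      map_smul, map_smul, h2, h1]
    simp only [TensorProduct.map_tmul, TensorProduct.lid_tmul, smul_eq_mul]
    field_simp
  · intro a ha
    exact hf a (by simpa [ht0] using ha)
  · intro a b
    rw [LinearMap.smul_apply, LinearMap.smul_apply, regTrace_mul_comm]

theorem isHaarState_haar : IsHaarState (haar A) := by
  obtain ⟨h, hh, -⟩ := exists_haarState A
  rwa [hh.haar_eq]

variable {A}

theorem haar_faithful {a : A} (ha : haar A (star a * a) = 0) : a = 0 := by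
  obtain ⟨h, hh, hf, -⟩ := exists_haarState A
  rw [hh.haar_eq] at ha
  exact hf a ha

theorem haar_mul_comm (a b : A) : haar A (a * b) = haar A (b * a) := by
  obtain ⟨h, hh, -, ht⟩ := exists_haarState A
  rw [hh.haar_eq, ht]

theorem haar_star (a : A) : haar A (star a) = star (haar A a) :=
  map_star_of_nonneg (isHaarState_haar A).nonneg a

theorem eq_of_haar_mul {a b : A} (h : ∀ x, haar A (x * a) = haar A (x * b)) : a = b := by
  refine sub_eq_zero.1 (haar_faithful ?_)
  rw [mul_sub, map_sub, h, sub_self]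

end haarExists

/-! ### Strong invariance and involutivity of the antipode -/

section antipode

variable {A : Type v} [Ring A] [HopfAlgebra ℂ A]

theorem sum_counit_right_smul {a : A} {ι : Type*} (r : Coalgebra.Repr ℂ a ι) :
    ∑ i ∈ r.index, counit (R := ℂ) (r.right i) • r.left i = a := by
  have h := congrArg (TensorProduct.rid ℂ A) (sum_tmul_counit_eq r)
  simpa only [map_sum, TensorProduct.rid_tmul, one_smul] using h

variable [StarRing A]

theorem convProd_apply (a : A) {b : A} {ι : Type*} (r : Coalgebra.Repr ℂ b ι) :
    convProd a b = ∑ i ∈ r.index, haar A (antipode ℂ (r.left i) * a) • r.right i := by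
  change TensorProduct.lid ℂ A (LinearMap.rTensor A (haar A)
      (LinearMap.rTensor A (antipode ℂ) (comul (R := ℂ) b) * (a ⊗ₜ[ℂ] (1 : A)))) = _
  rw [← r.eq]
  simp [Finset.sum_mul]

theorem counit_convProd (a b : A) :
    counit (R := ℂ) (convProd a b) = haar A (antipode ℂ b * a) := by
  have h := congrArg (fun y => haar A (antipode ℂ y * a)) (sum_counit_right_smul (ℛ ℂ b))
  simp only [map_sum, map_smul, Finset.sum_mul, smul_mul_assoc, smul_eq_mul] at h
  rw [convProd_apply a (ℛ ℂ b), ← h]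
  simp [mul_comm]

variable [FiniteQuantumGroup A]

/-- Strong invariance of the Haar state: `S((id ⊗ h)(Δ(a)(1 ⊗ b))) = (id ⊗ h)((1 ⊗ a)Δ(b))`. The
identity map convolved with the right-hand side is `a ↦ h(ab)1` by invariance, and the antipode is
the convolution inverse of the identity. -/
theorem strong_invariance {a b : A} {ι κ : Type*} (r : Coalgebra.Repr ℂ a ι)
    (q : Coalgebra.Repr ℂ b κ) :
    ∑ i ∈ r.index, haar A (r.right i * b) • antipode ℂ (r.left i) =
      ∑ j ∈ q.index, haar A (a * q.right j) • q.left j := by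
  let F : A →ₗ[ℂ] A := Algebra.linearMap ℂ A ∘ₗ haar A ∘ₗ LinearMap.mulRight ℂ b
  let G : A →ₗ[ℂ] A := ∑ j ∈ q.index,
    LinearMap.toSpanSingleton ℂ A (q.left j) ∘ₗ haar A ∘ₗ LinearMap.mulRight ℂ (q.right j)
  have hG : ∀ x, G x = ∑ j ∈ q.index, haar A (x * q.right j) • q.left j := fun x => by
    simp [G, LinearMap.sum_apply]
  have h1 : WithConv.toConv (LinearMap.id : A →ₗ[ℂ] A) * WithConv.toConv G =
      WithConv.toConv F := by
    apply WithConv.ext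
    refine LinearMap.ext fun x => ?_
    rw [(ℛ ℂ x).convMul_apply]
    have h2 := (isHaarState_haar A).sum_right ((ℛ ℂ x).mul q)
    have h3 : F x = haar A (x * b) • (1 : A) := by
      simp [F, Algebra.algebraMap_eq_smul_one]
    refine Eq.trans ?_ (h2.trans h3.symm)
    refine Eq.trans ?_ (Finset.sum_product _ _ _).symm
    refine Finset.sum_congr rfl fun i _ => ?_
    change (ℛ ℂ x).left i * G ((ℛ ℂ x).right i) = _
    rw [hG, Finset.mul_sum]
    refine Finset.sum_congr rfl fun j _ => ?_
    rw [mul_smul_comm]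
    rfl
  have h2 : WithConv.toConv G = WithConv.toConv (antipode ℂ (A := A)) * WithConv.toConv F := by
    rw [← h1, ← mul_assoc, LinearMap.antipode_mul_id, one_mul]
  have h3 := congrArg (fun f : WithConv (A →ₗ[ℂ] A) => f a) h2
  simp only [r.convMul_apply] at h3
  rw [← hG]
  refine Eq.trans ?_ h3.symm
  refine Finset.sum_congr rfl fun i _ => ?_
  simp [F, Algebra.algebraMap_eq_smul_one]

/-- The antipode of a finite quantum group is involutive: since the Haar state is a trace, strong
invariance says that `S` exchanges `(id ⊗ h)(Δ(a)(1 ⊗ b))` and `(id ⊗ h)(Δ(b)(1 ⊗ a))`, and these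
elements span. -/
theorem antipode_antipode_eq (a : A) : antipode ℂ (antipode ℂ a) = a := by
  let F : A ⊗[ℂ] A →ₗ[ℂ] A :=
    (TensorProduct.rid ℂ A).toLinearMap ∘ₗ LinearMap.lTensor A (haar A) ∘ₗ galoisEquiv.toLinearMap
  have hF : ∀ (x b : A) {ι : Type v} (r : Coalgebra.Repr ℂ x ι), F (x ⊗ₜ b) =
      ∑ i ∈ r.index, haar A (r.right i * b) • r.left i := by
    intro x b ι r
    change TensorProduct.rid ℂ A (LinearMap.lTensor A (haar A) (galoisEquiv (x ⊗ₜ b))) = _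
    rw [galoisEquiv_tmul, ← r.eq, Finset.sum_mul, map_sum, map_sum]
    simp
  have hS : ∀ x b : A, antipode ℂ (F (x ⊗ₜ b)) = F (b ⊗ₜ x) := by
    intro x b
    rw [hF x b (ℛ ℂ x), hF b x (ℛ ℂ b), map_sum]
    simp only [map_smul]
    rw [strong_invariance (ℛ ℂ x) (ℛ ℂ b)]
    exact Finset.sum_congr rfl fun j _ => by rw [haar_mul_comm]
  have key : ∀ t : A ⊗[ℂ] A, antipode ℂ (antipode ℂ (F t)) = F t := by
    intro t
    induction t with
    | zero => simp
    | add s t hs ht => simp only [map_add, hs, ht]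
    | tmul x b => rw [hS, hS]
  have ha : F (galoisEquiv.symm (a ⊗ₜ 1)) = a := by
    simp [F, (isHaarState_haar A).map_one]
  rw [← ha, key]

/-! ### The Haar element -/

theorem fourier_injective : Function.Injective (fourier A) := fun a b hab =>
  eq_of_haar_mul fun x => by rw [← fourier_apply, hab, fourier_apply]

variable (A) in
/-- The Fourier transform as a linear isomorphism. -/
def fourierEquiv : A ≃ₗ[ℂ] QDual A :=
  LinearEquiv.ofInjectiveOfFinrankEq (fourier A) fourier_injective
    (by rw [QDual.toDual.finrank_eq, Subspace.dual_finrank_eq])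

theorem fourierEquiv_apply (a : A) : fourierEquiv A a = fourier A a := rfl

/-- The definition of the Haar element by choice asks for left absorption only; an element that
absorbs on both sides agrees with every such choice. -/
theorem haarElement_eq {B : Type v} [Ring B] [HopfAlgebra ℂ B] {η : B}
    (h1 : counit (R := ℂ) η = 1) (hl : ∀ a : B, a * η = counit (R := ℂ) a • η)
    (hr : ∀ a : B, η * a = counit (R := ℂ) a • η) : haarElement B = η := by
  have h := Classical.epsilon_spec (p := fun η : B => counit (R := ℂ) η = 1 ∧
    ∀ a : B, a * η = counit (R := ℂ) a • η) ⟨η, h1, hl⟩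
  change counit (R := ℂ) (haarElement B) = 1 ∧
    ∀ a : B, a * haarElement B = counit (R := ℂ) a • haarElement B at h
  have e1 := h.2 η
  rw [hr, h.1, h1, one_smul, one_smul] at e1
  exact e1.symm

/-- The Haar element is the multiple of the inverse Fourier transform of the counit with
`ε(η) = 1`. -/
theorem exists_haarElement : ∃ η : A, counit (R := ℂ) η = 1 ∧
    (∀ a : A, a * η = counit (R := ℂ) a • η) ∧ ∀ a : A, η * a = counit (R := ℂ) a • η := by
  obtain ⟨η, hη⟩ := (fourierEquiv A).surjective 1
  have hη : ∀ x, haar A (x * η) = counit (R := ℂ) x := fun x => by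
    rw [← fourier_apply, ← fourierEquiv_apply, hη, QDual.one_apply]
  have hl : ∀ a : A, a * η = counit (R := ℂ) a • η := fun a => eq_of_haar_mul fun x => by
    rw [← mul_assoc, hη, Bialgebra.counit_mul, mul_smul_comm, map_smul, hη, smul_eq_mul, mul_comm]
  have hr : ∀ a : A, η * a = counit (R := ℂ) a • η := fun a => eq_of_haar_mul fun x => by
    rw [← mul_assoc, haar_mul_comm, ← mul_assoc, hη, Bialgebra.counit_mul, mul_smul_comm,
      map_smul, hη, smul_eq_mul]
  -- If `ε(η) = 0`, then `η*η = 0`, so `η = 0` by faithfulness, contradicting `ε = h(·η)`.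
  have h0 : counit (R := ℂ) η ≠ 0 := by
    intro h0
    have h1 : η = 0 := haar_faithful (by rw [hl, counit_star, h0, star_zero, zero_smul, map_zero])
    have h2 := hη 1
    rw [h1, mul_zero, map_zero, Bialgebra.counit_one] at h2
    exact zero_ne_one h2
  refine ⟨(counit (R := ℂ) η)⁻¹ • η, ?_, fun a => ?_, fun a => ?_⟩
  · rw [map_smul, smul_eq_mul, inv_mul_cancel₀ h0]
  · rw [mul_smul_comm, hl, smul_comm]
  · rw [smul_mul_assoc, hr, smul_comm]

theorem counit_haarElement : counit (R := ℂ) (haarElement A) = 1 := by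
  obtain ⟨η, h1, h2, h3⟩ := exists_haarElement (A := A)
  rw [haarElement_eq h1 h2 h3, h1]

theorem mul_haarElement (a : A) : a * haarElement A = counit (R := ℂ) a • haarElement A := by
  obtain ⟨η, h1, h2, h3⟩ := exists_haarElement (A := A)
  rw [haarElement_eq h1 h2 h3, h2]

theorem haarElement_mul (a : A) : haarElement A * a = counit (R := ℂ) a • haarElement A := by
  obtain ⟨η, h1, h2, h3⟩ := exists_haarElement (A := A)
  rw [haarElement_eq h1 h2 h3, h3]

theorem haar_mul_haarElement (a : A) :
    haar A (a * haarElement A) = haar A (haarElement A) * counit (R := ℂ) a := by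
  rw [mul_haarElement, map_smul, smul_eq_mul, mul_comm]

theorem haar_haarElement_mul (a : A) :
    haar A (haarElement A * a) = haar A (haarElement A) * counit (R := ℂ) a := by
  rw [haarElement_mul, map_smul, smul_eq_mul, mul_comm]

theorem star_haarElement_mul_self : star (haarElement A) * haarElement A = haarElement A := by
  rw [mul_haarElement, counit_star, counit_haarElement, star_one, one_smul]

theorem haar_haarElement_nonneg : 0 ≤ haar A (haarElement A) := by
  have h := (isHaarState_haar A).nonneg (haarElement A)
  rwa [star_haarElement_mul_self] at h

theorem haar_haarElement_ne_zero : haar A (haarElement A) ≠ 0 := by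
  intro h
  rw [← star_haarElement_mul_self] at h
  have h2 := counit_haarElement (A := A)
  rw [haar_faithful h, map_zero] at h2
  exact zero_ne_one h2

/-- The Haar state is invariant under the antipode: apply it to strong invariance with `b = η`. -/
theorem haar_antipode (a : A) : haar A (antipode ℂ a) = haar A a := by
  have h := congrArg (haar A) (strong_invariance (ℛ ℂ a) (ℛ ℂ (haarElement A)))
  have h2 := congrArg (haar A ∘ₗ LinearMap.mulLeft ℂ a)
    ((isHaarState_haar A).sum_left (ℛ ℂ (haarElement A)))
  have h3 := congrArg (haar A ∘ₗ antipode ℂ) (sum_counit_right_smul (ℛ ℂ a))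
  simp only [map_sum, map_smul, haar_mul_haarElement, smul_eq_mul, LinearMap.comp_apply,
    LinearMap.mulLeft_apply, mul_one] at h h2 h3
  have h4 : haar A (haarElement A) * haar A (antipode ℂ a) = haar A (haarElement A) * haar A a := by
    rw [← h2, ← h3, Finset.mul_sum]
    refine Eq.trans ?_ (h.trans ?_)
    · exact Finset.sum_congr rfl fun i _ => by ring
    · exact Finset.sum_congr rfl fun i _ => by ring
  exact mul_left_cancel₀ haar_haarElement_ne_zero h4

/-! ### The Fourier transform -/

/-- The Fourier transform is multiplicative for the convolution product. -/
theorem fourier_convProd (a b : A) : fourier A (convProd a b) = fourier A a * fourier A b := by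
  refine QDual.ext fun x => ?_
  rw [fourier_apply, convProd_apply a (ℛ ℂ b), QDual.mul_apply _ _ (ℛ ℂ x)]
  have h := congrArg (fun y => haar A (antipode ℂ y * a))
    (strong_invariance (ℛ ℂ x) (ℛ ℂ b))
  simp only [map_sum, map_smul, antipode_antipode_eq, Finset.sum_mul, smul_mul_assoc,
    smul_eq_mul] at h
  simp only [Finset.mul_sum, map_sum, mul_smul_comm, map_smul, smul_eq_mul, fourier_apply]
  refine Eq.trans ?_ (h.symm.trans ?_)
  · exact Finset.sum_congr rfl fun i _ => mul_comm _ _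
  · exact Finset.sum_congr rfl fun i _ => mul_comm _ _

theorem star_fourier (a : A) : star (fourier A a) = fourier A (antipode ℂ (star a)) := by
  refine QDual.ext fun x => ?_
  rw [QDual.star_apply, fourier_apply, fourier_apply, ← haar_star, star_mul, star_star,
    ← haar_antipode, antipode_mul_antidistrib, antipode_antipode_eq]

/-- The Haar state of the dual is the evaluation at the Haar element. -/
theorem haar_dual (ω : QDual A) : haar (QDual A) ω = QDual.toDual ω (haarElement A) := by
  let h : QDual A →ₗ[ℂ] ℂ := LinearMap.applyₗ (haarElement A) ∘ₗ QDual.toDual.toLinearMap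
  have hh : ∀ ω, h ω = QDual.toDual ω (haarElement A) := fun _ => rfl
  rw [← hh]
  congr 1
  refine IsHaarState.haar_eq ⟨?_, fun ω => ?_, fun ω => QDual.ext fun b => ?_,
    fun ω => QDual.ext fun b => ?_⟩
  · rw [hh, QDual.one_apply, counit_haarElement]
  · obtain ⟨a, rfl⟩ := (fourierEquiv A).surjective ω
    rw [fourierEquiv_apply, hh, star_fourier, ← fourier_convProd, fourier_apply,
      haar_haarElement_mul, counit_convProd, ← antipode_mul_antidistrib, haar_antipode]
    exact mul_nonneg haar_haarElement_nonneg ((isHaarState_haar A).nonneg a)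
  · have key : ∀ t : QDual A ⊗[ℂ] QDual A, QDual.toDual (TensorProduct.lid ℂ _
        (LinearMap.rTensor _ h t)) b = QDual.pair t (haarElement A ⊗ₜ b) := by
      intro t
      induction t with
      | zero => simp
      | add s t hs ht => simp only [map_add, LinearMap.add_apply, hs, ht]
      | tmul ω θ => simp [QDual.pair_tmul, hh]
    rw [key, QDual.pair_comul, haarElement_mul, hh, map_smul, map_smul, LinearMap.smul_apply,
      QDual.one_apply, smul_eq_mul, smul_eq_mul, mul_comm]
  · have key : ∀ t : QDual A ⊗[ℂ] QDual A, QDual.toDual (TensorProduct.rid ℂ _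
        (LinearMap.lTensor _ h t)) b = QDual.pair t (b ⊗ₜ haarElement A) := by
      intro t
      induction t with
      | zero => simp
      | add s t hs ht => simp only [map_add, LinearMap.add_apply, hs, ht]
      | tmul ω θ => simp [QDual.pair_tmul, hh, mul_comm]
    rw [key, QDual.pair_comul, mul_haarElement, hh, map_smul, map_smul, LinearMap.smul_apply,
      QDual.one_apply, smul_eq_mul, smul_eq_mul, mul_comm]

theorem haarElement_dual : haarElement (QDual A) = fourier A 1 := by
  refine haarElement_eq ?_ (fun ω => QDual.ext fun x => ?_) (fun ω => QDual.ext fun x => ?_)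
  · rw [QDual.counit_apply, fourier_apply, one_mul, (isHaarState_haar A).map_one]
  · have h := congrArg (QDual.toDual ω) ((isHaarState_haar A).sum_right (ℛ ℂ x))
    simp only [map_sum, map_smul, smul_eq_mul] at h
    rw [QDual.mul_apply _ _ (ℛ ℂ x), map_smul, LinearMap.smul_apply, QDual.counit_apply]
    simp only [fourier_apply, mul_one, smul_eq_mul]
    rw [mul_comm, ← h]
    exact Finset.sum_congr rfl fun i _ => mul_comm _ _
  · have h := congrArg (QDual.toDual ω) ((isHaarState_haar A).sum_left (ℛ ℂ x))
    simp only [map_sum, map_smul, smul_eq_mul] at h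
    rw [QDual.mul_apply _ _ (ℛ ℂ x), map_smul, LinearMap.smul_apply, QDual.counit_apply]
    simp only [fourier_apply, mul_one, smul_eq_mul]
    rw [mul_comm, ← h]

theorem fourier_haarElement : fourier A (haarElement A) = haar A (haarElement A) • 1 := by
  refine QDual.ext fun x => ?_
  rw [fourier_apply, haar_mul_haarElement, map_smul, LinearMap.smul_apply, QDual.one_apply,
    smul_eq_mul]

/-- The Fourier transform reverses products, up to a scalar, with respect to the convolution of
the dual. -/
theorem convProd_fourier (a b : A) : convProd (fourier A a) (fourier A b) =
    haar A (haarElement A) • fourier A (b * a) := by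
  refine QDual.ext fun x => ?_
  let r := ℛ ℂ (haarElement A)
  have key : ∀ (ω : QDual A) (t : QDual A ⊗[ℂ] QDual A),
      QDual.toDual (TensorProduct.lid ℂ (QDual A) (LinearMap.rTensor _ (haar (QDual A))
        (LinearMap.rTensor _ (antipode ℂ) t * (ω ⊗ₜ[ℂ] 1)))) x =
      ∑ i ∈ r.index, QDual.pair t (antipode ℂ (r.left i) ⊗ₜ x) * QDual.toDual ω (r.right i) := by
    intro ω t
    induction t with
    | zero => simp
    | add s t hs ht =>
      simp only [map_add, LinearMap.add_apply, add_mul, hs, ht, Finset.sum_add_distrib]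
    | tmul χ θ =>
      rw [LinearMap.rTensor_tmul, Algebra.TensorProduct.tmul_mul_tmul, LinearMap.rTensor_tmul,
        TensorProduct.lid_tmul, haar_dual, QDual.mul_apply _ _ r, mul_one, map_smul,
        LinearMap.smul_apply, smul_eq_mul, Finset.sum_mul]
      refine Finset.sum_congr rfl fun i _ => ?_
      rw [QDual.pair_tmul, QDual.antipode_apply]
      ring
  have h1 := key (fourier A a) (comul (R := ℂ) (fourier A b))
  refine h1.trans ?_
  simp only [QDual.pair_comul, fourier_apply]
  -- Strong invariance for the Haar element reads `h(η₂a)S(η₁) = h(ηa₂)a₁ = h(η)a`.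
  have h2 := congrArg (fun y => haar A (y * x * b)) (strong_invariance r (ℛ ℂ a))
  have h3 := congrArg (fun y => haar A (y * x * b)) (sum_counit_right_smul (ℛ ℂ a))
  simp only [haar_haarElement_mul, Finset.sum_mul, map_sum, smul_mul_assoc, map_smul,
    smul_eq_mul] at h2 h3
  rw [map_smul, LinearMap.smul_apply, fourier_apply, smul_eq_mul, ← mul_assoc,
    haar_mul_comm (x * b), ← mul_assoc, ← h3, Finset.mul_sum]
  refine Eq.trans ?_ (h2.trans ?_)
  · exact Finset.sum_congr rfl fun i _ => mul_comm _ _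
  · exact Finset.sum_congr rfl fun i _ => by ring

theorem antipode_fourier (a : A) : antipode ℂ (fourier A a) = fourier A (antipode ℂ a) := by
  refine QDual.ext fun x => ?_
  rw [QDual.antipode_apply, fourier_apply, fourier_apply, ← haar_antipode,
    antipode_mul_antidistrib, antipode_antipode_eq, haar_mul_comm]

/-- Fourier inversion. -/
theorem fourier_dual_antipode_fourier (a : A) :
    fourier (QDual A) (antipode ℂ (fourier A a)) = haar A (haarElement A) • bidual A a := by
  refine QDual.ext fun χ => ?_
  let r := ℛ ℂ (haarElement A)
  rw [fourier_apply, haar_dual, QDual.mul_apply _ _ r, antipode_fourier, map_smul,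
    LinearMap.smul_apply, bidual_apply]
  have h2 := congrArg (QDual.toDual χ) (strong_invariance (ℛ ℂ (antipode ℂ a)) r)
  have h3 := congrArg (fun y => QDual.toDual χ (antipode ℂ y))
    (sum_counit_right_smul (ℛ ℂ (antipode ℂ a)))
  simp only [haar_mul_haarElement, map_sum, map_smul, smul_eq_mul, antipode_antipode_eq] at h2 h3
  rw [← h3, smul_eq_mul, Finset.mul_sum]
  refine Eq.trans ?_ (h2.symm.trans ?_)
  · exact Finset.sum_congr rfl fun i _ => by rw [fourier_apply, haar_mul_comm, mul_comm]
  · exact Finset.sum_congr rfl fun i _ => by ring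

variable {B : Type u} [CStarAlgebra B]

/-- The transported map is the conjugate of `α` by the Fourier transform. -/
theorem hat_fourier (α : A →ₗ[ℂ] A ⊗[ℂ] B) (a : A) :
    hat α (fourier A a) = LinearMap.rTensor B (fourier A) (α a) := by
  change (haar A (haarElement A))⁻¹ • LinearMap.rTensor B (fourier A) (α ((bidual A).symm
    (fourier (QDual A) (antipode ℂ (fourier A a))))) = _
  rw [fourier_dual_antipode_fourier, map_smul, LinearEquiv.symm_apply_apply, map_smul, map_smul,
    inv_smul_smul₀ haar_haarElement_ne_zero]

end antipode

end haarState

/-! ### Families of automorphisms with values in a `*`-algebra -/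

section tensor

variable {A : Type*} [Ring A] [Algebra ℂ A]
variable {B C : Type*} [Ring B] [Algebra ℂ B] [Ring C] [Algebra ℂ C]

theorem map₂_mul_mul (x y : A ⊗[ℂ] B) :
    TensorProduct.map₂ (LinearMap.mul ℂ A) (LinearMap.mul ℂ B) x y = x * y := by
  induction x with
  | zero => simp
  | add s t hs ht => simp only [map_add, LinearMap.add_apply, add_mul, hs, ht]
  | tmul a b =>
    induction y with
    | zero => simp
    | add s t hs ht => simp only [map_add, mul_add, hs, ht]
    | tmul c d => simp

theorem lTensor_map₂ (p : A →ₗ[ℂ] A →ₗ[ℂ] A) (f : B →ₐ[ℂ] C) (x y : A ⊗[ℂ] B) :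
    LinearMap.lTensor A f.toLinearMap (TensorProduct.map₂ p (LinearMap.mul ℂ B) x y) =
      TensorProduct.map₂ p (LinearMap.mul ℂ C) (LinearMap.lTensor A f.toLinearMap x)
        (LinearMap.lTensor A f.toLinearMap y) := by
  induction x with
  | zero => simp
  | add s t hs ht => simp only [map_add, LinearMap.add_apply, hs, ht]
  | tmul a b =>
    induction y with
    | zero => simp
    | add s t hs ht => simp only [map_add, hs, ht]
    | tmul c d => simp

theorem lTensor_mul' (f : B →ₐ[ℂ] C) (x y : A ⊗[ℂ] B) :
    LinearMap.lTensor A f.toLinearMap (x * y) =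
      LinearMap.lTensor A f.toLinearMap x * LinearMap.lTensor A f.toLinearMap y := by
  rw [← map₂_mul_mul, lTensor_map₂, map₂_mul_mul]

/-- A linear map intertwining two bilinear operations on the first leg intertwines their
amplifications. -/
theorem rTensor_map₂ {A' : Type*} [AddCommGroup A'] [Module ℂ A'] (g : A →ₗ[ℂ] A')
    (p : A →ₗ[ℂ] A →ₗ[ℂ] A) (q : A' →ₗ[ℂ] A' →ₗ[ℂ] A') (h : ∀ a b, g (p a b) = q (g a) (g b))
    (x y : A ⊗[ℂ] B) :
    LinearMap.rTensor B g (TensorProduct.map₂ p (LinearMap.mul ℂ B) x y) =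
      TensorProduct.map₂ q (LinearMap.mul ℂ B) (LinearMap.rTensor B g x)
        (LinearMap.rTensor B g y) := by
  induction x with
  | zero => simp
  | add s t hs ht => simp only [map_add, LinearMap.add_apply, hs, ht]
  | tmul a b =>
    induction y with
    | zero => simp
    | add s t hs ht => simp only [map_add, hs, ht]
    | tmul c d => simp [h]

theorem lTensor_rTensor {A' : Type*} [AddCommGroup A'] [Module ℂ A'] (g : A →ₗ[ℂ] A')
    (f : B →ₗ[ℂ] C) (x : A ⊗[ℂ] B) : LinearMap.lTensor A' f (LinearMap.rTensor B g x) =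
      LinearMap.rTensor C g (LinearMap.lTensor A f x) := by
  induction x with
  | zero => simp
  | add s t hs ht => simp only [map_add, hs, ht]
  | tmul a b => simp

theorem rTensor_mul_one_tmul {A' : Type*} [Ring A'] [Algebra ℂ A'] (g : A →ₗ[ℂ] A')
    (x : A ⊗[ℂ] B) (b : B) : LinearMap.rTensor B g (x * 1 ⊗ₜ b) =
      LinearMap.rTensor B g x * 1 ⊗ₜ b := by
  induction x with
  | zero => simp
  | add s t hs ht => simp only [map_add, add_mul, hs, ht]
  | tmul c d => simp

theorem assoc_map₂ (p : A →ₗ[ℂ] A →ₗ[ℂ] A) (x y : A ⊗[ℂ] B) (c d : C) :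
    TensorProduct.assoc ℂ A B C (TensorProduct.map₂ p (LinearMap.mul ℂ B) x y ⊗ₜ (c * d)) =
      TensorProduct.map₂ p (LinearMap.mul ℂ (B ⊗[ℂ] C)) (TensorProduct.assoc ℂ A B C (x ⊗ₜ c))
        (TensorProduct.assoc ℂ A B C (y ⊗ₜ d)) := by
  induction x with
  | zero => simp
  | add s t hs ht => simp only [TensorProduct.add_tmul, map_add, LinearMap.add_apply, hs, ht]
  | tmul a b =>
    induction y with
    | zero => simp
    | add s t hs ht => simp only [TensorProduct.add_tmul, map_add, hs, ht]
    | tmul c d => simp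

theorem assoc_mul_one_tmul (x : (A ⊗[ℂ] B) ⊗[ℂ] C) (b : B) (c : C) :
    TensorProduct.assoc ℂ A B C (x * ((1 : A) ⊗ₜ b) ⊗ₜ c) =
      TensorProduct.assoc ℂ A B C x * (1 : A) ⊗ₜ (b ⊗ₜ[ℂ] c) :=
  map_mul (Algebra.TensorProduct.assoc ℂ ℂ ℂ A B C) x (((1 : A) ⊗ₜ b) ⊗ₜ c)

variable [StarRing B] [StarRing C]

theorem lTensor_tmul_one (f : B →⋆ₐ[ℂ] C) (a : A) :
    LinearMap.lTensor A (f : B →ₗ[ℂ] C) (a ⊗ₜ 1) = a ⊗ₜ 1 := by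
  rw [LinearMap.lTensor_tmul]
  exact congrArg _ (map_one f)

variable [StarRing A] [StarModule ℂ A] [StarModule ℂ B] [StarModule ℂ C]

theorem lTensor_star (f : B →⋆ₐ[ℂ] C) (x : A ⊗[ℂ] B) :
    LinearMap.lTensor A (f : B →ₗ[ℂ] C) (star x) =
      star (LinearMap.lTensor A (f : B →ₗ[ℂ] C) x) := by
  induction x with
  | zero => simp
  | add s t hs ht => simp only [star_add, map_add, hs, ht]
  | tmul a b => simp [map_star]

theorem assoc_star (x : A ⊗[ℂ] B) (c : C) :
    TensorProduct.assoc ℂ A B C (star x ⊗ₜ star c) =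
      star (TensorProduct.assoc ℂ A B C (x ⊗ₜ c)) := by
  induction x with
  | zero => simp
  | add s t hs ht => simp only [star_add, TensorProduct.add_tmul, map_add, hs, ht]
  | tmul a b => simp

end tensor

section famComp

variable {A : Type*} [Ring A] [Algebra ℂ A]
variable {B C : Type*} [Ring B] [Algebra ℂ B] [Ring C] [Algebra ℂ C]

/-- The composition `(α ⊗ id) ∘ β` of two families, with values in `A ⊗ (B ⊗ C)`. -/
def famComp (α : A →ₗ[ℂ] A ⊗[ℂ] B) (β : A →ₗ[ℂ] A ⊗[ℂ] C) : A →ₗ[ℂ] A ⊗[ℂ] (B ⊗[ℂ] C) :=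
  (TensorProduct.assoc ℂ A B C).toLinearMap ∘ₗ LinearMap.rTensor C α ∘ₗ β

theorem famComp_apply (α : A →ₗ[ℂ] A ⊗[ℂ] B) (β : A →ₗ[ℂ] A ⊗[ℂ] C) (a : A) :
    famComp α β a = TensorProduct.assoc ℂ A B C (LinearMap.rTensor C α (β a)) := rfl

theorem assoc_rTensor_map₂ {α : A →ₗ[ℂ] A ⊗[ℂ] B} (p : A →ₗ[ℂ] A →ₗ[ℂ] A)
    (hp : ∀ a b, α (p a b) = TensorProduct.map₂ p (LinearMap.mul ℂ B) (α a) (α b))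
    (x y : A ⊗[ℂ] C) :
    TensorProduct.assoc ℂ A B C (LinearMap.rTensor C α
      (TensorProduct.map₂ p (LinearMap.mul ℂ C) x y)) =
      TensorProduct.map₂ p (LinearMap.mul ℂ (B ⊗[ℂ] C))
        (TensorProduct.assoc ℂ A B C (LinearMap.rTensor C α x))
        (TensorProduct.assoc ℂ A B C (LinearMap.rTensor C α y)) := by
  induction x with
  | zero => simp
  | add s t hs ht => simp only [map_add, LinearMap.add_apply, hs, ht]
  | tmul a c =>
    induction y with
    | zero => simp
    | add s t hs ht => simp only [map_add, hs, ht]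
    | tmul b d =>
      rw [TensorProduct.map₂_apply_tmul, TensorProduct.map_tmul, LinearMap.rTensor_tmul, hp,
        LinearMap.mul_apply', assoc_map₂, LinearMap.rTensor_tmul, LinearMap.rTensor_tmul]

end famComp

section preFamily

variable {A : Type v} [Ring A] [StarRing A] [HopfAlgebra ℂ A] [StarModule ℂ A]
variable {B : Type*} [Ring B] [StarRing B] [Algebra ℂ B] [StarModule ℂ B]
variable {C : Type*} [Ring C] [StarRing C] [Algebra ℂ C] [StarModule ℂ C]

/-- Quantum families of automorphisms with values in an arbitrary `*`-algebra. Since `α` preserves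
adjoints, preservation of the convolution adjoint `a ↦ S(a*)` amounts to preservation of `S`; the
Podleś condition is stated for the generators `a ⊗ 1` of the right `B`-module `A ⊗ B`. -/
structure IsPreFamily (α : A →ₗ[ℂ] A ⊗[ℂ] B) : Prop where
  map_one : α 1 = 1
  map_mul : ∀ a b, α (a * b) = α a * α b
  map_star : ∀ a, α (star a) = star (α a)
  map_antipode : ∀ a, α (antipode ℂ a) = LinearMap.rTensor B (antipode ℂ) (α a)
  map_convProd : ∀ a b : A,
    α (convProd a b) = TensorProduct.map₂ convProd (LinearMap.mul ℂ B) (α a) (α b)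
  map_haarElement : α (haarElement A) = haarElement A ⊗ₜ[ℂ] (1 : B)
  podles : ∀ a, a ⊗ₜ[ℂ] (1 : B) ∈ Submodule.span ℂ
    {x : A ⊗[ℂ] B | ∃ (a : A) (b : B), x = α a * ((1 : A) ⊗ₜ[ℂ] b)}

theorem isAutFamily_iff_isPreFamily {D : Type u} [CStarAlgebra D] {α : A →ₗ[ℂ] A ⊗[ℂ] D} :
    IsAutFamily α ↔ IsPreFamily α := by
  constructor
  · intro h
    exact
      { map_one := h.map_one
        map_mul := h.map_mul
        map_star := h.map_star
        map_antipode := fun a => by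
          have := h.map_convAdjoint (star a)
          rwa [star_star, h.map_star, star_star] at this
        map_convProd := h.map_convProd
        map_haarElement := h.map_haarElement
        podles := fun a => h.podles ▸ Submodule.mem_top }
  · intro h
    exact
      { map_one := h.map_one
        map_mul := h.map_mul
        map_star := h.map_star
        map_convAdjoint := fun a => by rw [h.map_antipode, h.map_star]
        map_convProd := h.map_convProd
        map_haarElement := h.map_haarElement
        podles := by
          refine Submodule.eq_top_iff'.2 fun t => ?_
          induction t with
          | zero => exact Submodule.zero_mem _
          | add s t hs ht => exact Submodule.add_mem _ hs ht
          | tmul a d =>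
            have h1 := Submodule.mem_map_of_mem (f := LinearMap.mulRight ℂ ((1 : A) ⊗ₜ[ℂ] d))
              (h.podles a)
            rw [LinearMap.mulRight_apply, Algebra.TensorProduct.tmul_mul_tmul, mul_one,
              one_mul] at h1
            refine Submodule.map_span_le _ _ _ |>.2 ?_ h1
            rintro _ ⟨x, b, rfl⟩
            refine Submodule.subset_span ⟨x, b * d, ?_⟩
            rw [LinearMap.mulRight_apply, mul_assoc, Algebra.TensorProduct.tmul_mul_tmul, mul_one] }

/-- The image of a family of automorphisms under a unital `*`-homomorphism. -/
theorem IsPreFamily.push {α : A →ₗ[ℂ] A ⊗[ℂ] B} (h : IsPreFamily α) (f : B →⋆ₐ[ℂ] C) :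
    IsPreFamily (LinearMap.lTensor A (f : B →ₗ[ℂ] C) ∘ₗ α) where
  map_one := by
    rw [LinearMap.comp_apply, h.map_one, Algebra.TensorProduct.one_def, lTensor_tmul_one]
    rfl
  map_mul a b := by
    simp only [LinearMap.comp_apply, h.map_mul]
    exact lTensor_mul' (f : B →ₐ[ℂ] C) _ _
  map_star a := by
    simp only [LinearMap.comp_apply, h.map_star, lTensor_star]
  map_antipode a := by
    rw [LinearMap.comp_apply, LinearMap.comp_apply, h.map_antipode, lTensor_rTensor]
  map_convProd a b := by
    simp only [LinearMap.comp_apply, h.map_convProd]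
    exact lTensor_map₂ _ (f : B →ₐ[ℂ] C) _ _
  map_haarElement := by
    rw [LinearMap.comp_apply, h.map_haarElement, lTensor_tmul_one]
  podles a := by
    have h1 := Submodule.mem_map_of_mem (f := LinearMap.lTensor A (f : B →ₗ[ℂ] C)) (h.podles a)
    rw [lTensor_tmul_one] at h1
    refine Submodule.map_span_le _ _ _ |>.2 ?_ h1
    rintro _ ⟨x, b, rfl⟩
    exact Submodule.subset_span ⟨x, f b, lTensor_mul' (f : B →ₐ[ℂ] C) _ _⟩

/-- Families of automorphisms can be composed, with values in the algebraic tensor product. -/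
theorem IsPreFamily.comp {α : A →ₗ[ℂ] A ⊗[ℂ] B} {β : A →ₗ[ℂ] A ⊗[ℂ] C} (hα : IsPreFamily α)
    (hβ : IsPreFamily β) : IsPreFamily (famComp α β) where
  map_one := by
    rw [famComp_apply, hβ.map_one, Algebra.TensorProduct.one_def, LinearMap.rTensor_tmul,
      hα.map_one]
    rfl
  map_mul a b := by
    rw [famComp_apply, hβ.map_mul, ← map₂_mul_mul,
      assoc_rTensor_map₂ _ fun a b => by rw [LinearMap.mul_apply', hα.map_mul, map₂_mul_mul],
      map₂_mul_mul]
    rfl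
  map_star a := by
    rw [famComp_apply, famComp_apply, hβ.map_star]
    induction β a with
    | zero => simp
    | add s t hs ht => simp only [star_add, map_add, hs, ht]
    | tmul x c =>
      rw [TensorProduct.star_tmul, LinearMap.rTensor_tmul, hα.map_star, assoc_star,
        LinearMap.rTensor_tmul]
  map_antipode a := by
    rw [famComp_apply, famComp_apply, hβ.map_antipode]
    induction β a with
    | zero => simp
    | add s t hs ht => simp only [map_add, hs, ht]
    | tmul x c =>
      rw [LinearMap.rTensor_tmul, LinearMap.rTensor_tmul, hα.map_antipode, LinearMap.rTensor_tmul]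
      induction α x with
      | zero => simp
      | add s t hs ht => simp only [TensorProduct.add_tmul, map_add, hs, ht]
      | tmul y b => simp
  map_convProd a b := by
    rw [famComp_apply, hβ.map_convProd, assoc_rTensor_map₂ _ hα.map_convProd]
    rfl
  map_haarElement := by
    rw [famComp_apply, hβ.map_haarElement, LinearMap.rTensor_tmul, hα.map_haarElement]
    rfl
  podles a := by
    set P := Submodule.span ℂ {x : A ⊗[ℂ] (B ⊗[ℂ] C) | ∃ (a : A) (b : B ⊗[ℂ] C),
      x = famComp α β a * ((1 : A) ⊗ₜ[ℂ] b)}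
    have h1 : ∀ (x : A) (b : B), TensorProduct.assoc ℂ A B C
        ((α x * (1 : A) ⊗ₜ[ℂ] b) ⊗ₜ (1 : C)) ∈ P := by
      intro x b
      have h2 := Submodule.mem_map_of_mem
        (f := LinearMap.mulRight ℂ ((1 : A) ⊗ₜ[ℂ] (b ⊗ₜ[ℂ] (1 : C))) ∘ₗ
          (TensorProduct.assoc ℂ A B C).toLinearMap ∘ₗ LinearMap.rTensor C α) (hβ.podles x)
      have h3 : TensorProduct.assoc ℂ A B C ((α x * (1 : A) ⊗ₜ[ℂ] b) ⊗ₜ (1 : C)) =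
          (LinearMap.mulRight ℂ ((1 : A) ⊗ₜ[ℂ] (b ⊗ₜ[ℂ] (1 : C))) ∘ₗ
          (TensorProduct.assoc ℂ A B C).toLinearMap ∘ₗ LinearMap.rTensor C α) (x ⊗ₜ 1) := by
        simp only [LinearMap.comp_apply, LinearMap.mulRight_apply, LinearMap.rTensor_tmul,
          LinearEquiv.coe_coe]
        rw [← assoc_mul_one_tmul, Algebra.TensorProduct.tmul_mul_tmul, mul_one]
      rw [h3]
      refine Submodule.map_span_le _ _ _ |>.2 ?_ h2
      rintro _ ⟨y, c, rfl⟩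
      refine Submodule.subset_span ⟨y, b ⊗ₜ c, ?_⟩
      have h4 : ∀ t : A ⊗[ℂ] C, LinearMap.rTensor C α (t * 1 ⊗ₜ c) =
          LinearMap.rTensor C α t * 1 ⊗ₜ c := fun t => rTensor_mul_one_tmul α t c
      simp only [LinearMap.comp_apply, LinearMap.mulRight_apply, LinearEquiv.coe_coe]
      rw [h4, famComp_apply, Algebra.TensorProduct.one_def, assoc_mul_one_tmul, mul_assoc,
        Algebra.TensorProduct.tmul_mul_tmul, Algebra.TensorProduct.tmul_mul_tmul, one_mul, one_mul,
        mul_one]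
    have h5 := Submodule.mem_map_of_mem (f := (TensorProduct.assoc ℂ A B C).toLinearMap ∘ₗ
      (TensorProduct.mk ℂ (A ⊗[ℂ] B) C).flip 1) (hα.podles a)
    refine Submodule.map_span_le _ _ _ |>.2 ?_ h5
    rintro _ ⟨x, b, rfl⟩
    exact h1 x b

end preFamily

/-! ### Transport of families along the Fourier transform -/

section transport

variable {A : Type v} [Ring A] [StarRing A] [HopfAlgebra ℂ A] [FiniteQuantumGroup A]
variable {B : Type*} [Ring B] [Algebra ℂ B]

/-- A family that commutes with the antipode and is multiplicative is also multiplicative for the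
opposite product of `A` and the same product of `B`, because the antipode reverses products.
Applied to `p = q.flip`, this goes both ways. -/
theorem map_flip_of_map_antipode {α : A →ₗ[ℂ] A ⊗[ℂ] B}
    (hS : ∀ a, α (antipode ℂ a) = LinearMap.rTensor B (antipode ℂ) (α a))
    {p q : A →ₗ[ℂ] A →ₗ[ℂ] A} (hpq : ∀ a b, antipode ℂ (p a b) = q (antipode ℂ a) (antipode ℂ b))
    (hp : ∀ a b, α (p a b) = TensorProduct.map₂ p (LinearMap.mul ℂ B) (α a) (α b)) (a b : A) :
    α (q a b) = TensorProduct.map₂ q (LinearMap.mul ℂ B) (α a) (α b) := by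
  have h1 := hpq (antipode ℂ a) (antipode ℂ b)
  rw [antipode_antipode_eq, antipode_antipode_eq] at h1
  rw [← h1, hS, hp, rTensor_map₂ _ p q hpq, ← hS, ← hS, antipode_antipode_eq, antipode_antipode_eq]

theorem rTensor_fourier_injective :
    Function.Injective (LinearMap.rTensor B (fourier A)) :=
  (LinearEquiv.rTensor B (fourierEquiv A)).injective

theorem rTensor_antipode_injective :
    Function.Injective (LinearMap.rTensor B (antipode ℂ (A := A))) := by
  have h : ∀ t : A ⊗[ℂ] B, LinearMap.rTensor B (antipode ℂ (A := A))
      (LinearMap.rTensor B (antipode ℂ (A := A)) t) = t := by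
    intro t
    induction t with
    | zero => simp
    | add s t hs ht => simp only [map_add, hs, ht]
    | tmul a b => simp [antipode_antipode_eq]
  exact Function.LeftInverse.injective h

theorem rTensor_fourier_antipode (t : A ⊗[ℂ] B) :
    LinearMap.rTensor B (antipode ℂ) (LinearMap.rTensor B (fourier A) t) =
    LinearMap.rTensor B (fourier A) (LinearMap.rTensor B (antipode ℂ) t) := by
  induction t with
  | zero => simp
  | add s t hs ht => simp only [map_add, hs, ht]
  | tmul a b => simp [antipode_fourier]

variable [StarRing B] [StarModule ℂ B]

theorem star_rTensor_fourier (t : A ⊗[ℂ] B) : star (LinearMap.rTensor B (fourier A) t) =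
    LinearMap.rTensor B (fourier A) (LinearMap.rTensor B (antipode ℂ) (star t)) := by
  induction t with
  | zero => simp
  | add s t hs ht => simp only [star_add, map_add, hs, ht]
  | tmul a b => simp [star_fourier]

/-- The Fourier transform exchanges products with convolution products, adjoints with convolution
adjoints, and units with Haar elements; therefore it transports families of automorphisms of a
finite quantum group to families of automorphisms of its dual, and conversely. -/
theorem isPreFamily_iff_of_fourier {α : A →ₗ[ℂ] A ⊗[ℂ] B} {β : QDual A →ₗ[ℂ] QDual A ⊗[ℂ] B}
    (h : ∀ a, β (fourier A a) = LinearMap.rTensor B (fourier A) (α a)) :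
    IsPreFamily β ↔ IsPreFamily α := by
  have hη := haar_haarElement_ne_zero (A := A)
  have hsurj : Function.Surjective (fourier A) := (fourierEquiv A).surjective
  have hinj := rTensor_fourier_injective (A := A) (B := B)
  have hone : β 1 = 1 ↔ α (haarElement A) = haarElement A ⊗ₜ[ℂ] (1 : B) := by
    rw [← hinj.eq_iff, ← h, fourier_haarElement, LinearMap.rTensor_tmul, fourier_haarElement,
      map_smul, ← TensorProduct.smul_tmul', Algebra.TensorProduct.one_def]
    exact ((smul_right_injective _ hη).eq_iff).symm
  have hhaar : β (haarElement (QDual A)) = haarElement (QDual A) ⊗ₜ[ℂ] (1 : B) ↔ α 1 = 1 := by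
    rw [← hinj.eq_iff, ← h, haarElement_dual, Algebra.TensorProduct.one_def,
      LinearMap.rTensor_tmul]
  have hconv : (∀ ω θ, β (ω * θ) = β ω * β θ) ↔ ∀ a b,
      α (convProd a b) = TensorProduct.map₂ convProd (LinearMap.mul ℂ B) (α a) (α b) := by
    simp only [hsurj.forall]
    refine forall_congr' fun a => forall_congr' fun b => ?_
    rw [← hinj.eq_iff, ← h, fourier_convProd, rTensor_map₂ (fourier A) convProd
      (LinearMap.mul ℂ (QDual A)) fourier_convProd, map₂_mul_mul, h, h]
  have hS : (∀ ω, β (antipode ℂ ω) = LinearMap.rTensor B (antipode ℂ) (β ω)) ↔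
      ∀ a, α (antipode ℂ a) = LinearMap.rTensor B (antipode ℂ) (α a) := by
    simp only [hsurj.forall]
    refine forall_congr' fun a => ?_
    rw [antipode_fourier, h, h, rTensor_fourier_antipode, hinj.eq_iff]
  have hstar : (∀ a, α (antipode ℂ a) = LinearMap.rTensor B (antipode ℂ) (α a)) →
      ((∀ ω, β (star ω) = star (β ω)) ↔ ∀ a, α (star a) = star (α a)) := by
    intro hS
    simp only [hsurj.forall]
    refine forall_congr' fun a => ?_
    rw [star_fourier, h, h, star_rTensor_fourier, hinj.eq_iff, hS,
      rTensor_antipode_injective.eq_iff]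
  have hmul : (∀ ω θ, β (convProd ω θ) =
      TensorProduct.map₂ convProd (LinearMap.mul ℂ B) (β ω) (β θ)) ↔
      ∀ a b, α ((LinearMap.mul ℂ A).flip a b) =
        TensorProduct.map₂ (LinearMap.mul ℂ A).flip (LinearMap.mul ℂ B) (α a) (α b) := by
    have e : ∀ x y : A ⊗[ℂ] B, TensorProduct.map₂ convProd (LinearMap.mul ℂ B)
        (LinearMap.rTensor B (fourier A) x) (LinearMap.rTensor B (fourier A) y) =
        haar A (haarElement A) • LinearMap.rTensor B (fourier A)
          (TensorProduct.map₂ (LinearMap.mul ℂ A).flip (LinearMap.mul ℂ B) x y) := by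
      intro x y
      induction x with
      | zero => simp
      | add s t hs ht => simp only [map_add, LinearMap.add_apply, smul_add, hs, ht]
      | tmul a b =>
        induction y with
        | zero => simp
        | add s t hs ht => simp only [map_add, smul_add, hs, ht]
        | tmul c d =>
          simp [convProd_fourier, TensorProduct.smul_tmul']
    simp only [hsurj.forall]
    refine forall_congr' fun a => forall_congr' fun b => ?_
    rw [convProd_fourier, map_smul, h, h, h, e, (smul_right_injective _ hη).eq_iff, hinj.eq_iff]
    rfl
  have hpod : (∀ ω, ω ⊗ₜ[ℂ] (1 : B) ∈ Submodule.span ℂ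
      {x : QDual A ⊗[ℂ] B | ∃ (ω : QDual A) (b : B), x = β ω * ((1 : QDual A) ⊗ₜ[ℂ] b)}) ↔
      ∀ a, a ⊗ₜ[ℂ] (1 : B) ∈ Submodule.span ℂ
        {x : A ⊗[ℂ] B | ∃ (a : A) (b : B), x = α a * ((1 : A) ⊗ₜ[ℂ] b)} := by
    have himg : {x : QDual A ⊗[ℂ] B | ∃ (ω : QDual A) (b : B),
        x = β ω * ((1 : QDual A) ⊗ₜ[ℂ] b)} = LinearMap.rTensor B (fourier A) ''
        {x : A ⊗[ℂ] B | ∃ (a : A) (b : B), x = α a * ((1 : A) ⊗ₜ[ℂ] b)} := by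
      ext x
      constructor
      · rintro ⟨ω, b, rfl⟩
        obtain ⟨a, rfl⟩ := hsurj ω
        exact ⟨_, ⟨a, b, rfl⟩, by rw [rTensor_mul_one_tmul, h]⟩
      · rintro ⟨_, ⟨a, b, rfl⟩, rfl⟩
        exact ⟨fourier A a, b, by rw [rTensor_mul_one_tmul, h]⟩
    rw [himg, ← Submodule.map_span, hsurj.forall]
    refine forall_congr' fun a => ?_
    rw [← LinearMap.rTensor_tmul, Submodule.mem_map]
    exact ⟨fun ⟨y, hy, hxy⟩ => hinj hxy ▸ hy, fun hy => ⟨_, hy, rfl⟩⟩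
  constructor
  · intro hβ
    have hSα := hS.1 hβ.map_antipode
    refine ⟨hhaar.1 hβ.map_haarElement, fun a b => ?_, (hstar hSα).1 hβ.map_star, hSα,
      hconv.1 hβ.map_mul, hone.1 hβ.map_one, hpod.1 hβ.podles⟩
    have := map_flip_of_map_antipode hSα (q := LinearMap.mul ℂ A)
      (fun a b => antipode_mul_antidistrib b a) (hmul.1 hβ.map_convProd) a b
    rwa [map₂_mul_mul] at this
  · intro hα
    refine ⟨hone.2 hα.map_haarElement, hconv.2 hα.map_convProd,
      (hstar hα.map_antipode).2 hα.map_star, hS.2 hα.map_antipode, hmul.2 ?_, hhaar.2 hα.map_one,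
      hpod.2 hα.podles⟩
    exact map_flip_of_map_antipode hα.map_antipode (p := LinearMap.mul ℂ A)
      (fun a b => antipode_mul_antidistrib a b)
      (fun a b => by rw [map₂_mul_mul]; exact hα.map_mul a b)

end transport

/-! ### The coefficient matrix of a family -/

section coords

variable {A : Type*} [Ring A] [Algebra ℂ A] {B C : Type*} [Ring B] [Algebra ℂ B] [Ring C]
  [Algebra ℂ C] {ι : Type*} [Fintype ι] (e : Module.Basis ι ℂ A)

variable (B) in
/-- The coordinates in `B` of an element of `A ⊗ B`, in terms of a basis of `A`. -/
def coords [DecidableEq ι] : A ⊗[ℂ] B ≃ₗ[ℂ] (ι → B) :=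
  (TensorProduct.equivFinsuppOfBasisLeft e).trans (Finsupp.linearEquivFunOnFinite ℂ B ι)

theorem coords_tmul [DecidableEq ι] (a : A) (b : B) (i : ι) :
    coords B e (a ⊗ₜ b) i = e.repr a i • b := by
  simp [coords]

theorem coords_sum [DecidableEq ι] (c : ι → B) : coords B e (∑ i, e i ⊗ₜ c i) = c := by
  funext j
  simp [map_sum, coords_tmul, Finsupp.single_apply]

theorem sum_coords [DecidableEq ι] (t : A ⊗[ℂ] B) : ∑ i, e i ⊗ₜ coords B e t i = t :=
  (coords B e).injective (coords_sum e _)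

theorem coords_mul [DecidableEq ι] (t : A ⊗[ℂ] B) (b : B) (i : ι) :
    coords B e (t * 1 ⊗ₜ b) i = coords B e t i * b := by
  induction t with
  | zero => simp
  | add s t hs ht => simp only [add_mul, map_add, Pi.add_apply, hs, ht]
  | tmul a c => simp [coords_tmul]

theorem coords_lTensor [DecidableEq ι] (f : B →ₗ[ℂ] C) (t : A ⊗[ℂ] B) (i : ι) :
    coords C e (LinearMap.lTensor A f t) i = f (coords B e t i) := by
  induction t with
  | zero => simp
  | add s t hs ht => simp only [map_add, Pi.add_apply, hs, ht]
  | tmul a c => simp [coords_tmul]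

/-- The matrix `(u i j)` with `α(e j) = ∑ i, e i ⊗ u i j`. -/
def coeffMatrix [DecidableEq ι] (α : A →ₗ[ℂ] A ⊗[ℂ] B) : Matrix ι ι B :=
  Matrix.of fun i j => coords B e (α (e j)) i

/-- The linear map `α` with `α(e j) = ∑ i, e i ⊗ M i j`. -/
def ofMatrix (M : Matrix ι ι B) : A →ₗ[ℂ] A ⊗[ℂ] B :=
  e.constr ℂ fun j => ∑ i, e i ⊗ₜ M i j

theorem ofMatrix_basis (M : Matrix ι ι B) (j : ι) : ofMatrix e M (e j) = ∑ i, e i ⊗ₜ M i j :=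
  e.constr_basis ℂ _ j

theorem coords_ofMatrix [DecidableEq ι] (M : Matrix ι ι B) (a : A) (i : ι) :
    coords B e (ofMatrix e M a) i = ∑ j, e.repr a j • M i j := by
  conv_lhs => rw [← e.sum_repr a]
  simp only [map_sum, map_smul, ofMatrix_basis, Finset.sum_apply, Pi.smul_apply]
  simp [coords_tmul, Finsupp.single_apply]

theorem ofMatrix_coeffMatrix [DecidableEq ι] (α : A →ₗ[ℂ] A ⊗[ℂ] B) :
    ofMatrix e (coeffMatrix e α) = α := by
  refine e.ext fun j => ?_
  rw [ofMatrix_basis]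
  exact sum_coords e _

theorem coeffMatrix_ofMatrix [DecidableEq ι] (M : Matrix ι ι B) :
    coeffMatrix e (ofMatrix e M) = M := by
  ext i j
  change coords B e (ofMatrix e M (e j)) i = _
  rw [ofMatrix_basis, coords_sum]

theorem lTensor_comp_ofMatrix (f : B →ₗ[ℂ] C) (M : Matrix ι ι B) :
    LinearMap.lTensor A f ∘ₗ ofMatrix e M = ofMatrix e (M.map f) := by
  refine e.ext fun j => ?_
  rw [LinearMap.comp_apply, ofMatrix_basis, ofMatrix_basis, map_sum]
  rfl

/-- The Podleś condition follows from right invertibility of the coefficient matrix. -/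
theorem podles_of_mul_eq_one [DecidableEq ι] {M w : Matrix ι ι B} (hw : M * w = 1) (a : A) :
    a ⊗ₜ[ℂ] (1 : B) ∈ Submodule.span ℂ
      {x : A ⊗[ℂ] B | ∃ (a : A) (b : B), x = ofMatrix e M a * ((1 : A) ⊗ₜ[ℂ] b)} := by
  rw [← e.sum_repr a, TensorProduct.sum_tmul]
  refine Submodule.sum_mem _ fun k _ => ?_
  rw [← TensorProduct.smul_tmul']
  refine Submodule.smul_mem _ _ ?_
  have h : e k ⊗ₜ[ℂ] (1 : B) = ∑ j, ofMatrix e M (e j) * ((1 : A) ⊗ₜ[ℂ] w j k) := by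
    apply (coords B e).injective
    funext i
    have h1 : (M * w) i k = (1 : Matrix ι ι B) i k := by rw [hw]
    rw [Matrix.mul_apply] at h1
    rw [map_sum, Finset.sum_apply, coords_tmul]
    simp only [coords_mul, ofMatrix_basis, coords_sum]
    rw [h1, Module.Basis.repr_self, Matrix.one_apply, Finsupp.single_apply]
    simp [eq_comm]
  rw [h]
  exact Submodule.sum_mem _ fun j _ => Submodule.subset_span ⟨e j, w j k, rfl⟩

/-- Conversely, the Podleś condition makes the coefficient matrix right invertible. -/
theorem exists_mul_eq_one_of_podles [DecidableEq ι] {M : Matrix ι ι B}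
    (h : ∀ a, a ⊗ₜ[ℂ] (1 : B) ∈ Submodule.span ℂ
      {x : A ⊗[ℂ] B | ∃ (a : A) (b : B), x = ofMatrix e M a * ((1 : A) ⊗ₜ[ℂ] b)}) :
    ∃ w : Matrix ι ι B, M * w = 1 := by
  -- In coordinates, `α(A)(1 ⊗ B)` lies in the range of left multiplication by `M` on columns.
  let L : (ι → B) →ₗ[ℂ] (ι → B) :=
    { toFun := fun c i => ∑ j, M i j * c j
      map_add' := fun c d => by ext i; simp [mul_add, Finset.sum_add_distrib]
      map_smul' := fun r c => by ext i; simp [Finset.smul_sum] }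
  have hL : Submodule.span ℂ {x : A ⊗[ℂ] B | ∃ (a : A) (b : B),
      x = ofMatrix e M a * ((1 : A) ⊗ₜ[ℂ] b)} ≤
      (LinearMap.range L).comap (coords B e).toLinearMap := by
    rw [Submodule.span_le]
    rintro _ ⟨a, b, rfl⟩
    refine ⟨fun j => e.repr a j • b, ?_⟩
    funext i
    change ∑ j, M i j * (e.repr a j • b) = coords B e (ofMatrix e M a * 1 ⊗ₜ[ℂ] b) i
    rw [coords_mul, coords_ofMatrix, Finset.sum_mul]
    simp
  choose c hc using fun k => hL (h (e k))
  refine ⟨Matrix.of fun j k => c k j, ?_⟩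
  ext i k
  have h1 := congrFun (hc k) i
  change ∑ j, M i j * c k j = coords B e (e k ⊗ₜ 1) i at h1
  rw [coords_tmul] at h1
  rw [Matrix.mul_apply]
  refine h1.trans ?_
  rw [Module.Basis.repr_self, Matrix.one_apply, Finsupp.single_apply]
  simp [eq_comm]

end coords

section unitary

variable {A : Type v} [Ring A] [StarRing A] [HopfAlgebra ℂ A] [FiniteQuantumGroup A]
variable {B : Type*} [Ring B] [StarRing B] [Algebra ℂ B] [StarModule ℂ B]

theorem convProd_one_left (a : A) : convProd 1 a = haar A a • (1 : A) := by
  rw [convProd_apply 1 (ℛ ℂ a), ← (isHaarState_haar A).sum_left (ℛ ℂ a)]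
  simp only [mul_one, haar_antipode]

/-- A family of automorphisms preserves the Haar state, because `1 ⋆ a = h(a)1`. -/
theorem IsPreFamily.map_haar {α : A →ₗ[ℂ] A ⊗[ℂ] B} (hα : IsPreFamily α) (a : A) :
    TensorProduct.lid ℂ B (LinearMap.rTensor B (haar A) (α a)) = haar A a • (1 : B) := by
  have h1 := hα.map_convProd 1 a
  have h2 : ∀ t : A ⊗[ℂ] B, TensorProduct.map₂ convProd (LinearMap.mul ℂ B) (1 ⊗ₜ[ℂ] 1) t =
      1 ⊗ₜ TensorProduct.lid ℂ B (LinearMap.rTensor B (haar A) t) := by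
    intro t
    induction t with
    | zero => simp
    | add s t hs ht => simp only [map_add, TensorProduct.tmul_add, hs, ht]
    | tmul a b => simp [convProd_one_left, TensorProduct.smul_tmul]
  rw [convProd_one_left, map_smul, hα.map_one, Algebra.TensorProduct.one_def, h2] at h1
  have h3 := congrArg (fun t => TensorProduct.lid ℂ B (LinearMap.rTensor B (haar A) t)) h1
  simpa [(isHaarState_haar A).map_one] using h3.symm

variable {ι : Type*} [Fintype ι] [DecidableEq ι] {e : Module.Basis ι ℂ A}

/-- The coefficient matrix of a family of automorphisms in an orthonormal basis is unitary: it is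
isometric because the Haar state is preserved, and right invertible by the Podleś condition. -/
theorem IsPreFamily.unitary (he : ∀ i j, haar A (star (e i) * e j) = if i = j then 1 else 0)
    {M : Matrix ι ι B} (hM : IsPreFamily (ofMatrix e M)) :
    star M * M = 1 ∧ M * star M = 1 := by
  have h1 : star M * M = 1 := by
    ext j k
    have h2 := hM.map_haar (star (e j) * e k)
    rw [hM.map_mul, hM.map_star, ofMatrix_basis, ofMatrix_basis, lid_map_star_mul he, he] at h2
    rw [Matrix.mul_apply, Matrix.one_apply]
    refine h2.trans ?_
    split_ifs <;> simp
  obtain ⟨w, hw⟩ := exists_mul_eq_one_of_podles e hM.podles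
  refine ⟨h1, ?_⟩
  rw [left_inv_eq_right_inv h1 hw, hw]

end unitary

/-! ### The free `*`-algebra -/

/-- The free unital complex `*`-algebra on `X`, realized as the complexification of the free real
algebra on two self-adjoint variables for each `x : X`, the real and the imaginary part of `x`. -/
def FreeStar (X : Type u) : Type u := ℂ ⊗[ℝ] FreeAlgebra ℝ (X × Bool)

namespace FreeStar

variable {X : Type u}

instance : StarModule ℝ (FreeAlgebra ℝ (X × Bool)) where
  star_smul r x := by
    rw [Algebra.smul_def, star_mul, FreeAlgebra.star_algebraMap, ← Algebra.commutes,
      Algebra.smul_def]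
    rfl

instance : Ring (FreeStar X) := inferInstanceAs (Ring (ℂ ⊗[ℝ] FreeAlgebra ℝ (X × Bool)))

instance : Algebra ℂ (FreeStar X) :=
  inferInstanceAs (Algebra ℂ (ℂ ⊗[ℝ] FreeAlgebra ℝ (X × Bool)))

instance : StarRing (FreeStar X) := inferInstanceAs (StarRing (ℂ ⊗[ℝ] FreeAlgebra ℝ (X × Bool)))

/-- The elementary tensors. -/
def mk (z : ℂ) (w : FreeAlgebra ℝ (X × Bool)) : FreeStar X := z ⊗ₜ[ℝ] w

theorem star_mk (z : ℂ) (w : FreeAlgebra ℝ (X × Bool)) : star (mk z w) = mk (star z) (star w) := rfl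

theorem smul_mk (c z : ℂ) (w : FreeAlgebra ℝ (X × Bool)) : c • mk z w = mk (c * z) w := rfl

theorem mk_induction {p : FreeStar X → Prop} (x : FreeStar X) (h0 : p 0)
    (hadd : ∀ x y, p x → p y → p (x + y)) (hmk : ∀ z w, p (mk z w)) : p x :=
  TensorProduct.induction_on (motive := p) x h0 hmk hadd

instance : StarModule ℂ (FreeStar X) where
  star_smul c x := by
    induction x using mk_induction with
    | h0 => simp
    | hadd x y hx hy => rw [smul_add, star_add, hx, hy, star_add, smul_add]
    | hmk z w => rw [smul_mk, star_mk, star_mk, smul_mk, star_mul']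

/-- The canonical generators. -/
def of (x : X) : FreeStar X :=
  mk 1 (FreeAlgebra.ι ℝ (x, false)) + mk Complex.I (FreeAlgebra.ι ℝ (x, true))

theorem star_of (x : X) : star (of x) =
    mk 1 (FreeAlgebra.ι ℝ (x, false)) - mk Complex.I (FreeAlgebra.ι ℝ (x, true)) := by
  rw [of, star_add, star_mk, star_mk, FreeAlgebra.star_ι, FreeAlgebra.star_ι, star_one,
    sub_eq_add_neg]
  congr 1
  have : star Complex.I = (-1) * Complex.I := by simp
  rw [this, ← smul_mk, neg_one_smul]

/-- A subalgebra that contains the generators and their adjoints is everything. -/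
theorem mem_of_gen (S : Subalgebra ℂ (FreeStar X)) (h : ∀ x, of x ∈ S) (hs : ∀ x, star (of x) ∈ S)
    (y : FreeStar X) : y ∈ S := by
  have h1 : ∀ i, mk (1 : ℂ) (FreeAlgebra.ι ℝ i) ∈ S := by
    rintro ⟨x, b⟩
    cases b
    · have h2 := S.smul_mem (S.add_mem (h x) (hs x)) (1 / 2 : ℂ)
      rw [star_of, of, add_add_sub_cancel, ← two_smul ℂ, smul_smul] at h2
      norm_num at h2
      exact h2
    · have h2 := S.smul_mem (S.sub_mem (h x) (hs x)) (-Complex.I / 2 : ℂ)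
      rw [star_of, of, add_sub_sub_cancel, ← two_smul ℂ, smul_smul, smul_mk] at h2
      have h3 : -Complex.I / 2 * 2 * Complex.I = 1 := by
        linear_combination -Complex.I_mul_I
      rwa [h3] at h2
  have h2 : ∀ w, mk (1 : ℂ) w ∈ S := by
    intro w
    induction w using FreeAlgebra.induction with
    | grade0 r =>
      have : mk (1 : ℂ) (algebraMap ℝ (FreeAlgebra ℝ (X × Bool)) r) =
          algebraMap ℂ (FreeStar X) (r : ℂ) := by
        have h5 : (algebraMap ℝ (FreeAlgebra ℝ (X × Bool)) r) = r • 1 :=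
          Algebra.algebraMap_eq_smul_one r
        change (1 : ℂ) ⊗ₜ[ℝ] _ = (r : ℂ) ⊗ₜ[ℝ] 1
        rw [h5, TensorProduct.tmul_smul, TensorProduct.smul_tmul']
        simp
      rw [this]
      exact S.algebraMap_mem _
    | grade1 x => exact h1 x
    | mul a b ha hb =>
      have : mk (1 : ℂ) (a * b) = mk 1 a * mk 1 b := by
        change _ = ((1 : ℂ) ⊗ₜ[ℝ] a) * ((1 : ℂ) ⊗ₜ[ℝ] b)
        rw [Algebra.TensorProduct.tmul_mul_tmul, mul_one]
        rfl
      rw [this]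
      exact S.mul_mem ha hb
    | add a b ha hb =>
      have : mk (1 : ℂ) (a + b) = mk 1 a + mk 1 b := TensorProduct.tmul_add _ _ _
      rw [this]
      exact S.add_mem ha hb
  refine mk_induction (p := (· ∈ S)) y S.zero_mem (fun x y => S.add_mem) fun z w => ?_
  have : mk z w = z • mk 1 w := by rw [smul_mk, mul_one]
  rw [this]
  exact S.smul_mem (h2 w) z

section lift

variable {C : Type*} [Ring C] [StarRing C] [Algebra ℂ C] [StarModule ℂ C]

open scoped ComplexStarModule

/-- The self-adjoint part of `c x` corresponding to a self-adjoint variable. -/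
def liftVar (c : X → C) (i : X × Bool) : C := if i.2 then (ℑ (c i.1) : C) else (ℜ (c i.1) : C)

theorem star_liftVar (c : X → C) (i : X × Bool) : star (liftVar c i) = liftVar c i := by
  unfold liftVar
  split_ifs
  · exact (ℑ (c i.1)).2
  · exact (ℜ (c i.1)).2

theorem star_lift_liftVar (c : X → C) (w : FreeAlgebra ℝ (X × Bool)) :
    FreeAlgebra.lift ℝ (liftVar c) (star w) = star (FreeAlgebra.lift ℝ (liftVar c) w) := by
  induction w using FreeAlgebra.induction with
  | grade0 r =>
    rw [FreeAlgebra.star_algebraMap, AlgHom.commutes, IsScalarTower.algebraMap_apply ℝ ℂ C,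
      ← algebraMap_star_comm]
    simp
  | grade1 x => rw [FreeAlgebra.star_ι, FreeAlgebra.lift_ι_apply, star_liftVar]
  | mul a b ha hb => rw [star_mul, map_mul, map_mul, star_mul, ha, hb]
  | add a b ha hb => rw [star_add, map_add, map_add, star_add, ha, hb]

/-- The algebra homomorphism underlying `lift`. -/
def liftAlg (c : X → C) : FreeStar X →ₐ[ℂ] C :=
  Algebra.TensorProduct.lift (Algebra.ofId ℂ C) (FreeAlgebra.lift ℝ (liftVar c))
    fun z _ => Algebra.commutes z _

theorem liftAlg_mk (c : X → C) (z : ℂ) (w : FreeAlgebra ℝ (X × Bool)) :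
    liftAlg c (mk z w) = z • FreeAlgebra.lift ℝ (liftVar c) w := by
  rw [Algebra.smul_def]
  exact Algebra.TensorProduct.lift_tmul _ _ _ _ _

/-- The universal property of the free `*`-algebra. -/
def lift (c : X → C) : FreeStar X →⋆ₐ[ℂ] C where
  __ := liftAlg c
  map_star' x := by
    change liftAlg c (star x) = star (liftAlg c x)
    induction x using mk_induction with
    | h0 => simp
    | hadd x y hx hy => rw [star_add, map_add, map_add, star_add, hx, hy]
    | hmk z w => rw [star_mk, liftAlg_mk, liftAlg_mk, star_smul, star_lift_liftVar]

theorem lift_of (c : X → C) (x : X) : lift c (of x) = c x := by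
  change liftAlg c (of x) = c x
  rw [of, map_add, liftAlg_mk, liftAlg_mk, FreeAlgebra.lift_ι_apply, FreeAlgebra.lift_ι_apply,
    one_smul]
  exact realPart_add_I_smul_imaginaryPart (c x)

end lift

end FreeStar

/-! ### The universal family of automorphisms -/

section universal

theorem continuous_starAlgHom {B C : Type*} [CStarAlgebra B] [CStarAlgebra C] (f : B →⋆ₐ[ℂ] C) :
    Continuous f :=
  AddMonoidHomClass.continuous_of_bound f 1 fun x => by
    rw [one_mul]
    exact NonUnitalStarAlgHom.norm_apply_le f x

theorem norm_le_one_of_star_mul_self_sum {D : Type u} [CStarAlgebra D] {ι : Type*} [Fintype ι]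
    {c : ι → D} (h : ∑ i, star (c i) * c i = 1) (i : ι) : ‖c i‖ ≤ 1 := by
  let : PartialOrder D := CStarAlgebra.spectralOrder D
  have : StarOrderedRing D := CStarAlgebra.spectralOrderedRing D
  have h1 : star (c i) * c i ≤ 1 := h ▸ Finset.single_le_sum
    (f := fun i => star (c i) * c i) (fun j _ => star_mul_self_nonneg (c j)) (Finset.mem_univ i)
  have h2 := CStarAlgebra.norm_le_norm_of_nonneg_of_le (star_mul_self_nonneg (c i)) h1
  rw [CStarRing.norm_star_mul_self] at h2
  have h3 : ‖(1 : D)‖ ≤ 1 := by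
    have h4 : ‖(1 : D)‖ = ‖(1 : D)‖ * ‖(1 : D)‖ := by
      have h5 := CStarRing.norm_star_mul_self (x := (1 : D))
      rwa [star_one, one_mul] at h5
    nlinarith [sq_nonneg (‖(1 : D)‖ - 1), norm_nonneg (1 : D)]
  nlinarith [norm_nonneg (c i)]

variable {A : Type v} [Ring A] [StarRing A] [HopfAlgebra ℂ A] [FiniteQuantumGroup A] {n : ℕ}

variable {e : Module.Basis (Fin n) ℂ A}

/-- A matrix over a `*`-algebra `R` represents a family of automorphisms after applying `f`, if
it does so after applying each of the homomorphisms `F k`, and these detect all relations that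
hold after applying `f`. The Podleś condition is covered because it amounts to unitarity of the
coefficient matrix. -/
theorem isPreFamily_of_forall (he : ∀ i j, haar A (star (e i) * e j) = if i = j then 1 else 0)
    {R B : Type*} [Ring R] [StarRing R] [Algebra ℂ R] [StarModule ℂ R] [Ring B] [StarRing B]
    [Algebra ℂ B] [StarModule ℂ B] (G : Matrix (Fin n) (Fin n) R) (f : R →⋆ₐ[ℂ] B)
    {κ : Type*} {D : κ → Type*} [∀ k, Ring (D k)] [∀ k, StarRing (D k)] [∀ k, Algebra ℂ (D k)]
    [∀ k, StarModule ℂ (D k)] (F : ∀ k, R →⋆ₐ[ℂ] D k)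
    (hf : ∀ x y, (∀ k, F k x = F k y) → f x = f y)
    (hF : ∀ k, IsPreFamily (ofMatrix e (G.map (F k)))) : IsPreFamily (ofMatrix e (G.map f)) := by
  let α := ofMatrix e G
  have hα : ofMatrix e (G.map f) = LinearMap.lTensor A (f : R →ₗ[ℂ] B) ∘ₗ α :=
    (lTensor_comp_ofMatrix e (f : R →ₗ[ℂ] B) G).symm
  have hF' : ∀ k, IsPreFamily (LinearMap.lTensor A (F k : R →ₗ[ℂ] D k) ∘ₗ α) := fun k => by
    have h1 := hF k
    have h2 := lTensor_comp_ofMatrix e (F k : R →ₗ[ℂ] D k) G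
    rw [h2]
    exact h1
  have key : ∀ s t : A ⊗[ℂ] R, (∀ k, LinearMap.lTensor A (F k : R →ₗ[ℂ] D k) s =
      LinearMap.lTensor A (F k : R →ₗ[ℂ] D k) t) →
      LinearMap.lTensor A (f : R →ₗ[ℂ] B) s = LinearMap.lTensor A (f : R →ₗ[ℂ] B) t := by
    intro s t h
    apply (coords B e).injective
    funext i
    rw [coords_lTensor, coords_lTensor]
    refine hf _ _ fun k => ?_
    have h1 := congrFun (congrArg (coords (D k) e) (h k)) i
    rwa [coords_lTensor, coords_lTensor] at h1
  have hpod : G.map f * star (G.map f) = 1 := by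
    ext i k
    have h1 : (G.map f * star (G.map f)) i k = f ((G * star G) i k) := by
      simp [Matrix.mul_apply, map_sum, map_mul, map_star, Matrix.star_apply]
    have h2 : (1 : Matrix (Fin n) (Fin n) B) i k = f ((1 : Matrix (Fin n) (Fin n) R) i k) := by
      rw [Matrix.one_apply, Matrix.one_apply]
      split_ifs <;> simp
    rw [h1, h2]
    refine hf _ _ fun l => ?_
    have h3 := congrFun (congrFun ((hF l).unitary he).2 i) k
    have h4 : (G.map (F l) * star (G.map (F l))) i k = F l ((G * star G) i k) := by
      simp [Matrix.mul_apply, map_sum, map_mul, map_star, Matrix.star_apply]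
    have h5 : (1 : Matrix (Fin n) (Fin n) (D l)) i k =
        F l ((1 : Matrix (Fin n) (Fin n) R) i k) := by
      rw [Matrix.one_apply, Matrix.one_apply]
      split_ifs <;> simp
    rw [← h4, ← h5, h3]
  refine ⟨?_, fun a b => ?_, fun a => ?_, fun a => ?_, fun a b => ?_, ?_,
    podles_of_mul_eq_one e hpod⟩
  all_goals rw [hα]; simp only [LinearMap.comp_apply]
  · rw [Algebra.TensorProduct.one_def, ← lTensor_tmul_one f]
    exact key _ _ fun k => by rw [lTensor_tmul_one]; exact (hF' k).map_one
  · refine Eq.trans ?_ (lTensor_mul' (f : R →ₐ[ℂ] B) _ _)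
    exact key _ _ fun k => ((hF' k).map_mul a b).trans (lTensor_mul' (F k : R →ₐ[ℂ] D k) _ _).symm
  · rw [← lTensor_star]
    exact key _ _ fun k => by rw [lTensor_star]; exact (hF' k).map_star a
  · rw [← lTensor_rTensor]
    exact key _ _ fun k => by rw [lTensor_rTensor]; exact (hF' k).map_antipode a
  · refine Eq.trans ?_ (lTensor_map₂ _ (f : R →ₐ[ℂ] B) _ _)
    exact key _ _ fun k =>
      ((hF' k).map_convProd a b).trans (lTensor_map₂ _ (F k : R →ₐ[ℂ] D k) _ _).symm
  · rw [← lTensor_tmul_one f]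
    exact key _ _ fun k => by rw [lTensor_tmul_one]; exact (hF' k).map_haarElement

/-- The adjoints of the coefficients of a family are linear combinations of the coefficients. -/
theorem star_coeff_mem
    (he : ∀ i j, haar A (star (e i) * e j) = if i = j then 1 else 0) {B : Type*} [Ring B]
    [StarRing B] [Algebra ℂ B] [StarModule ℂ B] {M : Matrix (Fin n) (Fin n) B}
    (hM : IsPreFamily (ofMatrix e M)) (S : Submodule ℂ B)
    (hS : ∀ i j, M i j ∈ S) (i j : Fin n) : star (M i j) ∈ S := by
  have h1 := congrArg (fun t => TensorProduct.lid ℂ B (LinearMap.rTensor B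
    (haar A ∘ₗ LinearMap.mulLeft ℂ (e i)) t)) (hM.map_star (e j))
  have h2 : ∀ k, haar A (e i * star (e k)) = if k = i then 1 else 0 := fun k => by
    rw [haar_mul_comm, he]
  simp only [ofMatrix_basis, star_sum, map_sum, TensorProduct.star_tmul, LinearMap.rTensor_tmul,
    LinearMap.comp_apply, LinearMap.mulLeft_apply, h2, TensorProduct.lid_tmul, ite_smul, one_smul,
    zero_smul, Finset.sum_ite_eq', Finset.mem_univ, if_true] at h1
  rw [← h1, ← sum_coords e (ofMatrix e M (star (e j))), map_sum, map_sum]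
  refine S.sum_mem fun k _ => ?_
  rw [LinearMap.rTensor_tmul, TensorProduct.lid_tmul, coords_ofMatrix]
  exact S.smul_mem _ (S.sum_mem fun l _ => S.smul_mem _ (hS k l))

/-- The free `*`-algebra on the entries of a matrix of size `n`. -/
abbrev MatrixAlg (n : ℕ) : Type u := FreeStar (ULift.{u} (Fin n × Fin n))

variable (n) in
/-- The matrix of the free generators. -/
def genMatrix : Matrix (Fin n) (Fin n) (MatrixAlg.{u} n) :=
  Matrix.of fun i j => FreeStar.of ⟨(i, j)⟩

/-- A family of automorphisms with values in a C*-algebra, presented by the `*`-homomorphism that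
maps the free generators to the entries of its coefficient matrix. -/
structure FamRep {A : Type v} [Ring A] [StarRing A] [HopfAlgebra ℂ A] [FiniteQuantumGroup A]
    {n : ℕ} (e : Module.Basis (Fin n) ℂ A) where
  carrier : Type u
  [cstar : CStarAlgebra carrier]
  hom : MatrixAlg.{u} n →⋆ₐ[ℂ] carrier
  isPreFamily : IsPreFamily (ofMatrix e ((genMatrix.{u} n).map hom))

attribute [instance] FamRep.cstar

/-- The elements with a uniform bound form a subalgebra, which contains the generators because a
unitary matrix has entries of norm at most one. -/
theorem bddAbove_famRep (he : ∀ i j, haar A (star (e i) * e j) = if i = j then 1 else 0)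
    (x : MatrixAlg.{u} n) : BddAbove (Set.range fun F : FamRep.{u} e => ‖F.hom x‖) := by
  let S : Subalgebra ℂ (MatrixAlg.{u} n) :=
    { carrier := {x | ∃ K : ℝ, ∀ F : FamRep.{u} e, ‖F.hom x‖ ≤ K}
      mul_mem' := by
        rintro x y ⟨K, hK⟩ ⟨L, hL⟩
        refine ⟨K * L, fun F => ?_⟩
        rw [map_mul]
        exact (norm_mul_le _ _).trans (mul_le_mul (hK F) (hL F) (norm_nonneg _)
          ((norm_nonneg _).trans (hK F)))
      add_mem' := by
        rintro x y ⟨K, hK⟩ ⟨L, hL⟩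
        refine ⟨K + L, fun F => ?_⟩
        rw [map_add]
        exact (norm_add_le _ _).trans (add_le_add (hK F) (hL F))
      algebraMap_mem' := fun r => by
        refine ⟨‖r‖, fun F => ?_⟩
        rw [AlgHomClass.commutes, Algebra.algebraMap_eq_smul_one]
        refine (norm_smul_le _ _).trans (mul_le_of_le_one_right (norm_nonneg r) ?_)
        exact norm_le_one_of_star_mul_self_sum (ι := Unit) (c := fun _ => (1 : F.carrier))
          (by simp) () }
  have hS : x ∈ S := by
    have h : ∀ i, ∀ F : FamRep.{u} e, ‖F.hom (FreeStar.of i)‖ ≤ 1 := by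
      intro i F
      have h1 := (F.isPreFamily.unitary he).1
      have h2 : (star ((genMatrix.{u} n).map F.hom) * (genMatrix.{u} n).map F.hom)
          i.down.2 i.down.2 = (1 : Matrix (Fin n) (Fin n) F.carrier) i.down.2 i.down.2 := by
        rw [h1]
      rw [Matrix.mul_apply, Matrix.one_apply_eq] at h2
      exact norm_le_one_of_star_mul_self_sum h2 i.down.1
    refine FreeStar.mem_of_gen S (fun i => ⟨1, h i⟩) (fun i => ⟨1, fun F => ?_⟩) x
    rw [map_star, norm_star]
    exact h i F
  obtain ⟨K, hK⟩ := hS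
  exact ⟨K, by rintro _ ⟨F, rfl⟩; exact hK F⟩

/-- The largest C*-seminorm on the free `*`-algebra that is compatible with all families of
automorphisms; completing with respect to it imposes exactly the relations that hold in all of
them. The supremum ranges over all C*-algebras of the universe at hand, and needs no restriction of
size because it is taken in `ℝ`. -/
def univSeminorm (he : ∀ i j, haar A (star (e i) * e j) = if i = j then 1 else 0) :
    CStarSeminorm (MatrixAlg.{u} n) :=
  have hle : ∀ x (F : FamRep.{u} e), ‖F.hom x‖ ≤ ⨆ F : FamRep.{u} e, ‖F.hom x‖ :=
    fun x F => le_ciSup (bddAbove_famRep he x) F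
  have hnn : ∀ x, 0 ≤ ⨆ F : FamRep.{u} e, ‖F.hom x‖ :=
    fun x => Real.iSup_nonneg fun F => norm_nonneg _
  have hmul : ∀ x y, (⨆ F : FamRep.{u} e, ‖F.hom (x * y)‖) ≤
      (⨆ F : FamRep.{u} e, ‖F.hom x‖) * ⨆ F : FamRep.{u} e, ‖F.hom y‖ := fun x y =>
    Real.iSup_le (fun F => by
      rw [map_mul]
      exact (norm_mul_le _ _).trans (mul_le_mul (hle x F) (hle y F) (norm_nonneg _) (hnn x)))
      (mul_nonneg (hnn x) (hnn y))
  { toFun := fun x => ⨆ F : FamRep.{u} e, ‖F.hom x‖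
    add_le := fun x y => Real.iSup_le (fun F => by
      rw [map_add]
      exact (norm_add_le _ _).trans (add_le_add (hle x F) (hle y F))) (add_nonneg (hnn x) (hnn y))
    smul_eq := fun c x => by
      rw [Real.mul_iSup_of_nonneg (norm_nonneg c)]
      exact congrArg iSup (funext fun F => by rw [map_smul, norm_smul])
    mul_le := hmul
    star_mul_self := fun x => by
      have hstar : (⨆ F : FamRep.{u} e, ‖F.hom (star x)‖) = ⨆ F : FamRep.{u} e, ‖F.hom x‖ :=
        congrArg iSup (funext fun F => by rw [map_star, norm_star])
      refine le_antisymm ((hmul _ _).trans (by rw [hstar])) ?_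
      -- The C*-identity in each algebra gives `‖x‖ ≤ √‖x*x‖` for the supremum.
      have h1 : (⨆ F : FamRep.{u} e, ‖F.hom x‖) ≤
          √(⨆ F : FamRep.{u} e, ‖F.hom (star x * x)‖) :=
        Real.iSup_le (fun F => Real.le_sqrt_of_sq_le <| by
          refine le_trans (le_of_eq ?_) (hle (star x * x) F)
          rw [map_mul, map_star, CStarRing.norm_star_mul_self, sq]) (Real.sqrt_nonneg _)
      calc _ ≤ √(⨆ F : FamRep.{u} e, ‖F.hom (star x * x)‖) *
            √(⨆ F : FamRep.{u} e, ‖F.hom (star x * x)‖) :=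
            mul_le_mul h1 h1 (hnn x) (Real.sqrt_nonneg _)
        _ = _ := Real.mul_self_sqrt (hnn _) }

variable (he : ∀ i j, haar A (star (e i) * e j) = if i = j then 1 else 0)

theorem hom_le_univSeminorm (F : FamRep.{u} e) (x : MatrixAlg.{u} n) :
    ‖F.hom x‖ ≤ (univSeminorm.{u} he).toFun x :=
  le_ciSup (bddAbove_famRep he x) F

/-- The C*-algebra generated by the coefficients of the universal family of automorphisms. -/
def UnivAlg : Type u := (univSeminorm.{u} he).Completion

instance : CStarAlgebra (UnivAlg.{u} he) :=
  inferInstanceAs (CStarAlgebra (univSeminorm.{u} he).Completion)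

/-- The canonical `*`-homomorphism from the free `*`-algebra. -/
def univHom : MatrixAlg.{u} n →⋆ₐ[ℂ] UnivAlg.{u} he := (univSeminorm.{u} he).ι

theorem denseRange_univHom : DenseRange (univHom.{u} he) :=
  (univSeminorm.{u} he).denseRange_toCompl

theorem exists_univHom_lift (F : FamRep.{u} e) :
    ∃ Λ : UnivAlg.{u} he →⋆ₐ[ℂ] F.carrier, ∀ x, Λ (univHom.{u} he x) = F.hom x :=
  ⟨CStarSeminorm.lift F.hom (hom_le_univSeminorm he F),
    CStarSeminorm.lift_ι F.hom (hom_le_univSeminorm he F)⟩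

theorem univHom_eq_of_forall {x y : MatrixAlg.{u} n}
    (h : ∀ F : FamRep.{u} e, F.hom x = F.hom y) : univHom.{u} he x = univHom.{u} he y := by
  rw [← sub_eq_zero, ← map_sub, ← norm_eq_zero]
  refine ((univSeminorm.{u} he).norm_toCompl (x - y)).trans ?_
  change (⨆ F : FamRep.{u} e, ‖F.hom (x - y)‖) = 0
  simp [map_sub, h]

/-- The coefficient matrix of the universal family. -/
def univMatrix : Matrix (Fin n) (Fin n) (UnivAlg.{u} he) := (genMatrix.{u} n).map (univHom.{u} he)

theorem isPreFamily_univ : IsPreFamily (ofMatrix e (univMatrix.{u} he)) :=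
  isPreFamily_of_forall he _ _ (fun F : FamRep.{u} e => F.hom)
    (fun _ _ => univHom_eq_of_forall he) fun F => F.isPreFamily

theorem dense_of_univMatrix_mem (S : Subalgebra ℂ (UnivAlg.{u} he))
    (hS : ∀ i j, univMatrix.{u} he i j ∈ S) : Dense (S : Set (UnivAlg.{u} he)) := by
  have h1 : ∀ x, univHom.{u} he x ∈ S := fun x =>
    FreeStar.mem_of_gen (S.comap (univHom.{u} he : MatrixAlg.{u} n →ₐ[ℂ] UnivAlg.{u} he))
      (fun i => hS i.down.1 i.down.2)
      (fun i => by
        change univHom.{u} he (star (FreeStar.of i)) ∈ S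
        rw [map_star]
        exact star_coeff_mem he (isPreFamily_univ.{u} he) (Subalgebra.toSubmodule S) hS
          i.down.1 i.down.2) x
  exact (denseRange_univHom.{u} he).mono (by rintro _ ⟨x, rfl⟩; exact h1 x)

/-- The universal family is final: a family `γ` is represented by its coefficient matrix, which
extends to the completion, and the extension is determined by its values on the coefficients. -/
theorem isFinalAutFamily_univ : IsFinalAutFamily (ofMatrix e (univMatrix.{u} he)) where
  isAutFamily := isAutFamily_iff_isPreFamily.2 (isPreFamily_univ he)
  existsUnique C _ γ hγ := by
    rw [isAutFamily_iff_isPreFamily] at hγ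
    let f : MatrixAlg.{u} n →⋆ₐ[ℂ] C := FreeStar.lift fun i => coeffMatrix e γ i.down.1 i.down.2
    have hf : (genMatrix.{u} n).map f = coeffMatrix e γ := by
      ext i j
      exact FreeStar.lift_of _ _
    have hfγ : ofMatrix e ((genMatrix.{u} n).map f) = γ := by rw [hf, ofMatrix_coeffMatrix]
    obtain ⟨Λ, hΛ⟩ : ∃ Λ : UnivAlg.{u} he →⋆ₐ[ℂ] C, ∀ x, Λ (univHom.{u} he x) = f x :=
      exists_univHom_lift he ⟨C, f, by rw [hfγ]; exact hγ⟩
    have hcomp : ∀ Θ : UnivAlg.{u} he →⋆ₐ[ℂ] C,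
        LinearMap.lTensor A (Θ : UnivAlg.{u} he →ₗ[ℂ] C) ∘ₗ
        ofMatrix e (univMatrix.{u} he) = ofMatrix e ((univMatrix.{u} he).map Θ) := fun Θ =>
      lTensor_comp_ofMatrix e (Θ : UnivAlg.{u} he →ₗ[ℂ] C) _
    have h1 : (univMatrix.{u} he).map Λ = (genMatrix.{u} n).map f := by
      ext i j
      exact hΛ _
    refine ⟨Λ, fun a => ?_, fun Θ hΘ => ?_⟩
    · have h2 := hcomp Λ
      rw [h1, hfγ] at h2
      exact (LinearMap.congr_fun h2 a).symm
    · have h2 : ofMatrix e ((univMatrix.{u} he).map Θ) = γ := by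
        rw [← hcomp]
        exact LinearMap.ext fun a => (hΘ a).symm
      have h3 := congrArg (coeffMatrix e) h2
      rw [coeffMatrix_ofMatrix, ← hf, ← h1] at h3
      let S : Subalgebra ℂ (UnivAlg.{u} he) := AlgHom.equalizer
        (Θ : UnivAlg.{u} he →ₐ[ℂ] C) (Λ : UnivAlg.{u} he →ₐ[ℂ] C)
      have hS : Dense (S : Set (UnivAlg.{u} he)) :=
        dense_of_univMatrix_mem he S fun i j => congrFun (congrFun h3 i) j
      have hc : Continuous Θ := continuous_starAlgHom Θ
      have hc' : Continuous Λ := continuous_starAlgHom Λ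
      exact DFunLike.coe_injective (hc.ext_on hS hc' fun x hx => hx)

end universal

/-! ### The compact quantum group structure -/

section spatialLegs

variable {B C D : Type u} [CStarAlgebra B] [CStarAlgebra C] [CStarAlgebra D]

theorem SpatialTensor.tmul_mul_tmul (a b : B) (c d : C) :
    SpatialTensor.tmul a c * SpatialTensor.tmul b d = SpatialTensor.tmul (a * b) (c * d) := by
  change SpatialTensor.ofAlg B C _ * SpatialTensor.ofAlg B C _ = SpatialTensor.ofAlg B C _
  rw [← map_mul, Algebra.TensorProduct.tmul_mul_tmul]

variable (B C) in
/-- The embedding `b ↦ b ⊗ 1`. -/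
def inLeft : B →⋆ₐ[ℂ] SpatialTensor B C :=
  (SpatialTensor.ofAlg B C).comp
    { (Algebra.TensorProduct.includeLeft : B →ₐ[ℂ] B ⊗[ℂ] C) with
      map_star' := fun b => by
        change star b ⊗ₜ[ℂ] (1 : C) = star (b ⊗ₜ[ℂ] (1 : C))
        rw [TensorProduct.star_tmul, star_one] }

theorem inLeft_apply (b : B) : inLeft B C b = SpatialTensor.tmul b 1 := rfl

variable (B C) in
/-- The embedding `c ↦ 1 ⊗ c`. -/
def inRight : C →⋆ₐ[ℂ] SpatialTensor B C :=
  (SpatialTensor.ofAlg B C).comp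
    { (Algebra.TensorProduct.includeRight : C →ₐ[ℂ] B ⊗[ℂ] C) with
      map_star' := fun c => by
        change (1 : B) ⊗ₜ[ℂ] star c = star ((1 : B) ⊗ₜ[ℂ] c)
        rw [TensorProduct.star_tmul, star_one] }

theorem inRight_apply (c : C) : inRight B C c = SpatialTensor.tmul 1 c := rfl

theorem inLeft_mul_inRight (b : B) (c : C) :
    inLeft B C b * inRight B C c = SpatialTensor.tmul b c := by
  rw [inLeft_apply, inRight_apply, SpatialTensor.tmul_mul_tmul, mul_one, one_mul]

theorem inRight_mul_inLeft (b : B) (c : C) :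
    inRight B C c * inLeft B C b = SpatialTensor.tmul b c := by
  rw [inLeft_apply, inRight_apply, SpatialTensor.tmul_mul_tmul, mul_one, one_mul]

theorem dense_of_tmul_mem (P : Submodule ℂ (SpatialTensor B C))
    (h : ∀ b c, SpatialTensor.tmul b c ∈ closure (P : Set (SpatialTensor B C))) :
    Dense (P : Set (SpatialTensor B C)) := by
  have h1 : ∀ t : B ⊗[ℂ] C, SpatialTensor.ofAlg B C t ∈ P.topologicalClosure := by
    intro t
    induction t with
    | zero => rw [map_zero]; exact Submodule.zero_mem _
    | add s t hs ht => rw [map_add]; exact Submodule.add_mem _ hs ht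
    | tmul b c => exact h b c
  have h2 : DenseRange (SpatialTensor.ofAlg B C) := (spatialSeminorm B C).denseRange_toCompl
  have h3 : Dense (P.topologicalClosure : Set (SpatialTensor B C)) :=
    h2.mono (by rintro _ ⟨t, rfl⟩; exact h1 t)
  rw [Submodule.topologicalClosure_coe] at h3
  exact dense_closure.1 h3

/-- The graph of the algebraic associativity isomorphism, as a subalgebra. -/
def assocGraph (B C D : Type u) [CStarAlgebra B] [CStarAlgebra C] [CStarAlgebra D] :
    Subalgebra ℂ (SpatialTensor (SpatialTensor B C) D × SpatialTensor B (SpatialTensor C D)) :=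
  AlgHom.range (AlgHom.prod
    ((SpatialTensor.ofAlg (SpatialTensor B C) D :
      SpatialTensor B C ⊗[ℂ] D →ₐ[ℂ] SpatialTensor (SpatialTensor B C) D).comp
      (Algebra.TensorProduct.map (SpatialTensor.ofAlg B C : B ⊗[ℂ] C →ₐ[ℂ] SpatialTensor B C)
        (AlgHom.id ℂ D)))
    ((SpatialTensor.ofAlg B (SpatialTensor C D) :
      B ⊗[ℂ] SpatialTensor C D →ₐ[ℂ] SpatialTensor B (SpatialTensor C D)).comp
      ((Algebra.TensorProduct.map (AlgHom.id ℂ B)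
        (SpatialTensor.ofAlg C D : C ⊗[ℂ] D →ₐ[ℂ] SpatialTensor C D)).comp
        (Algebra.TensorProduct.assoc ℂ ℂ ℂ B C D).toAlgHom)))

theorem assocRel_iff (x : SpatialTensor (SpatialTensor B C) D)
    (y : SpatialTensor B (SpatialTensor C D)) :
    SpatialTensor.AssocRel x y ↔ (x, y) ∈ (assocGraph B C D).topologicalClosure :=
  Iff.rfl

theorem tmul_mem_assocGraph (b : B) (c : C) (d : D) :
    (SpatialTensor.tmul (SpatialTensor.tmul b c) d, SpatialTensor.tmul b (SpatialTensor.tmul c d)) ∈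
      assocGraph B C D :=
  ⟨(b ⊗ₜ c) ⊗ₜ d, rfl⟩

theorem SpatialTensor.tmul_sum {κ : Type*} (s : Finset κ) (b : B) (c : κ → C) :
    SpatialTensor.tmul b (∑ k ∈ s, c k) = ∑ k ∈ s, SpatialTensor.tmul b (c k) := by
  simp only [SpatialTensor.tmul, TensorProduct.tmul_sum, map_sum]

theorem SpatialTensor.sum_tmul {κ : Type*} (s : Finset κ) (b : κ → B) (c : C) :
    SpatialTensor.tmul (∑ k ∈ s, b k) c = ∑ k ∈ s, SpatialTensor.tmul (b k) c := by
  simp only [SpatialTensor.tmul, TensorProduct.sum_tmul, map_sum]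

end spatialLegs

section matrixCoproduct

variable {B : Type u} [CStarAlgebra B] {n : ℕ} {M : Matrix (Fin n) (Fin n) B}
  {Δ : B →⋆ₐ[ℂ] SpatialTensor B B}

/-- A coproduct of the form `Δ(u i j) = ∑ k, u i k ⊗ u k j` on topological generators is
coassociative. -/
theorem assocRel_of_matrix (hgen : ∀ S : Subalgebra ℂ B, (∀ i j, M i j ∈ S) → Dense (S : Set B))
    (hΔ : ∀ i j, Δ (M i j) = ∑ k, SpatialTensor.tmul (M i k) (M k j)) (a : B) :
    SpatialTensor.AssocRel (SpatialTensor.map Δ (StarAlgHom.id ℂ B) (Δ a))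
      (SpatialTensor.map (StarAlgHom.id ℂ B) Δ (Δ a)) := by
  let F : B →⋆ₐ[ℂ] _ := (SpatialTensor.map Δ (StarAlgHom.id ℂ B)).comp Δ
  let G : B →⋆ₐ[ℂ] _ := (SpatialTensor.map (StarAlgHom.id ℂ B) Δ).comp Δ
  have hF : ∀ i j, F (M i j) = ∑ k, ∑ l,
      SpatialTensor.tmul (SpatialTensor.tmul (M i l) (M l k)) (M k j) := fun i j => by
    change SpatialTensor.map Δ (StarAlgHom.id ℂ B) (Δ (M i j)) = _
    rw [hΔ, map_sum]
    refine Finset.sum_congr rfl fun k _ => ?_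
    rw [SpatialTensor.map_tmul, hΔ, SpatialTensor.sum_tmul]
    rfl
  have hG : ∀ i j, G (M i j) = ∑ k, ∑ l,
      SpatialTensor.tmul (M i l) (SpatialTensor.tmul (M l k) (M k j)) := fun i j => by
    change SpatialTensor.map (StarAlgHom.id ℂ B) Δ (Δ (M i j)) = _
    rw [hΔ, map_sum, Finset.sum_comm]
    refine Finset.sum_congr rfl fun k _ => ?_
    rw [SpatialTensor.map_tmul, hΔ, SpatialTensor.tmul_sum]
    rfl
  let S : Subalgebra ℂ B := (assocGraph B B B).topologicalClosure.comap
    (AlgHom.prod (F : B →ₐ[ℂ] _) (G : B →ₐ[ℂ] _))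
  have hmem : ∀ a, a ∈ S ↔ (F a, G a) ∈ (assocGraph B B B).topologicalClosure := fun _ => Iff.rfl
  have hS : Dense (S : Set B) := hgen S fun i j => by
    rw [hmem, hF, hG]
    have h : ((∑ k, ∑ l, SpatialTensor.tmul (SpatialTensor.tmul (M i l) (M l k)) (M k j)),
        (∑ k, ∑ l, SpatialTensor.tmul (M i l) (SpatialTensor.tmul (M l k) (M k j)))) =
        ∑ k, ∑ l, (SpatialTensor.tmul (SpatialTensor.tmul (M i l) (M l k)) (M k j),
          SpatialTensor.tmul (M i l) (SpatialTensor.tmul (M l k) (M k j))) := by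
      simp only [Prod.ext_iff, Prod.fst_sum, Prod.snd_sum, and_self]
    rw [h]
    exact Subalgebra.le_topologicalClosure _ (Subalgebra.sum_mem _ fun k _ =>
      Subalgebra.sum_mem _ fun l _ => tmul_mem_assocGraph _ _ _)
  have hc : IsClosed (S : Set B) := (Subalgebra.isClosed_topologicalClosure _).preimage
    ((continuous_starAlgHom F).prodMk (continuous_starAlgHom G))
  have ha : a ∈ (S : Set B) := by
    have := hS a
    rwa [hc.closure_eq] at this
  exact (assocRel_iff _ _).2 ((hmem a).1 ha)

/-- Density of `Δ(B)(1 ⊗ B)`: the elements `x` with `x ⊗ 1` in the span form an algebra, which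
contains the generators because `∑ j, Δ(u i j)(1 ⊗ (u k j)*) = u i k ⊗ 1`. -/
theorem dense_comul_mul_right
    (hgen : ∀ S : Subalgebra ℂ B, (∀ i j, M i j ∈ S) → Dense (S : Set B))
    (hΔ : ∀ i j, Δ (M i j) = ∑ k, SpatialTensor.tmul (M i k) (M k j)) (hM : M * star M = 1) :
    Dense (Submodule.span ℂ {x | ∃ a b : B, x = Δ a * SpatialTensor.tmul 1 b} :
      Set (SpatialTensor B B)) := by
  set P := Submodule.span ℂ {x | ∃ a b : B, x = Δ a * SpatialTensor.tmul 1 b} with hP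
  have hr : ∀ x ∈ P, ∀ b, x * inRight B B b ∈ P := fun x hx b => by
    refine Submodule.span_induction (p := fun x _ => x * inRight B B b ∈ P) ?_ ?_ ?_ ?_ hx
    · rintro _ ⟨a, c, rfl⟩
      refine Submodule.subset_span ⟨a, c * b, ?_⟩
      rw [← inRight_apply, ← inRight_apply, map_mul, mul_assoc]
    · simp
    · intro x y _ _ hx hy
      rw [add_mul]
      exact P.add_mem hx hy
    · intro c x _ hx
      rw [smul_mul_assoc]
      exact P.smul_mem c hx
  have hl : ∀ x ∈ P, ∀ a, Δ a * x ∈ P := fun x hx a => by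
    refine Submodule.span_induction (p := fun x _ => Δ a * x ∈ P) ?_ ?_ ?_ ?_ hx
    · rintro _ ⟨c, b, rfl⟩
      refine Submodule.subset_span ⟨a * c, b, ?_⟩
      rw [map_mul, mul_assoc]
    · simp
    · intro x y _ _ hx hy
      rw [mul_add]
      exact P.add_mem hx hy
    · intro c x _ hx
      rw [mul_smul_comm]
      exact P.smul_mem c hx
  have hmul : ∀ x ∈ P, ∀ y, inLeft B B y ∈ P → x * inLeft B B y ∈ P := fun x hx y hy => by
    refine Submodule.span_induction (p := fun x _ => x * inLeft B B y ∈ P) ?_ ?_ ?_ ?_ hx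
    · rintro _ ⟨a, b, rfl⟩
      rw [← inRight_apply, mul_assoc, inRight_mul_inLeft, ← inLeft_mul_inRight, ← mul_assoc]
      rw [mul_assoc]
      exact hl _ (hr _ hy b) a
    · simp
    · intro x y _ _ hx hy
      rw [add_mul]
      exact P.add_mem hx hy
    · intro c x _ hx
      rw [smul_mul_assoc]
      exact P.smul_mem c hx
  have hone : (1 : SpatialTensor B B) ∈ P :=
    Submodule.subset_span ⟨1, 1, by rw [map_one, one_mul, ← inRight_apply, map_one]⟩
  let S : Subalgebra ℂ B :=
    { carrier := {x | inLeft B B x ∈ P}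
      mul_mem' := fun {x y} hx hy => by
        change inLeft B B (x * y) ∈ P
        rw [map_mul]
        exact hmul _ hx y hy
      add_mem' := fun {x y} hx hy => by
        change inLeft B B (x + y) ∈ P
        rw [map_add]
        exact P.add_mem hx hy
      algebraMap_mem' := fun c => by
        change inLeft B B (algebraMap ℂ B c) ∈ P
        rw [AlgHomClass.commutes, Algebra.algebraMap_eq_smul_one]
        exact P.smul_mem c hone }
  have hS : Dense (S : Set B) := hgen S fun i k => by
    change inLeft B B (M i k) ∈ P
    have h : inLeft B B (M i k) = ∑ j, Δ (M i j) * SpatialTensor.tmul 1 (star (M k j)) := by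
      have h1 : ∀ l, ∑ j, SpatialTensor.tmul (M i l) (M l j * star (M k j)) =
          if l = k then inLeft B B (M i l) else 0 := fun l => by
        have h2 := congrFun (congrFun hM l) k
        rw [Matrix.mul_apply, Matrix.one_apply] at h2
        rw [← SpatialTensor.tmul_sum]
        simp only [Matrix.star_apply] at h2
        rw [h2]
        split_ifs
        · rfl
        · rw [SpatialTensor.tmul, TensorProduct.tmul_zero, map_zero]
      simp only [hΔ, Finset.sum_mul, SpatialTensor.tmul_mul_tmul, mul_one]
      rw [Finset.sum_comm]
      simp only [h1, Finset.sum_ite_eq', Finset.mem_univ, if_true]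
    rw [h]
    exact P.sum_mem fun j _ => Submodule.subset_span ⟨_, _, rfl⟩
  refine dense_of_tmul_mem P fun b c => ?_
  have hc : Continuous fun x => inLeft B B x * inRight B B c :=
    (continuous_starAlgHom (inLeft B B)).mul continuous_const
  rw [← inLeft_mul_inRight]
  exact map_mem_closure (f := fun x => inLeft B B x * inRight B B c) hc (hS b) fun x hx => hr _ hx c

/-- Density of `(B ⊗ 1)Δ(B)`: the elements `x` with `1 ⊗ x` in the span form an algebra, which
contains the generators because `∑ i, ((u i k)* ⊗ 1)Δ(u i j) = 1 ⊗ u k j`. -/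
theorem dense_comul_mul_left
    (hgen : ∀ S : Subalgebra ℂ B, (∀ i j, M i j ∈ S) → Dense (S : Set B))
    (hΔ : ∀ i j, Δ (M i j) = ∑ k, SpatialTensor.tmul (M i k) (M k j)) (hM : star M * M = 1) :
    Dense (Submodule.span ℂ {x | ∃ a b : B, x = SpatialTensor.tmul a 1 * Δ b} :
      Set (SpatialTensor B B)) := by
  set P := Submodule.span ℂ {x | ∃ a b : B, x = SpatialTensor.tmul a 1 * Δ b} with hP
  have hl : ∀ x ∈ P, ∀ a, inLeft B B a * x ∈ P := fun x hx a => by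
    refine Submodule.span_induction (p := fun x _ => inLeft B B a * x ∈ P) ?_ ?_ ?_ ?_ hx
    · rintro _ ⟨c, b, rfl⟩
      refine Submodule.subset_span ⟨a * c, b, ?_⟩
      rw [← inLeft_apply, ← inLeft_apply, map_mul, mul_assoc]
    · simp
    · intro x y _ _ hx hy
      rw [mul_add]
      exact P.add_mem hx hy
    · intro c x _ hx
      rw [mul_smul_comm]
      exact P.smul_mem c hx
  have hr : ∀ x ∈ P, ∀ a, x * Δ a ∈ P := fun x hx a => by
    refine Submodule.span_induction (p := fun x _ => x * Δ a ∈ P) ?_ ?_ ?_ ?_ hx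
    · rintro _ ⟨c, b, rfl⟩
      refine Submodule.subset_span ⟨c, b * a, ?_⟩
      rw [map_mul, mul_assoc]
    · simp
    · intro x y _ _ hx hy
      rw [add_mul]
      exact P.add_mem hx hy
    · intro c x _ hx
      rw [smul_mul_assoc]
      exact P.smul_mem c hx
  have hmul : ∀ y ∈ P, ∀ x, inRight B B x ∈ P → inRight B B x * y ∈ P := fun y hy x hx => by
    refine Submodule.span_induction (p := fun y _ => inRight B B x * y ∈ P) ?_ ?_ ?_ ?_ hy
    · rintro _ ⟨a, b, rfl⟩
      rw [← inLeft_apply, ← mul_assoc, inRight_mul_inLeft, ← inLeft_mul_inRight]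
      exact hr _ (hl _ hx a) b
    · simp
    · intro x y _ _ hx hy
      rw [mul_add]
      exact P.add_mem hx hy
    · intro c x _ hx
      rw [mul_smul_comm]
      exact P.smul_mem c hx
  have hone : (1 : SpatialTensor B B) ∈ P :=
    Submodule.subset_span ⟨1, 1, by rw [map_one, mul_one, ← inLeft_apply, map_one]⟩
  let S : Subalgebra ℂ B :=
    { carrier := {x | inRight B B x ∈ P}
      mul_mem' := fun {x y} hx hy => by
        change inRight B B (x * y) ∈ P
        rw [map_mul]
        exact hmul _ hy x hx
      add_mem' := fun {x y} hx hy => by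
        change inRight B B (x + y) ∈ P
        rw [map_add]
        exact P.add_mem hx hy
      algebraMap_mem' := fun c => by
        change inRight B B (algebraMap ℂ B c) ∈ P
        rw [AlgHomClass.commutes, Algebra.algebraMap_eq_smul_one]
        exact P.smul_mem c hone }
  have hS : Dense (S : Set B) := hgen S fun k j => by
    change inRight B B (M k j) ∈ P
    have h : inRight B B (M k j) = ∑ i, SpatialTensor.tmul (star (M i k)) 1 * Δ (M i j) := by
      have h1 : ∀ l, ∑ i, SpatialTensor.tmul (star (M i k) * M i l) (M l j) =
          if k = l then inRight B B (M l j) else 0 := fun l => by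
        have h2 := congrFun (congrFun hM k) l
        rw [Matrix.mul_apply, Matrix.one_apply] at h2
        rw [← SpatialTensor.sum_tmul]
        simp only [Matrix.star_apply] at h2
        rw [h2]
        split_ifs
        · rfl
        · rw [SpatialTensor.tmul, TensorProduct.zero_tmul, map_zero]
      simp only [hΔ, Finset.mul_sum, SpatialTensor.tmul_mul_tmul, one_mul]
      rw [Finset.sum_comm]
      simp only [h1, Finset.sum_ite_eq, Finset.mem_univ, if_true]
    rw [h]
    exact P.sum_mem fun j _ => Submodule.subset_span ⟨_, _, rfl⟩
  refine dense_of_tmul_mem P fun b c => ?_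
  have hc : Continuous fun x => inLeft B B b * inRight B B x :=
    continuous_const.mul (continuous_starAlgHom (inRight B B))
  rw [← inLeft_mul_inRight]
  exact map_mem_closure (f := fun x => inLeft B B b * inRight B B x) hc (hS c) fun x hx => hl _ hx b

end matrixCoproduct

section existence

variable {A : Type v} [Ring A] [StarRing A] [HopfAlgebra ℂ A] [FiniteQuantumGroup A] {n : ℕ}
  {e : Module.Basis (Fin n) ℂ A}

/-- The final family acquires its coproduct by applying universality to `(α ⊗ id) ∘ α`. In terms of
the coefficient matrix, `Δ(u i j) = ∑ k, u i k ⊗ u k j`. -/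
theorem exists_isQAut_of_isFinal (he : ∀ i j, haar A (star (e i) * e j) = if i = j then 1 else 0)
    {B : Type u} [CStarAlgebra B] {M : Matrix (Fin n) (Fin n) B}
    (hfin : IsFinalAutFamily (ofMatrix e M))
    (hgen : ∀ S : Subalgebra ℂ B, (∀ i j, M i j ∈ S) → Dense (S : Set B)) :
    ∃ (H : CompactQuantumGroup.{u}) (α : A →ₗ[ℂ] A ⊗[ℂ] H.carrier), IsQAut A H α := by
  have hpre := isAutFamily_iff_isPreFamily.1 hfin.isAutFamily
  obtain ⟨Δ, hΔ, -⟩ := hfin.existsUnique (SpatialTensor B B) _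
    (isAutFamily_iff_isPreFamily.2 ((hpre.comp hpre).push (SpatialTensor.ofAlg B B)))
  have hcoef : ∀ i j, Δ (M i j) = ∑ k, SpatialTensor.tmul (M i k) (M k j) := by
    intro i j
    have h1 := congrFun (congrArg (coords _ e) (hΔ (e j))) i
    rw [idTensor, coords_lTensor, LinearMap.comp_apply, coords_lTensor, famComp_apply,
      ofMatrix_basis, coords_sum, map_sum, map_sum, map_sum] at h1
    rw [Finset.sum_apply, map_sum] at h1
    refine h1.symm.trans (Finset.sum_congr rfl fun k _ => ?_)
    have h2 : TensorProduct.assoc ℂ A B B (LinearMap.rTensor B (ofMatrix e M) (e k ⊗ₜ M k j)) =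
        ∑ i, e i ⊗ₜ (M i k ⊗ₜ[ℂ] M k j) := by
      rw [LinearMap.rTensor_tmul, ofMatrix_basis, TensorProduct.sum_tmul, map_sum]
      rfl
    rw [h2, coords_sum]
    rfl
  exact ⟨{ carrier := B
           comul := Δ
           coassoc := assocRel_of_matrix hgen hcoef
           dense_right := dense_comul_mul_right hgen hcoef (hpre.unitary he).2
           dense_left := dense_comul_mul_left hgen hcoef (hpre.unitary he).1 },
    ofMatrix e M, hfin, fun a => (hΔ a).symm⟩

variable (A) in
theorem exists_isQAut :
    ∃ (H : CompactQuantumGroup.{u}) (α : A →ₗ[ℂ] A ⊗[ℂ] H.carrier), IsQAut A H α := by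
  obtain ⟨e, he⟩ := exists_orthonormal_basis (isHaarState_haar A).nonneg fun _ => haar_faithful
  exact exists_isQAut_of_isFinal he (isFinalAutFamily_univ.{u} he) (dense_of_univMatrix_mem he)

end existence

/-! ### Duality for quantum automorphism groups -/

section duality

variable {A : Type v} [Ring A] [StarRing A] [HopfAlgebra ℂ A] [FiniteQuantumGroup A]

theorem isAutFamily_hat_iff {B : Type u} [CStarAlgebra B] (α : A →ₗ[ℂ] A ⊗[ℂ] B) :
    IsAutFamily (hat α) ↔ IsAutFamily α := by
  rw [isAutFamily_iff_isPreFamily, isAutFamily_iff_isPreFamily]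
  exact isPreFamily_iff_of_fourier (hat_fourier α)

/-- By Fourier inversion, every map on the dual is of the form `α̂`. -/
theorem hat_surjective {B : Type u} [CStarAlgebra B] :
    Function.Surjective (hat : (A →ₗ[ℂ] A ⊗[ℂ] B) → QDual A →ₗ[ℂ] QDual A ⊗[ℂ] B) := by
  intro β
  refine ⟨(LinearEquiv.rTensor B (fourierEquiv A)).symm.toLinearMap ∘ₗ β ∘ₗ fourier A,
    LinearMap.ext fun ω => ?_⟩
  obtain ⟨a, rfl⟩ := (fourierEquiv A).surjective ω
  rw [fourierEquiv_apply, hat_fourier]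
  exact (LinearEquiv.rTensor B (fourierEquiv A)).apply_symm_apply _

theorem eq_idTensor_hat_iff {B C : Type u} [CStarAlgebra B] [CStarAlgebra C]
    (α : A →ₗ[ℂ] A ⊗[ℂ] B) (γ : A →ₗ[ℂ] A ⊗[ℂ] C) (Λ : B →⋆ₐ[ℂ] C) :
    (∀ ω, hat γ ω = idTensor (QDual A) Λ (hat α ω)) ↔ ∀ a, γ a = idTensor A Λ (α a) := by
  have hsurj : Function.Surjective (fourier A) := (fourierEquiv A).surjective
  rw [hsurj.forall]
  refine forall_congr' fun a => ?_
  rw [hat_fourier, hat_fourier, idTensor, lTensor_rTensor, rTensor_fourier_injective.eq_iff]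

/-- If `(B, α)` is final for a finite quantum group, then `(B, α̂)` is final for its dual. -/
theorem IsFinalAutFamily.hat {B : Type u} [CStarAlgebra B] {α : A →ₗ[ℂ] A ⊗[ℂ] B}
    (hα : IsFinalAutFamily α) : IsFinalAutFamily (hat α) where
  isAutFamily := (isAutFamily_hat_iff α).2 hα.isAutFamily
  existsUnique C _ γ hγ := by
    obtain ⟨δ, rfl⟩ := hat_surjective γ
    simpa only [eq_idTensor_hat_iff] using hα.existsUnique C δ ((isAutFamily_hat_iff δ).1 hγ)

theorem assoc_rTensor_hat {B C : Type u} [CStarAlgebra B] [CStarAlgebra C]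
    (α : A →ₗ[ℂ] A ⊗[ℂ] B) (t : A ⊗[ℂ] C) :
    TensorProduct.assoc ℂ (QDual A) B C
      (LinearMap.rTensor C (QuantumAut.hat α) (LinearMap.rTensor C (fourier A) t)) =
      LinearMap.rTensor (B ⊗[ℂ] C) (fourier A)
        (TensorProduct.assoc ℂ A B C (LinearMap.rTensor C α t)) := by
  induction t with
  | zero => simp
  | add s t hs ht => simp only [map_add, hs, ht]
  | tmul a c =>
    rw [LinearMap.rTensor_tmul, LinearMap.rTensor_tmul, LinearMap.rTensor_tmul, hat_fourier]
    induction α a with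
    | zero => simp
    | add s t hs ht => simp only [TensorProduct.add_tmul, map_add, hs, ht]
    | tmul x b => simp

theorem ActionEquation.hat {H : CompactQuantumGroup.{u}} {α : A →ₗ[ℂ] A ⊗[ℂ] H.carrier}
    (hα : ActionEquation H α) : ActionEquation H (hat α) := by
  intro ω
  obtain ⟨a, rfl⟩ := (fourierEquiv A).surjective ω
  rw [fourierEquiv_apply, hat_fourier, assoc_rTensor_hat, idTensor, lTensor_rTensor,
    lTensor_rTensor]
  exact congrArg _ (hα a)

theorem IsQAut.hat {H : CompactQuantumGroup.{u}} {α : A →ₗ[ℂ] A ⊗[ℂ] H.carrier}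
    (hα : IsQAut A H α) : IsQAut (QDual A) H (hat α) :=
  ⟨hα.isFinal.hat, hα.action.hat⟩

end duality

section uniqueness

theorem idTensor_comp {A : Type v} [Ring A] [HopfAlgebra ℂ A] {B C D : Type u} [CStarAlgebra B]
    [CStarAlgebra C] [CStarAlgebra D]
    (f : C →⋆ₐ[ℂ] D) (g : B →⋆ₐ[ℂ] C) (t : A ⊗[ℂ] B) :
    idTensor A (f.comp g) t = idTensor A f (idTensor A g t) := by
  change LinearMap.lTensor A ((f : C →ₗ[ℂ] D) ∘ₗ (g : B →ₗ[ℂ] C)) t = _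
  rw [LinearMap.lTensor_comp]
  rfl

theorem idTensor_id {A : Type v} [Ring A] [HopfAlgebra ℂ A] {B : Type u} [CStarAlgebra B]
    (t : A ⊗[ℂ] B) :
    idTensor A (StarAlgHom.id ℂ B) t = t :=
  LinearMap.lTensor_id_apply A B t

variable {A : Type v} [Ring A] [StarRing A] [HopfAlgebra ℂ A] [StarModule ℂ A]

theorem IsFinalAutFamily.hom_ext {B C : Type u} [CStarAlgebra B] [CStarAlgebra C]
    {α : A →ₗ[ℂ] A ⊗[ℂ] B} (hα : IsFinalAutFamily α) {f g : B →⋆ₐ[ℂ] C}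
    (h : ∀ a, idTensor A f (α a) = idTensor A g (α a)) : f = g := by
  have hγ : IsAutFamily (idTensor A f ∘ₗ α) :=
    isAutFamily_iff_isPreFamily.2 ((isAutFamily_iff_isPreFamily.1 hα.isAutFamily).push f)
  exact (hα.existsUnique C _ hγ).unique (fun a => rfl) h

/-- Two final families are isomorphic. -/
theorem IsFinalAutFamily.exists_equiv {B C : Type u} [CStarAlgebra B] [CStarAlgebra C]
    {α : A →ₗ[ℂ] A ⊗[ℂ] B} {β : A →ₗ[ℂ] A ⊗[ℂ] C} (hα : IsFinalAutFamily α)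
    (hβ : IsFinalAutFamily β) :
    ∃ Φ : B ≃⋆ₐ[ℂ] C, ∀ a, β a = idTensor A (Φ : B →⋆ₐ[ℂ] C) (α a) := by
  obtain ⟨f, hf, -⟩ := hα.existsUnique C β hβ.isAutFamily
  obtain ⟨g, hg, -⟩ := hβ.existsUnique B α hα.isAutFamily
  have hgf : g.comp f = StarAlgHom.id ℂ B := hα.hom_ext fun a => by
    rw [idTensor_comp, ← hf, ← hg, idTensor_id]
  have hfg : f.comp g = StarAlgHom.id ℂ C := hβ.hom_ext fun a => by
    rw [idTensor_comp, ← hg, ← hf, idTensor_id]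
  refine ⟨StarAlgEquiv.ofStarAlgHom f g hgf hfg, fun a => ?_⟩
  exact hf a

/-- The isomorphism between two quantum automorphism groups intertwines the coproducts, because
both `Δ ∘ Φ` and `(Φ ⊗ Φ) ∘ Δ` induce the family `(β ⊗ id) ∘ β`. -/
theorem IsQAut.isCQGIso {H K : CompactQuantumGroup.{u}} {α : A →ₗ[ℂ] A ⊗[ℂ] H.carrier}
    {β : A →ₗ[ℂ] A ⊗[ℂ] K.carrier} (hα : IsQAut A H α) (hβ : IsQAut A K β)
    (Φ : H.carrier ≃⋆ₐ[ℂ] K.carrier)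
    (hΦ : ∀ a, β a = idTensor A (Φ : H.carrier →⋆ₐ[ℂ] K.carrier) (α a)) : IsCQGIso H K Φ := by
  let φ : H.carrier →⋆ₐ[ℂ] K.carrier := Φ
  have hφ : ∀ a, β a = idTensor A φ (α a) := hΦ
  have key : K.comul.comp φ = (SpatialTensor.map φ φ).comp H.comul := by
    refine hα.isFinal.hom_ext fun a => ?_
    rw [idTensor_comp, idTensor_comp, ← hφ, hβ.action, hα.action]
    have h1 : ∀ t : A ⊗[ℂ] H.carrier, LinearMap.lTensor A
        (SpatialTensor.ofAlg K.carrier K.carrier :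
          K.carrier ⊗[ℂ] K.carrier →ₗ[ℂ] SpatialTensor K.carrier K.carrier)
        (TensorProduct.assoc ℂ A K.carrier K.carrier
          (LinearMap.rTensor K.carrier β (idTensor A φ t))) =
        idTensor A (SpatialTensor.map φ φ) (LinearMap.lTensor A
          (SpatialTensor.ofAlg H.carrier H.carrier :
            H.carrier ⊗[ℂ] H.carrier →ₗ[ℂ] SpatialTensor H.carrier H.carrier)
          (TensorProduct.assoc ℂ A H.carrier H.carrier (LinearMap.rTensor H.carrier α t))) := by
      intro t
      induction t with
      | zero => simp
      | add s t hs ht => simp only [map_add, hs, ht]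
      | tmul x b =>
        rw [idTensor, LinearMap.lTensor_tmul, LinearMap.rTensor_tmul, LinearMap.rTensor_tmul, hφ]
        induction α x with
        | zero => simp
        | add s t hs ht => simp only [TensorProduct.add_tmul, map_add, hs, ht]
        | tmul y c =>
          simp only [idTensor, LinearMap.lTensor_tmul, TensorProduct.assoc_tmul]
          exact congrArg _ (SpatialTensor.map_tmul φ φ c b).symm
    rw [hφ a]
    exact h1 _
  exact fun x => DFunLike.congr_fun key x

end uniqueness

end QuantumAut

end

theorem mainTheorem2 {A : Type v} [Ring A] [StarRing A] [HopfAlgebra ℂ A]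
    [QuantumAut.FiniteQuantumGroup A] :
    (∃ (H : QuantumAut.CompactQuantumGroup.{u}) (α : A →ₗ[ℂ] A ⊗[ℂ] H.carrier),
      QuantumAut.IsQAut A H α) ∧
    (∃ (K : QuantumAut.CompactQuantumGroup.{u})
      (β : QuantumAut.QDual A →ₗ[ℂ] QuantumAut.QDual A ⊗[ℂ] K.carrier),
      QuantumAut.IsQAut (QuantumAut.QDual A) K β) ∧
    ∀ (H : QuantumAut.CompactQuantumGroup.{u}) (α : A →ₗ[ℂ] A ⊗[ℂ] H.carrier)
      (K : QuantumAut.CompactQuantumGroup.{u})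
      (β : QuantumAut.QDual A →ₗ[ℂ] QuantumAut.QDual A ⊗[ℂ] K.carrier),
      QuantumAut.IsQAut A H α → QuantumAut.IsQAut (QuantumAut.QDual A) K β →
      ∃ Φ : H.carrier ≃⋆ₐ[ℂ] K.carrier,
        QuantumAut.IsCQGIso H K Φ ∧
        (∀ ω, β ω = QuantumAut.idTensor (QuantumAut.QDual A)
          (Φ : H.carrier →⋆ₐ[ℂ] K.carrier) (QuantumAut.hat α ω)) ∧
        ∀ Ψ : H.carrier →⋆ₐ[ℂ] K.carrier,
          (∀ ω, β ω = QuantumAut.idTensor (QuantumAut.QDual A) Ψ (QuantumAut.hat α ω)) →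
          Ψ = (Φ : H.carrier →⋆ₐ[ℂ] K.carrier) := by
  obtain ⟨H₀, α₀, h₀⟩ := QuantumAut.exists_isQAut.{u} A
  refine ⟨⟨H₀, α₀, h₀⟩, ⟨H₀, QuantumAut.hat α₀, h₀.hat⟩, fun H α K β hα hβ => ?_⟩
  obtain ⟨Φ, hΦ⟩ := hα.hat.isFinal.exists_equiv hβ.isFinal
  exact ⟨Φ, hα.hat.isCQGIso hβ Φ hΦ, hΦ, fun Ψ hΨ =>
    hα.hat.isFinal.hom_ext fun ω => (hΨ ω).symm.trans (hΦ ω)⟩
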